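/- Fix two smooth nonnegative functions $\chi,\varphi$ on $\mathbb R^2$ with $\operatorname{Supp}\chi\subset\{|\xi|\le 4/3\}$, $\operatorname{Supp}\varphi\subset\{3/4\le|\xi|\le 8/3\}$ and $\chi(\xi)+\sum_{q\ge 0}\varphi(2^{-q}\xi)=1$ for all $\xi$. For a tempered distribution $u$ on $\mathbb R^2$ set $\Delta_q u=0$ for $q\le -2$, $\Delta_{-1}u=\chi(D)u$, $\Delta_q u=\varphi(2^{-q}D)u$ for $q\ge 0$, $S_q u=\sum_{p\le q-1}\Delta_p u$, and $\|u\|_{B^s_{2,\infty}}=\sup_{q\ge -1}2^{qs}\|\Delta_q u\|_{L^2}$; $B^s_{2,\infty}$ is the set of those $u$ for which this is finite. Let $s\in(-1,1)$. There is a constant $C>0$ depending only on $s$ (and on the fixed couple $(\chi,\varphi)$) such that the following holds. Let $T>0$, let $\rho_0\in B^s_{2,\infty}$ and $f\in L^1([0,T];B^s_{2,\infty})$. Let $v$ be a real time-dependent vector field on $[0,T]\times\mathbb R^2$ with tempered distribution coefficients, integrable in time (i.e. $t\mapsto\langle v^i(t),\theta\rangle$ is in $L^1([0,T])$ for every Schwartz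 function $\theta$), with $\operatorname{div}v=0$, and such that for some nonnegative $V\in L^1([0,T])$ and almost every $t\in[0,T]$, $$\sup_{N\ge 0}\frac{\|\nabla S_N v(t)\|_{L^\infty}}{\sqrt{1+N}}\le V(t).$$ Let $\rho$ be bounded on $[0,T]$ with values in $B^\sigma_{2,\infty}$ for some $\sigma>-1$, and satisfy, in the sense of distributions and weakly continuously in time, $$\partial_t\rho+v\cdot\nabla\rho=f,\qquad \rho|_{t=0}=\rho_0,$$ where $v\cdot\nabla\rho$ is the limit of $S_Nv\cdot\nabla S_N\rho$ in the sense of tempered distributions as $N\to\infty$ (its pairing with each Schwartz function being integrable in time). Then for all $\varepsilon\in(0,(s+1)/2)$ and all $t\in[0,T]$, $$\|\rho(t)\|_{B^{s-\varepsilon}_{2,\infty}}\le C\exp\Bigl(\frac C\varepsilon\Bigl(\int_0^tV(\tau)\,d\tau\Bigr)^2\Bigr)\Bigl(\|\rho_0\|_{B^s_{2,\infty}}+\int_0^t\|f(\tau)\|_{B^s_{2,\infty}}\,d\tau\Bigr).$$ -/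

import Mathlib

open scoped SchwartzMap FourierTransform LineDeriv Topology ContDiff
open MeasureTheory Set Filter

namespace LosingTransport

/-- The plane `ℝ²` with its Euclidean norm. -/
abbrev Plane : Type := EuclideanSpace ℝ (Fin 2)

/-- The `j`-th vector of the canonical basis of `ℝ²`. -/
noncomputable abbrev basisVec (j : Fin 2) : Plane := EuclideanSpace.single j (1 : ℝ)

/-- A couple `(χ, φ)` of smooth nonnegative functions generating a nonhomogeneous
Littlewood-Paley decomposition of `ℝ²`. -/
structure DyadicCouple where
  χ : Plane → ℝ
  φ : Plane → ℝ
  χ_smooth : ContDiff ℝ ∞ χ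
  φ_smooth : ContDiff ℝ ∞ φ
  χ_nonneg : ∀ ξ, 0 ≤ χ ξ
  φ_nonneg : ∀ ξ, 0 ≤ φ ξ
  χ_support : tsupport χ ⊆ {ξ | ‖ξ‖ ≤ 4 / 3}
  φ_support : tsupport φ ⊆ {ξ | 3 / 4 ≤ ‖ξ‖ ∧ ‖ξ‖ ≤ 8 / 3}
  partition : ∀ ξ, HasSum (fun q : ℕ => φ (((2 : ℝ) ^ q)⁻¹ • ξ)) (1 - χ ξ)

/-- If `g` is smooth and supported in a ball, then so is `ξ ↦ g (a ξ)` for `a ≠ 0`; it is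
regarded here as a (complex valued) Schwartz function. -/
noncomputable def dilatedSymbol (g : Plane → ℝ) (hg : ContDiff ℝ ∞ g)
    (hc : HasCompactSupport g) (a : ℝ) (ha : a ≠ 0) : 𝓢(Plane, ℂ) :=
  HasCompactSupport.toSchwartzMap (f := fun ξ => ((g (a • ξ) : ℝ) : ℂ))
    ((hc.comp_smul ha).comp_left Complex.ofReal_zero)
    (Complex.ofRealCLM.contDiff.comp (hg.comp (contDiff_const_smul a)))

theorem DyadicCouple.χ_compact (L : DyadicCouple) : HasCompactSupport L.χ :=
  (isCompact_closedBall (0 : Plane) (4 / 3)).of_isClosed_subset (isClosed_tsupport _)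
    fun _ hξ => mem_closedBall_zero_iff.2 (L.χ_support hξ)

theorem DyadicCouple.φ_compact (L : DyadicCouple) : HasCompactSupport L.φ :=
  (isCompact_closedBall (0 : Plane) (8 / 3)).of_isClosed_subset (isClosed_tsupport _)
    fun _ hξ => mem_closedBall_zero_iff.2 (L.φ_support hξ).2

/-- The symbol of `Δ_q`: it is `0` for `q ≤ -2`, `χ` for `q = -1` and `φ(2^{-q} ·)` for `q ≥ 0`.
Mathlib's Fourier transform has the kernel `exp (-2πi x·ξ)`, so that the multiplier `m(D)` with
`D = -i∇` is the multiplication by `m(2πξ)` on the Fourier side; whence the factor `2π`. -/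
noncomputable def DyadicCouple.symbol (L : DyadicCouple) (q : ℤ) : 𝓢(Plane, ℂ) :=
  if q ≤ -2 then 0
  else if q = -1 then
    dilatedSymbol L.χ L.χ_smooth L.χ_compact (2 * Real.pi) (by positivity)
  else
    dilatedSymbol L.φ L.φ_smooth L.φ_compact ((2 : ℝ) ^ (-q) * (2 * Real.pi)) (by positivity)

/-- For a Schwartz function `m` and a tempered distribution `u`, the smooth function
`𝓕⁻¹ (m · 𝓕 u) = K * u`, where `K = 𝓕⁻¹ m`; its value at `x` is `⟨u, K(x - ·)⟩`, and
`K(x - y) = (𝓕 m)(y - x)`. -/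
noncomputable def multiplier (m : 𝓢(Plane, ℂ)) (u : 𝓢'(Plane, ℂ)) (x : Plane) : ℂ :=
  u (SchwartzMap.compSubConstCLM ℂ x (𝓕 m))

/-- The dyadic block `Δ_q u`, a smooth function on `ℝ²`. -/
noncomputable def DyadicCouple.block (L : DyadicCouple) (q : ℤ) (u : 𝓢'(Plane, ℂ)) :
    Plane → ℂ :=
  multiplier (L.symbol q) u

/-- The low frequency cut-off `S_q u = ∑_{p ≤ q - 1} Δ_p u` (the blocks with `p ≤ -2` vanish). -/
noncomputable def DyadicCouple.lowFreq (L : DyadicCouple) (q : ℤ) (u : 𝓢'(Plane, ℂ))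
    (x : Plane) : ℂ :=
  ∑ p ∈ Finset.Icc (-1) (q - 1), L.block p u x

/-- The norm `‖u‖_{B^s_{2,∞}} = sup_{q ≥ -1} 2^{qs} ‖Δ_q u‖_{L²}`, with value `∞` when `u` is not
in the Besov space `B^s_{2,∞}(ℝ²)`. -/
noncomputable def DyadicCouple.besovNorm (L : DyadicCouple) (s : ℝ) (u : 𝓢'(Plane, ℂ)) : ENNReal :=
  ⨆ (q : ℤ) (_ : -1 ≤ q), ENNReal.ofReal ((2 : ℝ) ^ ((q : ℝ) * s)) * eLpNorm (L.block q u) 2 volume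

/-- `u ∈ B^s_{2,∞}(ℝ²)`. -/
def DyadicCouple.MemBesov (L : DyadicCouple) (s : ℝ) (u : 𝓢'(Plane, ℂ)) : Prop :=
  L.besovNorm s u < ⊤

/-- `f ∈ L¹([0,T]; B^s_{2,∞})`: `f` is weakly measurable in time and its norm is integrable. -/
def DyadicCouple.MemL1Besov (L : DyadicCouple) (s T : ℝ) (f : ℝ → 𝓢'(Plane, ℂ)) : Prop :=
  (∀ θ : 𝓢(Plane, ℂ), AEStronglyMeasurable (fun t => f t θ) (volume.restrict (Icc 0 T))) ∧
    (∫⁻ t in Icc 0 T, L.besovNorm s (f t)) < ⊤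

/-- A tempered distribution is real if it is real on real valued test functions. -/
def IsRealDistribution (u : 𝓢'(Plane, ℂ)) : Prop :=
  ∀ θ : 𝓢(Plane, ℂ), (∀ x, (θ x).im = 0) → (u θ).im = 0

/-- `v` is a (time dependent, real) vector field on `[0,T] × ℝ²`, integrable in time with values
in the tempered distributions. -/
def IsVelocityField (T : ℝ) (v : ℝ → Fin 2 → 𝓢'(Plane, ℂ)) : Prop :=
  (∀ t ∈ Icc 0 T, ∀ i, IsRealDistribution (v t i)) ∧
    ∀ i, ∀ θ : 𝓢(Plane, ℂ), IntegrableOn (fun t => v t i θ) (Icc 0 T)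

/-- The divergence `∂₁ w¹ + ∂₂ w²` of a vector field with distributional coefficients. -/
noncomputable def divergence (w : Fin 2 → 𝓢'(Plane, ℂ)) : 𝓢'(Plane, ℂ) :=
  ∑ i, ∂_{basisVec i} (w i)

/-- `‖∇ S_N w‖_{L^∞}`, with the Euclidean norm of the matrix `∇ S_N w = (S_N ∂_j w^i)_{i,j}`. -/
noncomputable def DyadicCouple.gradLowNorm (L : DyadicCouple) (N : ℕ)
    (w : Fin 2 → 𝓢'(Plane, ℂ)) : ENNReal :=
  eLpNorm (fun x => Real.sqrt (∑ i, ∑ j, ‖L.lowFreq N (∂_{basisVec j} (w i)) x‖ ^ 2)) ⊤ volume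

/-- `P = w · ∇ρ`, the product being understood, as usual, as the limit in the sense of tempered
distributions of the products of smooth functions `∑_i S_N w^i S_N ∂_i ρ` for `N → ∞`. -/
def DyadicCouple.IsAdvection (L : DyadicCouple) (w : Fin 2 → 𝓢'(Plane, ℂ))
    (ρ P : 𝓢'(Plane, ℂ)) : Prop :=
  ∀ θ : 𝓢(Plane, ℂ),
    Tendsto
      (fun N : ℕ => ∫ x, (∑ i, L.lowFreq N (w i) x * L.lowFreq N (∂_{basisVec i} ρ) x) * θ x)
      atTop (𝓝 (P θ))

/-- `ρ` satisfies `∂_t ρ + v · ∇ρ = f` on `[0,T] × ℝ²` with initial data `ρ₀`, in the sense of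
distributions (the equation is integrated in time and tested against Schwartz functions, so that
`ρ` is weakly continuous in time). It is bounded in time with values in some
`B^σ_{2,∞}`, `σ > -1`, which is the regularity that gives a meaning to the product
`v · ∇ρ = div (ρ v)`. -/
def DyadicCouple.IsTransportSolution (L : DyadicCouple) (T : ℝ) (v : ℝ → Fin 2 → 𝓢'(Plane, ℂ))
    (f : ℝ → 𝓢'(Plane, ℂ)) (ρ₀ : 𝓢'(Plane, ℂ)) (ρ : ℝ → 𝓢'(Plane, ℂ)) : Prop :=
  (∃ σ : ℝ, -1 < σ ∧ (⨆ t ∈ Icc 0 T, L.besovNorm σ (ρ t)) < ⊤) ∧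
    ∃ P : ℝ → 𝓢'(Plane, ℂ),
      (∀ᵐ t ∂(volume.restrict (Icc 0 T)), L.IsAdvection (v t) (ρ t) (P t)) ∧
      ∀ θ : 𝓢(Plane, ℂ),
        IntegrableOn (fun t => f t θ) (Icc 0 T) ∧
        IntegrableOn (fun t => P t θ) (Icc 0 T) ∧
        ∀ t ∈ Icc 0 T, ρ t θ = ρ₀ θ + ∫ τ in (0 : ℝ)..t, (f τ θ - P τ θ)

end LosingTransport

namespace LosingTransport

/-! ### Translates of a Schwartz function paired with a tempered distribution -/

/-! Localize the equation in frequency. With the natural number `n` labelling Δ_{n-1}, the block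
Δ_{n-1}ρ is transported by the real field b = Re S_n v, with source Δ_{n-1}f and the remainder
b·∇Δ_{n-1}ρ − Δ_{n-1}(v·∇ρ). Since b is divergence free, transport preserves the L² norm, and
everything rests on the remainder.

Remainder (`GradBound.eLpNorm_advRemainder_le`). The block Δ_{p-1}ρ contributes at most a constant
times V √(1+max(p,n)) 2^{-|p-n|} ‖Δ_{p-1}ρ‖. The gradient bound enters as a Lipschitz bound in a
commutator, and through the smallness 2^{-r}√(1+r) of the blocks of v. For p ≤ n the derivative
stays on Δ_{p-1}ρ. For p > n, div v = 0 moves it to the kernel of Δ_{n-1}, and in the commutator a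
second derivative follows because Δ_{p-1}ρ is itself a divergence. As χ need not be even, S_n v need
not be real. Its imaginary part comes from the odd part of χ, which lives in an annulus, so it is as
small as a block of v.

Energy (`EnergySetting.le`). The field b may grow linearly at infinity, so the L² balance is
localized by logarithmic cutoffs, whose gradient times 1+|x| tends to zero.

Losing weights (`TransportData.weighted_le`). Let Λ(t) be the primitive of V. Multiply ‖Δ_{n-1}ρ(t)‖
by about 2^{ns} exp(−β(n+1)Λ(t)). Differentiating the square of the weight produces the damping
−2β(n+1)V X², while the remainder gives 2X·CV√(1+n)·Y, where Y bounds all the weighted blocks.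
Completing the square leaves C²/(2β)·V Y², with no power of n: a growth √(1+N) is exactly what the
damping absorbs. Slopes strictly between −1 and 1 are beaten by 2^{-|p-n|}, whence the range of s.
Spending the whole loss ε by time t means β = ε log 2/Λ(t), and the Gronwall exponent C²Λ/(2β)
becomes a multiple of Λ²/ε.

A priori regularity. The supremum of the weighted blocks must be finite before it is absorbed. The
weights are therefore truncated at the slope σ of the known regularity, with bounds independent of
the truncation (`TransportData.weighted_bound`). The constant still depends on the distance of σ to
−1. A first application raises the regularity to s − ε' with ε' ≤ (s+1)/4, and a second one has a
constant depending on s only. -/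

/-- A tempered distribution is bounded by weighted sup norms of finitely many derivatives. -/
theorem exists_bound_weighted (u : 𝓢'(Plane, ℂ)) :
    ∃ n : ℕ, ∃ C : ℝ, 0 ≤ C ∧ ∀ (ψ : 𝓢(Plane, ℂ)) (D : ℝ),
      (∀ j ≤ n, ∀ y, (1 + ‖y‖) ^ n * ‖iteratedFDeriv ℝ j ψ y‖ ≤ D) → ‖u ψ‖ ≤ C * D := by
  have hcont : Continuous ((normSeminorm ℂ ℂ).comp u.toLinearMap) :=
    continuous_norm.comp (map_continuous u)
  obtain ⟨s, C, -, hC⟩ := Seminorm.bound_of_continuous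
    (schwartz_withSeminorms ℂ Plane ℂ) _ hcont
  -- A single `n` exceeds both the weight and the order of each of the finitely many seminorms.
  refine ⟨s.sup (fun i => i.1 + i.2), C, C.2, fun ψ D hD => ?_⟩
  have h1 := hC ψ
  have hD0 : 0 ≤ D := le_trans (by positivity) (hD 0 (Nat.zero_le _) 0)
  refine le_trans h1 ?_
  change (C : ℝ) * (s.sup (schwartzSeminormFamily ℂ Plane ℂ)) ψ ≤ C * D
  refine mul_le_mul_of_nonneg_left ?_ C.2
  refine Seminorm.finset_sup_apply_le hD0 fun i hi => ?_
  have hi' : i.1 + i.2 ≤ s.sup (fun i => i.1 + i.2) := Finset.le_sup (f := fun i => i.1 + i.2) hi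
  refine SchwartzMap.seminorm_le_bound ℂ i.1 i.2 ψ hD0 fun y => ?_
  refine le_trans ?_ (hD i.2 (by omega) y)
  gcongr
  calc ‖y‖ ^ i.1 ≤ (1 + ‖y‖) ^ i.1 := by gcongr; linarith
    _ ≤ _ := pow_le_pow_right₀ (by linarith [norm_nonneg y]) (by omega)

/-- Peetre's inequality: a polynomial weight can be recentred at the price of a power of `1 + ‖b‖`.
-/
theorem one_add_norm_le_mul (a b : Plane) : 1 + ‖a‖ ≤ (1 + ‖a - b‖) * (1 + ‖b‖) := by
  have := norm_le_norm_sub_add a b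
  nlinarith [norm_nonneg (a - b), norm_nonneg b]

/-- The weighted derivatives of order at most `n` of a Schwartz function are bounded. -/
theorem exists_schwartz_bound (g : 𝓢(Plane, ℂ)) (k n : ℕ) :
    ∃ K : ℝ, 0 ≤ K ∧ ∀ j ≤ n, ∀ y, (1 + ‖y‖) ^ k * ‖iteratedFDeriv ℝ j g y‖ ≤ K := by
  refine ⟨2 ^ k * (Finset.Iic (k, n)).sup (fun m => SchwartzMap.seminorm ℝ m.1 m.2) g,
    by positivity, fun j hj y => ?_⟩
  exact SchwartzMap.one_add_le_sup_seminorm_apply (𝕜 := ℝ) (m := (k, n)) le_rfl hj g y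

theorem weighted_translate_le {g : 𝓢(Plane, ℂ)} {n j : ℕ} {K : ℝ}
    (hK : ∀ y, (1 + ‖y‖) ^ n * ‖iteratedFDeriv ℝ j g y‖ ≤ K) (x y : Plane) :
    (1 + ‖y‖) ^ n * ‖iteratedFDeriv ℝ j (g.compSubConstCLM ℂ x) y‖ ≤ K * (1 + ‖x‖) ^ n := by
  have h : iteratedFDeriv ℝ j (g.compSubConstCLM ℂ x) y = iteratedFDeriv ℝ j g (y - x) :=
    iteratedFDeriv_comp_sub (f := g) j x y
  rw [h]
  calc (1 + ‖y‖) ^ n * ‖iteratedFDeriv ℝ j g (y - x)‖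
      ≤ ((1 + ‖y - x‖) * (1 + ‖x‖)) ^ n * ‖iteratedFDeriv ℝ j g (y - x)‖ := by
        gcongr; exact one_add_norm_le_mul y x
    _ = ((1 + ‖y - x‖) ^ n * ‖iteratedFDeriv ℝ j g (y - x)‖) * (1 + ‖x‖) ^ n := by
        rw [mul_pow]; ring
    _ ≤ _ := by gcongr; exact hK _

/-- Derivatives of first order Taylor remainders. -/
theorem norm_iteratedFDeriv_taylor_le (j : ℕ) : ∀ {W : Type} [NormedAddCommGroup W]
    [NormedSpace ℝ W] (G : Plane → W) (_ : ContDiff ℝ ∞ G) (h z : Plane) (S : ℝ)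
    (_ : ∀ w ∈ segment ℝ z (z - h), ‖iteratedFDeriv ℝ (j + 2) G w‖ ≤ S),
    ‖iteratedFDeriv ℝ j (fun w => G (w - h) - G w + fderiv ℝ G w h) z‖ ≤ S * ‖h‖ * ‖h‖ := by
  induction j with
  | zero =>
    intro W _ _ G hG h z S hS
    have hd : Differentiable ℝ G := hG.differentiable (by simp)
    have hG' : ContDiff ℝ ∞ (fderiv ℝ G) := hG.fderiv_right (by simp)
    have hd' : Differentiable ℝ (fderiv ℝ G) := hG'.differentiable (by simp)
    have hS' : ∀ w ∈ segment ℝ z (z - h), ‖fderiv ℝ (fderiv ℝ G) w‖ ≤ S := fun w hw => by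
      have := hS w hw
      rwa [zero_add, ← norm_iteratedFDeriv_fderiv, ← norm_iteratedFDeriv_fderiv,
        norm_iteratedFDeriv_zero] at this
    have hS0 : 0 ≤ S := (norm_nonneg _).trans (hS z (left_mem_segment _ _ _))
    rw [norm_iteratedFDeriv_zero]
    have h1 : ∀ w ∈ segment ℝ z (z - h), ‖fderiv ℝ G w - fderiv ℝ G z‖ ≤ S * ‖h‖ := by
      intro w hw
      have h2 := (convex_segment z (z - h)).norm_image_sub_le_of_norm_fderiv_le
        (fun w _ => hd' w) hS' (left_mem_segment _ _ _) hw
      refine h2.trans ?_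
      gcongr
      obtain ⟨t, ht, rfl⟩ := (segment_eq_image' ℝ z (z - h)) ▸ hw
      have : z + t • (z - h - z) - z = (-t) • h := by
        rw [neg_smul, sub_sub_cancel_left, smul_neg]; abel
      rw [this, norm_smul, norm_neg, Real.norm_of_nonneg ht.1]
      nlinarith [norm_nonneg h, ht.2]
    have h3 := (convex_segment z (z - h)).norm_image_sub_le_of_norm_fderiv_le'
      (φ := fderiv ℝ G z) (fun w _ => hd w) h1 (left_mem_segment _ _ _) (right_mem_segment _ _ _)
    have h4 : z - h - z = -h := by abel
    rw [h4, map_neg, sub_neg_eq_add, norm_neg] at h3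
    exact h3
  | succ j ih =>
    intro W _ _ G hG h z S hS
    have hG' : ContDiff ℝ ∞ (fderiv ℝ G) := hG.fderiv_right (by simp)
    have hd : Differentiable ℝ G := hG.differentiable (by simp)
    have hd' : Differentiable ℝ (fderiv ℝ G) := hG'.differentiable (by simp)
    rw [← norm_iteratedFDeriv_fderiv]
    have h1 : fderiv ℝ (fun w => G (w - h) - G w + fderiv ℝ G w h) =
        fun w => fderiv ℝ G (w - h) - fderiv ℝ G w + fderiv ℝ (fderiv ℝ G) w h := by
      funext w
      have e1 : HasFDerivAt (fun w => G (w - h)) (fderiv ℝ G (w - h)) w := by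
        have := (hd (w - h)).hasFDerivAt.comp w ((hasFDerivAt_id w).sub_const h)
        simpa using! this
      have e2 : HasFDerivAt (fun w => fderiv ℝ G w h) ((fderiv ℝ (fderiv ℝ G) w).flip h) w := by
        have := (hd' w).hasFDerivAt.clm_apply (hasFDerivAt_const h w)
        simpa using! this
      have e3 := ((e1.sub (hd w).hasFDerivAt).add e2).fderiv
      -- By symmetry of the second derivative, differentiating the remainder of `G` gives the
      -- remainder of `fderiv ℝ G`. The induction is over all target spaces because this map takes
      -- values in linear maps.
      have e4 : (fderiv ℝ (fderiv ℝ G) w).flip h = fderiv ℝ (fderiv ℝ G) w h := by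
        ext k
        exact ((hG.contDiffAt (x := w)).isSymmSndFDerivAt
          (by simpa using! WithTop.coe_le_coe.2 (le_top : (2 : ℕ∞) ≤ ⊤))).eq k h
      rw [e4] at e3
      exact e3
    rw [h1]
    refine ih (fderiv ℝ G) hG' h z S fun w hw => ?_
    have := hS w hw
    rwa [norm_iteratedFDeriv_fderiv]

/-- The remainder is quadratic in `h` in all the weighted norms at once, so any distribution applied
to it is also quadratic in `h`. The weight `2 + ‖x‖` covers the whole segment from `y - x` to `y - x
- h`. -/
theorem exists_taylor_translate_bound (g : 𝓢(Plane, ℂ)) (n : ℕ) :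
    ∃ K : ℝ, 0 ≤ K ∧ ∀ j ≤ n, ∀ x h y : Plane, ‖h‖ ≤ 1 →
      (1 + ‖y‖) ^ n * ‖iteratedFDeriv ℝ j (g.compSubConstCLM ℂ (x + h) - g.compSubConstCLM ℂ x
        + (∂_{h} g).compSubConstCLM ℂ x : 𝓢(Plane, ℂ)) y‖ ≤ K * (2 + ‖x‖) ^ n * ‖h‖ ^ 2 := by
  obtain ⟨K, hK0, hK⟩ := exists_schwartz_bound g n (n + 2)
  refine ⟨K, hK0, fun j hj x h y hh => ?_⟩
  have h1 : iteratedFDeriv ℝ j (g.compSubConstCLM ℂ (x + h) - g.compSubConstCLM ℂ x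
        + (∂_{h} g).compSubConstCLM ℂ x : 𝓢(Plane, ℂ)) y =
      iteratedFDeriv ℝ j (fun w => g (w - h) - g w + fderiv ℝ g w h) (y - x) := by
    rw [← iteratedFDeriv_comp_sub]
    congr 1
    ext w
    simp [SchwartzMap.lineDerivOp_apply_eq_fderiv, sub_add_eq_sub_sub]
  have hS : ∀ w ∈ segment ℝ (y - x) (y - x - h),
      ‖iteratedFDeriv ℝ (j + 2) g w‖ ≤ K * (2 + ‖x‖) ^ n / (1 + ‖y‖) ^ n := by
    intro w hw
    rw [le_div_iff₀ (by positivity)]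
    have hw' : 1 + ‖y‖ ≤ (1 + ‖w‖) * (2 + ‖x‖) := by
      obtain ⟨t, ht, rfl⟩ := (segment_eq_image' ℝ (y - x) (y - x - h)) ▸ hw
      set w := y - x + t • (y - x - h - (y - x))
      have e : y - w = x + t • h := by simp only [w, sub_sub_cancel_left, smul_neg]; abel
      have e2 : ‖y - w‖ ≤ ‖x‖ + 1 := by
        rw [e]
        refine (norm_add_le _ _).trans ?_
        rw [norm_smul, Real.norm_of_nonneg ht.1]
        nlinarith [norm_nonneg h, ht.2, ht.1]
      have e3 := norm_le_norm_sub_add y w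
      nlinarith [norm_nonneg w, norm_nonneg x]
    calc ‖iteratedFDeriv ℝ (j + 2) g w‖ * (1 + ‖y‖) ^ n
        ≤ ‖iteratedFDeriv ℝ (j + 2) g w‖ * ((1 + ‖w‖) * (2 + ‖x‖)) ^ n := by gcongr
      _ = ((1 + ‖w‖) ^ n * ‖iteratedFDeriv ℝ (j + 2) g w‖) * (2 + ‖x‖) ^ n := by
          rw [mul_pow]; ring
      _ ≤ _ := by gcongr; exact hK _ (by omega) _
  have h2 := norm_iteratedFDeriv_taylor_le j g (g.smooth ⊤) h (y - x) _ hS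
  rw [h1]
  calc _ ≤ (1 + ‖y‖) ^ n * (K * (2 + ‖x‖) ^ n / (1 + ‖y‖) ^ n * ‖h‖ * ‖h‖) := by gcongr
    _ = _ := by field_simp

/-- The function `x ↦ ⟨u, g(· - x)⟩`. -/
noncomputable def translatePairing (u : 𝓢'(Plane, ℂ)) (g : 𝓢(Plane, ℂ)) (x : Plane) : ℂ :=
  u (g.compSubConstCLM ℂ x)

/-- The exponent depends on `u` alone. It therefore survives the replacement of `g` by its
derivatives, which is how temperate growth is obtained. -/
theorem exists_translatePairing_growth (u : 𝓢'(Plane, ℂ)) : ∃ n : ℕ, ∀ g : 𝓢(Plane, ℂ),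
    ∃ C : ℝ, 0 ≤ C ∧ ∀ x, ‖translatePairing u g x‖ ≤ C * (1 + ‖x‖) ^ n := by
  obtain ⟨n, C, hC, hu⟩ := exists_bound_weighted u
  refine ⟨n, fun g => ?_⟩
  obtain ⟨K, hK0, hK⟩ := exists_schwartz_bound g n n
  refine ⟨C * K, by positivity, fun x => ?_⟩
  rw [mul_assoc]
  exact hu _ _ fun j hj y => weighted_translate_le (hK j hj) x y

theorem lineDerivOp_eq_sum_basis (g : 𝓢(Plane, ℂ)) (h : Plane) :
    ∂_{h} g = ∑ i, h i • ∂_{basisVec i} g := by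
  ext y
  have : h = ∑ i, h i • basisVec i := by
    ext j; fin_cases j <;> simp [Fin.sum_univ_two]
  conv_lhs => rw [this]
  simp [SchwartzMap.lineDerivOp_apply_eq_fderiv]

/-- The derivative of `x ↦ ⟨u, g(· - x)⟩`. -/
noncomputable def translatePairingDeriv (u : 𝓢'(Plane, ℂ)) (g : 𝓢(Plane, ℂ)) (x : Plane) :
    Plane →L[ℝ] ℂ :=
  ∑ i, (EuclideanSpace.proj (𝕜 := ℝ) i : Plane →L[ℝ] ℝ).smulRight
    (translatePairing u (-∂_{basisVec i} g) x)

/-- Apply `u` to the Taylor remainder of the translates. The derivative is again made of pairings,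
with `-∂_i g`, so smoothness of all orders follows by induction. -/
theorem hasFDerivAt_translatePairing (u : 𝓢'(Plane, ℂ)) (g : 𝓢(Plane, ℂ)) (x : Plane) :
    HasFDerivAt (translatePairing u g) (translatePairingDeriv u g x) x := by
  obtain ⟨n, C, hC, hu⟩ := exists_bound_weighted u
  obtain ⟨K, hK0, hK⟩ := exists_taylor_translate_bound g n
  rw [hasFDerivAt_iff_isLittleO_nhds_zero]
  have key : ∀ h : Plane, ‖h‖ ≤ 1 → ‖translatePairing u g (x + h) - translatePairing u g x
      - translatePairingDeriv u g x h‖ ≤ C * (K * (2 + ‖x‖) ^ n) * ‖h‖ ^ 2 := by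
    intro h hh
    have := hu _ _ fun j hj y => hK j hj x h y hh
    rw [← mul_assoc] at this
    refine le_of_eq_of_le ?_ this
    congr 1
    rw [lineDerivOp_eq_sum_basis g h]
    simp only [translatePairing, translatePairingDeriv, map_add, map_sub, map_sum, map_neg,
      sum_apply, ContinuousLinearMap.smulRight_apply, smul_neg,
      Finset.sum_neg_distrib, sub_neg_eq_add]
    congr 1
    refine Finset.sum_congr rfl fun i _ => ?_
    rw [← Complex.coe_smul (h i) (∂_{basisVec i} g), map_smul, map_smul]
    simp
  refine Asymptotics.IsBigO.trans_isLittleO (g := fun h : Plane => ‖h‖ ^ 2) ?_ ?_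
  · refine Asymptotics.IsBigO.of_bound (C * (K * (2 + ‖x‖) ^ n)) ?_
    filter_upwards [Metric.closedBall_mem_nhds (0 : Plane) one_pos] with h hh
    rw [Real.norm_of_nonneg (by positivity)]
    exact key h (by simpa using hh)
  · exact Asymptotics.isLittleO_norm_pow_id one_lt_two

theorem contDiff_translatePairing (u : 𝓢'(Plane, ℂ)) (n : ℕ) : ∀ g : 𝓢(Plane, ℂ),
    ContDiff ℝ n (translatePairing u g) := by
  induction n with
  | zero =>
    intro g
    refine contDiff_zero.2 (continuous_iff_continuousAt.2 fun x => ?_)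
    exact (hasFDerivAt_translatePairing u g x).continuousAt
  | succ n ih =>
    intro g
    rw [show ((n + 1 : ℕ) : ℕ∞ω) = (n : ℕ∞ω) + 1 by simp]
    refine contDiff_succ_iff_hasFDerivAt.2 ⟨_, ?_, hasFDerivAt_translatePairing u g⟩
    unfold translatePairingDeriv
    refine ContDiff.sum fun i _ => ?_
    exact (ContinuousLinearMap.smulRightL ℝ Plane ℂ
      (EuclideanSpace.proj (𝕜 := ℝ) i : Plane →L[ℝ] ℝ)).contDiff.comp (ih _)

theorem fderiv_translatePairing (u : 𝓢'(Plane, ℂ)) (g : 𝓢(Plane, ℂ)) :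
    fderiv ℝ (translatePairing u g) = fun x => ∑ i, ContinuousLinearMap.smulRightL ℝ Plane ℂ
      (EuclideanSpace.proj (𝕜 := ℝ) i : Plane →L[ℝ] ℝ)
      (translatePairing u (-∂_{basisVec i} g) x) :=
  funext fun x => (hasFDerivAt_translatePairing u g x).fderiv

theorem contDiff_infty_translatePairing (u : 𝓢'(Plane, ℂ)) (g : 𝓢(Plane, ℂ)) :
    ContDiff ℝ ∞ (translatePairing u g) :=
  contDiff_infty.2 fun n => contDiff_translatePairing u n g

theorem hasTemperateGrowth_translatePairing (u : 𝓢'(Plane, ℂ)) (g : 𝓢(Plane, ℂ)) :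
    (translatePairing u g).HasTemperateGrowth := by
  refine ⟨contDiff_infty_translatePairing u g, fun n => ?_⟩
  obtain ⟨k, hk⟩ := exists_translatePairing_growth u
  refine ⟨k, ?_⟩
  induction n generalizing g with
  | zero =>
    obtain ⟨C, -, hC⟩ := hk g
    exact ⟨C, fun x => by rw [norm_iteratedFDeriv_zero]; exact hC x⟩
  | succ n ih =>
    choose C hC using fun i => ih (-∂_{basisVec i} g)
    refine ⟨∑ i, ‖ContinuousLinearMap.smulRightL ℝ Plane ℂ
      (EuclideanSpace.proj (𝕜 := ℝ) i : Plane →L[ℝ] ℝ)‖ * C i, fun x => ?_⟩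
    rw [← norm_iteratedFDeriv_fderiv, fderiv_translatePairing]
    have hsm : ∀ i, ContDiff ℝ n (fun x => ContinuousLinearMap.smulRightL ℝ Plane ℂ
        (EuclideanSpace.proj (𝕜 := ℝ) i : Plane →L[ℝ] ℝ)
        (translatePairing u (-∂_{basisVec i} g) x)) := fun i =>
      (ContinuousLinearMap.smulRightL ℝ Plane ℂ _).contDiff.comp (contDiff_translatePairing u n _)
    rw [iteratedFDeriv_fun_sum_apply (fun i _ => (hsm i).contDiffAt), Finset.sum_mul]
    refine (norm_sum_le _ _).trans (Finset.sum_le_sum fun i _ => ?_)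
    refine (ContinuousLinearMap.norm_iteratedFDeriv_comp_left _
      ((contDiff_translatePairing u n _).contDiffAt) le_rfl).trans ?_
    rw [mul_assoc]
    gcongr
    exact hC i x

end LosingTransport

namespace LosingTransport

/-! ### Tempered distributions commute with integrals of translates -/

/-- Bounded continuous fields of `j`-linear forms on the plane. -/
def JetComponent (j : ℕ) : Type := BoundedContinuousFunction Plane (Plane [×j]→L[ℝ] ℂ)

noncomputable instance (j : ℕ) : NormedAddCommGroup (JetComponent j) :=
  inferInstanceAs (NormedAddCommGroup (BoundedContinuousFunction Plane (Plane [×j]→L[ℝ] ℂ)))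

noncomputable instance (j : ℕ) : NormedSpace ℂ (JetComponent j) :=
  inferInstanceAs (NormedSpace ℂ (BoundedContinuousFunction Plane (Plane [×j]→L[ℝ] ℂ)))

noncomputable instance (j : ℕ) : CompleteSpace (JetComponent j) :=
  inferInstanceAs (CompleteSpace (BoundedContinuousFunction Plane (Plane [×j]→L[ℝ] ℂ)))

/-- Families of bounded continuous fields of `j`-linear forms, `j ≤ n`. -/
def JetSpace (n : ℕ) : Type := (j : Fin (n + 1)) → JetComponent j

noncomputable instance (n : ℕ) : NormedAddCommGroup (JetSpace n) :=
  inferInstanceAs (NormedAddCommGroup ((j : Fin (n + 1)) → JetComponent j))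

noncomputable instance (n : ℕ) : NormedSpace ℂ (JetSpace n) :=
  inferInstanceAs (NormedSpace ℂ ((j : Fin (n + 1)) → JetComponent j))

noncomputable instance (n : ℕ) : CompleteSpace (JetSpace n) :=
  inferInstanceAs (CompleteSpace ((j : Fin (n + 1)) → JetComponent j))

/-- The evaluation of the component of order `j` at the point `y`. -/
noncomputable def JetSpace.eval {n : ℕ} (j : Fin (n + 1)) (y : Plane) :
    JetSpace n →L[ℂ] (Plane [×(j : ℕ)]→L[ℝ] ℂ) :=
  ContinuousLinearMap.comp (M₂ := JetComponent j)
    (BoundedContinuousFunction.evalCLM ℂ y : BoundedContinuousFunction Plane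
      (Plane [×(j : ℕ)]→L[ℝ] ℂ) →L[ℂ] (Plane [×(j : ℕ)]→L[ℝ] ℂ))
    (ContinuousLinearMap.proj (φ := fun j : Fin (n + 1) => JetComponent j) j)

theorem JetSpace.ext_eval {n : ℕ} {a b : JetSpace n} (h : ∀ j y, eval j y a = eval j y b) :
    a = b :=
  funext fun j => BoundedContinuousFunction.ext fun y => h j y

theorem JetSpace.norm_le {n : ℕ} {a : JetSpace n} {D : ℝ} (hD : 0 ≤ D)
    (h : ∀ j y, ‖eval j y a‖ ≤ D) : ‖a‖ ≤ D :=
  (pi_norm_le_iff_of_nonneg (ι := Fin (n + 1)) (G := fun j => JetComponent j) hD).2 fun j =>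
    (BoundedContinuousFunction.norm_le hD).2 fun y => h j y

theorem JetSpace.norm_eval_le {n : ℕ} (a : JetSpace n) (j : Fin (n + 1)) (y : Plane) :
    ‖eval j y a‖ ≤ ‖a‖ :=
  (BoundedContinuousFunction.norm_coe_le_norm (α := Plane) (β := Plane [×(j : ℕ)]→L[ℝ] ℂ)
    (a j) y).trans
    (norm_le_pi_norm (ι := Fin (n + 1)) (G := fun j => JetComponent j) a j)

/-- The weighted derivatives of order at most `n` of a Schwartz function, as bounded continuous
functions. -/
noncomputable def weightedDerivs (n : ℕ) : 𝓢(Plane, ℂ) →ₗ[ℂ] JetSpace n where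
  toFun ψ j := BoundedContinuousFunction.ofNormedAddCommGroup
    (fun y => (1 + ‖y‖) ^ n • iteratedFDeriv ℝ j ψ y)
    (by
      have : Continuous (iteratedFDeriv ℝ j ψ) :=
        (ψ.smooth ⊤).continuous_iteratedFDeriv (mod_cast le_top)
      fun_prop)
    (exists_schwartz_bound ψ n n).choose
    (fun y => by
      rw [norm_smul, Real.norm_of_nonneg (by positivity)]
      exact (exists_schwartz_bound ψ n n).choose_spec.2 j (Nat.lt_succ_iff.1 j.2) y)
  map_add' ψ η := by
    refine JetSpace.ext_eval fun j y => ?_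
    refine Eq.trans ?_ (map_add (JetSpace.eval j y) _ _).symm
    have h1 : iteratedFDeriv ℝ j (ψ + η : 𝓢(Plane, ℂ)) y
        = iteratedFDeriv ℝ j ψ y + iteratedFDeriv ℝ j η y :=
      iteratedFDeriv_add_apply (ψ.contDiffAt _) (η.contDiffAt _)
    change (1 + ‖y‖) ^ n • iteratedFDeriv ℝ j (ψ + η : 𝓢(Plane, ℂ)) y = _
    rw [h1, smul_add]
    rfl
  map_smul' c ψ := by
    refine JetSpace.ext_eval fun j y => ?_
    refine Eq.trans ?_ (map_smul (JetSpace.eval j y) _ _).symm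
    have h1 : iteratedFDeriv ℝ j (c • ψ : 𝓢(Plane, ℂ)) y = c • iteratedFDeriv ℝ j ψ y :=
      iteratedFDeriv_const_smul_apply (ψ.contDiffAt _)
    change (1 + ‖y‖) ^ n • iteratedFDeriv ℝ j (c • ψ : 𝓢(Plane, ℂ)) y = _
    rw [h1, smul_comm]
    rfl

theorem weightedDerivs_apply (n : ℕ) (ψ : 𝓢(Plane, ℂ)) (j : Fin (n + 1)) (y : Plane) :
    JetSpace.eval j y (weightedDerivs n ψ) = (1 + ‖y‖) ^ n • iteratedFDeriv ℝ j ψ y := rfl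

theorem norm_weightedDerivs_le {n : ℕ} {ψ : 𝓢(Plane, ℂ)} {D : ℝ}
    (h : ∀ j ≤ n, ∀ y, (1 + ‖y‖) ^ n * ‖iteratedFDeriv ℝ j ψ y‖ ≤ D) :
    ‖weightedDerivs n ψ‖ ≤ D := by
  have hD0 : 0 ≤ D := le_trans (by positivity) (h 0 (Nat.zero_le _) 0)
  refine JetSpace.norm_le hD0 fun j y => ?_
  rw [weightedDerivs_apply, norm_smul, Real.norm_of_nonneg (by positivity)]
  exact h j (Nat.lt_succ_iff.1 j.2) y

theorem le_norm_weightedDerivs {n : ℕ} (ψ : 𝓢(Plane, ℂ)) {j : ℕ} (hj : j ≤ n) (y : Plane) :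
    (1 + ‖y‖) ^ n * ‖iteratedFDeriv ℝ j ψ y‖ ≤ ‖weightedDerivs n ψ‖ := by
  have h1 := (weightedDerivs n ψ).norm_eval_le ⟨j, Nat.lt_succ_iff.2 hj⟩ y
  rw [weightedDerivs_apply, norm_smul, Real.norm_of_nonneg (by positivity)] at h1
  exact h1

/-- Needed to transport `u` to the range of `weightedDerivs n`; the component of order zero
suffices. -/
theorem weightedDerivs_injective (n : ℕ) : Function.Injective (weightedDerivs n) := by
  rw [← LinearMap.ker_eq_bot, LinearMap.ker_eq_bot']
  intro ψ h
  ext y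
  have := le_norm_weightedDerivs (n := n) ψ (Nat.zero_le _) y
  rw [h, norm_zero, norm_iteratedFDeriv_zero] at this
  have h2 : 0 < (1 + ‖y‖) ^ n := by positivity
  have h3 : ‖ψ y‖ ≤ 0 := by
    by_contra hc
    push Not at hc
    nlinarith [mul_pos h2 hc]
  simpa using h3

/-- A tempered distribution is a continuous functional of finitely many weighted derivatives. -/
theorem exists_functional (u : 𝓢'(Plane, ℂ)) : ∃ n : ℕ, ∃ l : StrongDual ℂ (JetSpace n),
    ∀ ψ, u ψ = l (weightedDerivs n ψ) := by
  obtain ⟨n, C, hC, hu⟩ := exists_bound_weighted u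
  let e := LinearEquiv.ofInjective (weightedDerivs n) (weightedDerivs_injective n)
  let f : StrongDual ℂ (LinearMap.range (weightedDerivs n)) :=
    LinearMap.mkContinuous (u.toLinearMap ∘ₗ e.symm.toLinearMap) C (by
      intro b
      obtain ⟨ψ, rfl⟩ := e.surjective b
      simp only [LinearMap.comp_apply, LinearEquiv.coe_coe, LinearEquiv.symm_apply_apply]
      exact hu ψ _ fun j hj y => le_norm_weightedDerivs ψ hj y)
  -- Hahn–Banach: the functional is bounded on the range for the norm of `JetSpace n`, a Banach
  -- space in which Bochner integrals can be taken.
  obtain ⟨l, hl, -⟩ := exists_extension_norm_eq _ f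
  refine ⟨n, l, fun ψ => ?_⟩
  have h1 := hl (e ψ)
  have h2 : f (e ψ) = u ψ := by
    change u (e.symm (e ψ)) = u ψ
    rw [LinearEquiv.symm_apply_apply]
  rw [← h2, ← h1]
  rfl

/-- Follows from the Taylor bound. It provides the strong measurability of the Bochner integrand in
`integral_mul_translatePairing`. -/
theorem continuous_weightedDerivs_translate (n : ℕ) (g : 𝓢(Plane, ℂ)) :
    Continuous fun x => weightedDerivs n (g.compSubConstCLM ℂ x) := by
  rw [continuous_iff_continuousAt]
  intro x
  obtain ⟨K, hK0, hK⟩ := exists_taylor_translate_bound g n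
  let l : Plane → JetSpace n :=
    fun h => ∑ i, (h i : ℂ) • weightedDerivs n ((∂_{basisVec i} g).compSubConstCLM ℂ x)
  have hl : ∀ h, weightedDerivs n ((∂_{h} g).compSubConstCLM ℂ x) = l h := by
    intro h
    simp only [l]
    rw [lineDerivOp_eq_sum_basis g h]
    simp only [map_sum]
    refine Finset.sum_congr rfl fun i _ => ?_
    rw [← Complex.coe_smul (h i) (∂_{basisVec i} g), map_smul, map_smul]
  have hlc : Continuous l := by fun_prop
  have hl0 : l 0 = 0 := by simp [l]
  rw [ContinuousAt, tendsto_iff_norm_sub_tendsto_zero]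
  have h1 : Tendsto (fun z => K * (2 + ‖x‖) ^ n * ‖z - x‖ ^ 2 + ‖l (z - x)‖) (𝓝 x) (𝓝 0) := by
    have : Continuous fun z => K * (2 + ‖x‖) ^ n * ‖z - x‖ ^ 2 + ‖l (z - x)‖ := by fun_prop
    have h2 := this.tendsto x
    simpa [hl0] using h2
  refine squeeze_zero' (Eventually.of_forall fun _ => norm_nonneg _) ?_ h1
  filter_upwards [Metric.closedBall_mem_nhds x one_pos] with z hz
  have hz' : ‖z - x‖ ≤ 1 := by simpa [dist_eq_norm] using hz
  have h3 := norm_weightedDerivs_le fun j hj y => hK j hj x (z - x) y hz'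
  rw [map_add, map_sub, hl, add_sub_cancel] at h3
  have h4 := norm_le_norm_add_norm_sub (l (z - x))
    (weightedDerivs n (g.compSubConstCLM ℂ z) - weightedDerivs n (g.compSubConstCLM ℂ x) +
      l (z - x))
  set A := weightedDerivs n (g.compSubConstCLM ℂ z) - weightedDerivs n (g.compSubConstCLM ℂ x)
  calc ‖A‖ = ‖(A + l (z - x)) - l (z - x)‖ := by rw [add_sub_cancel_right]
    _ ≤ ‖A + l (z - x)‖ + ‖l (z - x)‖ := norm_sub_le _ _
    _ ≤ _ := by gcongr

/-! ### Convolution of Schwartz functions and exchange with a distribution. -/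

/-- The convolution of two Schwartz functions. -/
noncomputable abbrev schwartzConv (θ g : 𝓢(Plane, ℂ)) : 𝓢(Plane, ℂ) :=
  SchwartzMap.convolution (ContinuousLinearMap.mul ℂ ℂ) θ g

theorem schwartzConv_apply (θ g : 𝓢(Plane, ℂ)) (y : Plane) :
    schwartzConv θ g y = ∫ x, θ x * g (y - x) := by
  rw [schwartzConv, SchwartzMap.convolution_apply]
  rfl

/-- On the Fourier side the derivative is a scalar factor, which may be attached to either function.
-/
theorem lineDerivOp_schwartzConv (θ g : 𝓢(Plane, ℂ)) (m : Plane) :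
    ∂_{m} (schwartzConv θ g) = schwartzConv θ (∂_{m} g) := by
  change ∂_{m} (𝓕⁻ (SchwartzMap.pairing (ContinuousLinearMap.mul ℂ ℂ) (𝓕 θ) (𝓕 g))) =
    𝓕⁻ (SchwartzMap.pairing (ContinuousLinearMap.mul ℂ ℂ) (𝓕 θ) (𝓕 (∂_{m} g)))
  rw [SchwartzMap.lineDerivOp_fourierInv_eq, SchwartzMap.fourier_lineDerivOp_eq]
  congr 1
  ext y
  have : (fun x : Plane => inner ℝ x m).HasTemperateGrowth := by fun_prop
  simp [SchwartzMap.smulLeftCLM_apply_apply this]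
  ring

theorem iteratedLineDerivOp_schwartzConv (θ : 𝓢(Plane, ℂ)) (j : ℕ) :
    ∀ (g : 𝓢(Plane, ℂ)) (m : Fin j → Plane),
    ∂^{m} (schwartzConv θ g) = schwartzConv θ (∂^{m} g) := by
  induction j with
  | zero => intro g m; simp
  | succ j ih =>
    intro g m
    rw [LineDeriv.iteratedLineDerivOp_succ_left, ih, lineDerivOp_schwartzConv,
      LineDeriv.iteratedLineDerivOp_succ_left]

/-- Write `u` as a continuous functional on jets. The integral of the translates is a Bochner
integral in `JetSpace n`, identified with the jet of the convolution by evaluating each derivative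
at each point, and the functional passes under it. This is the source of the composition rule for
multipliers. -/
theorem integral_mul_translatePairing (u : 𝓢'(Plane, ℂ)) (θ g : 𝓢(Plane, ℂ)) :
    ∫ x, θ x * translatePairing u g x = u (schwartzConv θ g) := by
  obtain ⟨n, l, hl⟩ := exists_functional u
  obtain ⟨K, hK0, hK⟩ := exists_schwartz_bound g n n
  have hint : Integrable fun x => θ x • weightedDerivs n (g.compSubConstCLM ℂ x) := by
    -- The jets of the translates grow like `(1 + ‖x‖) ^ n`, and the decay of `θ` compensates this.
    have h1 : Integrable fun x : Plane => K * ((1 + ‖x‖) ^ n * ‖θ x‖) := by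
      refine Integrable.const_mul ?_ _
      obtain ⟨K', -, hK'⟩ := exists_schwartz_bound θ (n + volume.integrablePower (E := Plane)) 0
      have h2 := (Measure.integrable_pow_neg_integrablePower (volume : Measure Plane)).const_mul K'
      refine h2.mono' ?_ (Eventually.of_forall fun x => ?_)
      · have := θ.continuous
        exact Continuous.aestronglyMeasurable (by fun_prop)
      · rw [Real.norm_of_nonneg (by positivity), Real.rpow_neg (by positivity),
          ← div_eq_mul_inv, le_div_iff₀ (by positivity), Real.rpow_natCast]
        have := hK' 0 le_rfl x
        rw [norm_iteratedFDeriv_zero, pow_add] at this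
        linarith
    refine h1.mono' ?_ (Eventually.of_forall fun x => ?_)
    · exact (θ.continuous.smul (continuous_weightedDerivs_translate n g)).aestronglyMeasurable
    · rw [norm_smul]
      have := norm_weightedDerivs_le fun j hj y => weighted_translate_le (hK j hj) x y
      nlinarith [norm_nonneg (θ x)]
  have h1 : ∫ x, θ x • weightedDerivs n (g.compSubConstCLM ℂ x) =
      weightedDerivs n (schwartzConv θ g) := by
    refine JetSpace.ext_eval fun j y => ?_
    let ev := JetSpace.eval j y
    change ev _ = ev _
    rw [← ContinuousLinearMap.integral_comp_comm ev hint]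
    have hint' := ev.integrable_comp hint
    have hev : ∀ x, ev (θ x • weightedDerivs n (g.compSubConstCLM ℂ x)) =
        θ x • ((1 + ‖y‖) ^ n • iteratedFDeriv ℝ j g (y - x)) := by
      intro x
      rw [map_smul]
      have h : iteratedFDeriv ℝ j (g.compSubConstCLM ℂ x) y = iteratedFDeriv ℝ j g (y - x) :=
        iteratedFDeriv_comp_sub (f := g) j x y
      change θ x • ((1 + ‖y‖) ^ n • iteratedFDeriv ℝ j (g.compSubConstCLM ℂ x) y) = _
      rw [h]
    simp only [hev] at hint' ⊢
    change _ = (1 + ‖y‖) ^ n • iteratedFDeriv ℝ j (schwartzConv θ g) y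
    ext m
    have h2 := (ContinuousMultilinearMap.apply ℝ (fun _ : Fin j => Plane) ℂ m).integral_comp_comm
      hint'
    change (ContinuousMultilinearMap.apply ℝ (fun _ : Fin j => Plane) ℂ m) _ = _
    rw [← h2]
    rw [smul_apply, ← SchwartzMap.iteratedLineDerivOp_eq_iteratedFDeriv,
      iteratedLineDerivOp_schwartzConv, schwartzConv_apply, ← integral_smul]
    congr 1
    ext x
    rw [SchwartzMap.iteratedLineDerivOp_eq_iteratedFDeriv]
    simp only [ContinuousMultilinearMap.apply_apply, smul_apply,
      smul_eq_mul, Complex.real_smul]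
    ring
  rw [hl, ← h1, ← ContinuousLinearMap.integral_comp_comm l hint]
  congr 1
  ext x
  rw [map_smul, ← hl]
  rfl

end LosingTransport

namespace LosingTransport

/-! ### Calculus of Fourier multipliers on tempered distributions -/

/-- The `i`-th partial derivative of a function on the plane. -/
noncomputable abbrev partialDeriv (i : Fin 2) (F : Plane → ℂ) (x : Plane) : ℂ :=
  fderiv ℝ F x (basisVec i)

/-- The product of two Schwartz functions. -/
noncomputable abbrev schwartzMul (m₁ m₂ : 𝓢(Plane, ℂ)) : 𝓢(Plane, ℂ) :=
  SchwartzMap.pairing (ContinuousLinearMap.mul ℂ ℂ) m₁ m₂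

theorem schwartzMul_apply (m₁ m₂ : 𝓢(Plane, ℂ)) (ξ : Plane) :
    schwartzMul m₁ m₂ ξ = m₁ ξ * m₂ ξ := rfl

theorem hasTemperateGrowth_coord (i : Fin 2) :
    (fun ξ : Plane => 2 * Real.pi * Complex.I * (ξ i : ℂ)).HasTemperateGrowth := by
  have h : (fun ξ : Plane => (ξ i : ℂ)).HasTemperateGrowth :=
    (Complex.ofRealCLM.comp (EuclideanSpace.proj (𝕜 := ℝ) i)).hasTemperateGrowth
  exact (Function.HasTemperateGrowth.const (2 * Real.pi * Complex.I)).mul h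

/-- The product of a symbol with `2πi ξ_i`, the symbol of `∂_i`. -/
noncomputable def freqMul (i : Fin 2) (m : 𝓢(Plane, ℂ)) : 𝓢(Plane, ℂ) :=
  SchwartzMap.smulLeftCLM ℂ (fun ξ : Plane => 2 * Real.pi * Complex.I * (ξ i : ℂ)) m

theorem freqMul_apply (i : Fin 2) (m : 𝓢(Plane, ℂ)) (ξ : Plane) :
    freqMul i m ξ = 2 * Real.pi * Complex.I * (ξ i : ℂ) * m ξ :=
  SchwartzMap.smulLeftCLM_apply_apply (hasTemperateGrowth_coord i) m ξ

theorem lineDerivOp_fourier (i : Fin 2) (m : 𝓢(Plane, ℂ)) :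
    ∂_{basisVec i} (𝓕 m) = -𝓕 (freqMul i m) := by
  rw [SchwartzMap.lineDerivOp_fourier_eq, ← FourierTransform.fourier_neg]
  congr 1
  ext ξ
  have : (fun x : Plane => inner ℝ x (basisVec i)).HasTemperateGrowth := by fun_prop
  rw [neg_smul, neg_apply, smul_apply, SchwartzMap.smulLeftCLM_apply_apply this, neg_apply,
    freqMul_apply]
  simp [EuclideanSpace.inner_single_right]
  ring

theorem lineDerivOp_translate (g : 𝓢(Plane, ℂ)) (e x : Plane) :
    ∂_{e} (g.compSubConstCLM ℂ x) = (∂_{e} g).compSubConstCLM ℂ x := by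
  ext y
  rw [SchwartzMap.compSubConstCLM_apply, SchwartzMap.lineDerivOp_apply_eq_fderiv,
    SchwartzMap.lineDerivOp_apply_eq_fderiv]
  have := fderiv_comp_sub (𝕜 := ℝ) (f := g) (x := y) x
  rw [← this]
  rfl

theorem multiplier_eq_translatePairing (m : 𝓢(Plane, ℂ)) (u : 𝓢'(Plane, ℂ)) :
    multiplier m u = translatePairing u (𝓕 m) := rfl

theorem hasTemperateGrowth_multiplier (m : 𝓢(Plane, ℂ)) (u : 𝓢'(Plane, ℂ)) :
    (multiplier m u).HasTemperateGrowth := hasTemperateGrowth_translatePairing u _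

theorem contDiff_multiplier (m : 𝓢(Plane, ℂ)) (u : 𝓢'(Plane, ℂ)) :
    ContDiff ℝ ∞ (multiplier m u) := contDiff_infty_translatePairing u _

theorem multiplier_lineDeriv (m : 𝓢(Plane, ℂ)) (u : 𝓢'(Plane, ℂ)) (i : Fin 2) :
    multiplier m (∂_{basisVec i} u) = multiplier (freqMul i m) u := by
  ext x
  rw [multiplier, TemperedDistribution.lineDerivOp_apply_apply, lineDerivOp_translate,
    lineDerivOp_fourier, map_neg, map_neg, map_neg, neg_neg]
  rfl

theorem partialDeriv_multiplier (m : 𝓢(Plane, ℂ)) (u : 𝓢'(Plane, ℂ)) (i : Fin 2) :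
    partialDeriv i (multiplier m u) = multiplier m (∂_{basisVec i} u) := by
  ext x
  rw [partialDeriv, multiplier_eq_translatePairing, (hasFDerivAt_translatePairing u _ x).fderiv,
    multiplier_lineDeriv, translatePairingDeriv]
  fin_cases i <;> simp [Fin.sum_univ_two, lineDerivOp_fourier] <;> rfl

theorem multiplier_add_symbol (m₁ m₂ : 𝓢(Plane, ℂ)) (u : 𝓢'(Plane, ℂ)) (x : Plane) :
    multiplier (m₁ + m₂) u x = multiplier m₁ u x + multiplier m₂ u x := by
  simp only [multiplier, FourierTransform.fourier_add, map_add]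

theorem multiplier_sub_symbol (m₁ m₂ : 𝓢(Plane, ℂ)) (u : 𝓢'(Plane, ℂ)) (x : Plane) :
    multiplier (m₁ - m₂) u x = multiplier m₁ u x - multiplier m₂ u x := by
  rw [sub_eq_add_neg, multiplier_add_symbol, sub_eq_add_neg]
  simp only [multiplier, FourierTransform.fourier_neg, map_neg]

theorem multiplier_sum_symbol {ι : Type*} (s : Finset ι) (m : ι → 𝓢(Plane, ℂ))
    (u : 𝓢'(Plane, ℂ)) (x : Plane) :
    multiplier (∑ j ∈ s, m j) u x = ∑ j ∈ s, multiplier (m j) u x := by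
  simp only [multiplier, FourierTransform.fourier_sum, map_sum]

theorem multiplier_sum_distribution {ι : Type*} (s : Finset ι) (m : 𝓢(Plane, ℂ))
    (u : ι → 𝓢'(Plane, ℂ)) (x : Plane) :
    multiplier m (∑ j ∈ s, u j) x = ∑ j ∈ s, multiplier m (u j) x := by
  simp only [multiplier, sum_apply]

/-- Obtained from the transform of a convolution by inversion, using that two Fourier transforms
make a reflection. -/
theorem fourier_schwartzMul (m₁ m₂ : 𝓢(Plane, ℂ)) :
    𝓕 (schwartzMul m₁ m₂) = schwartzConv (𝓕 m₁) (𝓕 m₂) := by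
  have h : schwartzMul m₁ m₂ = 𝓕⁻ (schwartzConv (𝓕 m₁) (𝓕 m₂)) := by
    have hinv : ∀ m : 𝓢(Plane, ℂ), ∀ ξ, 𝓕 (𝓕 m) (-ξ) = m ξ := by
      intro m ξ
      rw [SchwartzMap.fourier_coe (𝓕 m), ← Real.fourierInv_eq_fourier_neg,
        ← SchwartzMap.fourierInv_coe, FourierTransform.fourierInv_fourier_eq]
    ext ξ
    rw [SchwartzMap.fourierInv_coe, Real.fourierInv_eq_fourier_neg, ← SchwartzMap.fourier_coe,
      SchwartzMap.fourier_convolution, schwartzMul_apply, SchwartzMap.pairing_apply_apply, hinv,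
      hinv]
    rfl
  rw [h, FourierTransform.fourier_fourierInv_eq]

theorem schwartzConv_translate (θ g : 𝓢(Plane, ℂ)) (x : Plane) :
    schwartzConv (θ.compSubConstCLM ℂ x) g = (schwartzConv θ g).compSubConstCLM ℂ x := by
  ext y
  rw [SchwartzMap.compSubConstCLM_apply, schwartzConv_apply, schwartzConv_apply,
    ← integral_sub_right_eq_self (fun z => θ z * g (y - x - z)) x]
  congr 1
  ext z
  rw [SchwartzMap.compSubConstCLM_apply, sub_sub_sub_cancel_right]

/-- The composition of two multipliers is a convolution. -/
theorem multiplier_schwartzMul (m₁ m₂ : 𝓢(Plane, ℂ)) (u : 𝓢'(Plane, ℂ)) (x : Plane) :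
    multiplier (schwartzMul m₁ m₂) u x = ∫ y, multiplier m₂ u y * (𝓕 m₁) (y - x) := by
  have h := integral_mul_translatePairing u ((𝓕 m₁).compSubConstCLM ℂ x) (𝓕 m₂)
  rw [schwartzConv_translate, ← fourier_schwartzMul] at h
  rw [multiplier, ← h]
  congr 1
  ext y
  rw [mul_comm]
  rfl

/-! ### Integration by parts -/

theorem hasTemperateGrowth_partialDeriv {F : Plane → ℂ} (hF : F.HasTemperateGrowth) (i : Fin 2) :
    (partialDeriv i F).HasTemperateGrowth := by
  have h1 : (fderiv ℝ F).HasTemperateGrowth := by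
    refine ⟨hF.1.fderiv_right (by simp), fun n => ?_⟩
    obtain ⟨k, C, h⟩ := hF.2 (n + 1)
    exact ⟨k, C, fun x => by rw [norm_iteratedFDeriv_fderiv]; exact h x⟩
  exact (ContinuousLinearMap.apply ℝ ℂ (basisVec i)).hasTemperateGrowth.comp h1

theorem integrable_temperate_mul_schwartz {F : Plane → ℂ} (hF : F.HasTemperateGrowth)
    (H : 𝓢(Plane, ℂ)) : Integrable fun y => F y * H y := by
  have h := (SchwartzMap.smulLeftCLM ℂ F H).integrable (μ := volume)
  refine h.congr (Eventually.of_forall fun y => ?_)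
  exact SchwartzMap.smulLeftCLM_apply_apply hF H y

theorem integral_partialDeriv_mul {F : Plane → ℂ} (hF : F.HasTemperateGrowth)
    (H : 𝓢(Plane, ℂ)) (i : Fin 2) :
    ∫ y, partialDeriv i F y * H y = -∫ y, F y * (∂_{basisVec i} H) y := by
  have h := integral_mul_fderiv_eq_neg_fderiv_mul_of_integrable (μ := (volume : Measure Plane))
    (f := F) (g := H) (v := basisVec i)
    (integrable_temperate_mul_schwartz (hasTemperateGrowth_partialDeriv hF i) H)
    (by
      refine (integrable_temperate_mul_schwartz hF (∂_{basisVec i} H)).congr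
        (Eventually.of_forall fun y => ?_)
      simp only [SchwartzMap.lineDerivOp_apply_eq_fderiv])
    (integrable_temperate_mul_schwartz hF H)
    (fun x _ => hF.1.contDiffAt.differentiableAt (by simp))
    (fun x _ => H.differentiableAt)
  rw [eq_neg_iff_add_eq_zero] at h ⊢
  rw [add_comm, ← h]
  rfl

theorem partialDeriv_mul {F G : Plane → ℂ} (hF : F.HasTemperateGrowth)
    (hG : G.HasTemperateGrowth) (i : Fin 2) (y : Plane) :
    partialDeriv i (F * G) y = partialDeriv i F y * G y + F y * partialDeriv i G y := by
  have h1 : DifferentiableAt ℝ F y := hF.1.contDiffAt.differentiableAt (by simp)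
  have h2 : DifferentiableAt ℝ G y := hG.1.contDiffAt.differentiableAt (by simp)
  rw [partialDeriv, fderiv_mul h1 h2]
  simp only [add_apply, smul_apply, smul_eq_mul]
  ring

/-! ### Real distributions -/

/-- Complex conjugation of Schwartz functions. -/
noncomputable def schwartzConj (g : 𝓢(Plane, ℂ)) : 𝓢(Plane, ℂ) :=
  SchwartzMap.postcompCLM (𝕜 := ℝ) (Complex.conjCLE : ℂ →L[ℝ] ℂ) g

theorem schwartzConj_apply (g : 𝓢(Plane, ℂ)) (x : Plane) :
    schwartzConj g x = (starRingEnd ℂ) (g x) := rfl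

/-- Reality is tested on the two real functions `g + ḡ` and `i (g - ḡ)`. -/
theorem IsRealDistribution.conj_apply {u : 𝓢'(Plane, ℂ)} (hu : IsRealDistribution u)
    (g : 𝓢(Plane, ℂ)) : (starRingEnd ℂ) (u g) = u (schwartzConj g) := by
  have h1 := hu (g + schwartzConj g) fun x => by
    simp [schwartzConj_apply]
  have h2 := hu (Complex.I • (g - schwartzConj g)) fun x => by
    simp [schwartzConj_apply]
  rw [map_add] at h1
  rw [map_smul, map_sub] at h2
  simp only [Complex.add_im, smul_eq_mul, Complex.mul_im, Complex.I_re, Complex.I_im,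
    Complex.sub_re, Complex.sub_im, zero_mul, one_mul, zero_add] at h1 h2
  apply Complex.ext
  · simp; linarith
  · simp; linarith

theorem fourier_conj_neg {m m' : 𝓢(Plane, ℂ)} (h : ∀ ξ, m' ξ = (starRingEnd ℂ) (m (-ξ))) :
    𝓕 m' = schwartzConj (𝓕 m) := by
  ext y
  rw [schwartzConj_apply, SchwartzMap.fourier_coe, SchwartzMap.fourier_coe, Real.fourier_eq,
    Real.fourier_eq, ← integral_conj, ← integral_neg_eq_self]
  congr 1
  ext ξ
  simp only [h, neg_neg, inner_neg_left, Circle.smul_def, smul_eq_mul, map_mul]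
  congr 1
  rw [← Circle.coe_inv_eq_conj, ← AddChar.map_neg_eq_inv, neg_neg]

/-- Since `χ` need not be even, a cut-off of a real field need not be real. This identity expresses
its imaginary part through the odd part of the symbol. -/
theorem IsRealDistribution.conj_multiplier {u : 𝓢'(Plane, ℂ)} (hu : IsRealDistribution u)
    {m m' : 𝓢(Plane, ℂ)} (h : ∀ ξ, m' ξ = (starRingEnd ℂ) (m (-ξ))) (x : Plane) :
    (starRingEnd ℂ) (multiplier m u x) = multiplier m' u x := by
  rw [multiplier, hu.conj_apply, multiplier, fourier_conj_neg h]
  rfl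

theorem IsRealDistribution.lineDeriv {u : 𝓢'(Plane, ℂ)} (hu : IsRealDistribution u) (i : Fin 2) :
    IsRealDistribution (∂_{basisVec i} u) := by
  intro θ hθ
  rw [TemperedDistribution.lineDerivOp_apply_apply]
  refine hu _ fun x => ?_
  have h1 : HasFDerivAt (fun y => (θ y).im) (Complex.imCLM.comp (fderiv ℝ θ x)) x :=
    Complex.imCLM.hasFDerivAt.comp x θ.differentiableAt.hasFDerivAt
  have h2 : (fun y => (θ y).im) = fun _ => (0 : ℝ) := funext hθ
  rw [h2] at h1
  have h3 := h1.unique (hasFDerivAt_const (0 : ℝ) x)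
  have h4 := congrArg (fun l : Plane →L[ℝ] ℝ => l (basisVec i)) h3
  simpa [SchwartzMap.lineDerivOp_apply_eq_fderiv] using h4

end LosingTransport

namespace LosingTransport

/-! ### Young's inequality for the `L²` norm -/

theorem eLpNorm_two_sq {α E : Type*} [MeasurableSpace α] {μ : Measure α} [NormedAddCommGroup E]
    (F : α → E) : eLpNorm F 2 μ ^ 2 = ∫⁻ x, ‖F x‖ₑ ^ 2 ∂μ := by
  have h := eLpNorm_nnreal_pow_eq_lintegral (f := F) (μ := μ) (p := 2) (by norm_num)
  norm_num at h
  exact_mod_cast h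

theorem sq_lintegral_le {α : Type*} [MeasurableSpace α] (μ : Measure α) {f : α → ENNReal}
    (hf : AEMeasurable f μ) : (∫⁻ x, f x ∂μ) ^ 2 ≤ μ univ * ∫⁻ x, f x ^ 2 ∂μ := by
  have h := ENNReal.lintegral_mul_le_Lp_mul_Lq μ (p := 2) (q := 2)
    ⟨by norm_num, by norm_num, by norm_num⟩ (aemeasurable_const (b := (1 : ENNReal))) hf
  simp only [Pi.mul_apply, one_mul, ENNReal.one_rpow, lintegral_one] at h
  calc (∫⁻ x, f x ∂μ) ^ 2
      ≤ (μ univ ^ (1 / 2 : ℝ) * (∫⁻ x, f x ^ (2 : ℝ) ∂μ) ^ (1 / 2 : ℝ)) ^ 2 := by gcongr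
    _ = μ univ * ∫⁻ x, f x ^ 2 ∂μ := by
        rw [← ENNReal.mul_rpow_of_nonneg _ _ (by norm_num), ← ENNReal.rpow_natCast,
          ← ENNReal.rpow_mul]
        norm_num

/-- Cauchy–Schwarz for the measure with density `κ (y - x)`, then Tonelli. Only a pointwise
domination is assumed, so commutators are covered as well as convolutions. -/
theorem eLpNorm_le_lintegral_kernel {T F : Plane → ℂ} {κ : Plane → ENNReal}
    (hF : Measurable F) (hκ : Measurable κ)
    (hT : ∀ x, ‖T x‖ₑ ≤ ∫⁻ y, ‖F y‖ₑ * κ (y - x)) :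
    eLpNorm T 2 volume ≤ (∫⁻ y, κ y) * eLpNorm F 2 volume := by
  have h1 : ∀ x, ‖T x‖ₑ ^ 2 ≤ (∫⁻ y, κ y) * ∫⁻ y, ‖F y‖ₑ ^ 2 * κ (y - x) := by
    intro x
    have hκx : Measurable fun y => κ (y - x) := hκ.comp (measurable_id.sub_const x)
    have h2 := sq_lintegral_le (volume.withDensity fun y => κ (y - x))
      (f := fun y => ‖F y‖ₑ) hF.enorm.aemeasurable
    rw [lintegral_withDensity_eq_lintegral_mul _ hκx hF.enorm,
      lintegral_withDensity_eq_lintegral_mul _ hκx (hF.enorm.pow_const 2),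
      withDensity_apply _ MeasurableSet.univ, Measure.restrict_univ,
      lintegral_sub_right_eq_self κ x] at h2
    simp only [Pi.mul_apply] at h2
    calc ‖T x‖ₑ ^ 2 ≤ (∫⁻ y, ‖F y‖ₑ * κ (y - x)) ^ 2 := by gcongr; exact hT x
      _ ≤ _ := by simpa only [mul_comm] using h2
  have h3 : eLpNorm T 2 volume ^ 2 ≤ ((∫⁻ y, κ y) * eLpNorm F 2 volume) ^ 2 := by
    rw [mul_pow, eLpNorm_two_sq, eLpNorm_two_sq]
    have hmeas : Measurable (Function.uncurry fun x y : Plane => ‖F y‖ₑ ^ 2 * κ (y - x)) :=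
      ((hF.comp measurable_snd).enorm.pow_const 2).mul
        (hκ.comp (measurable_snd.sub measurable_fst))
    calc ∫⁻ x, ‖T x‖ₑ ^ 2 ≤ ∫⁻ x, (∫⁻ y, κ y) * ∫⁻ y, ‖F y‖ₑ ^ 2 * κ (y - x) :=
          lintegral_mono h1
      _ = (∫⁻ y, κ y) * ∫⁻ x, ∫⁻ y, ‖F y‖ₑ ^ 2 * κ (y - x) :=
          lintegral_const_mul _ hmeas.lintegral_prod_right'
      _ = (∫⁻ y, κ y) * ∫⁻ y, ‖F y‖ₑ ^ 2 * ∫⁻ x, κ (y - x) := by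
          rw [lintegral_lintegral_swap hmeas.aemeasurable]
          congr 1
          refine lintegral_congr fun y => lintegral_const_mul _ ?_
          exact hκ.comp (measurable_const.sub measurable_id)
      _ = (∫⁻ y, κ y) * ∫⁻ y, ‖F y‖ₑ ^ 2 * ∫⁻ x, κ x := by
          simp only [lintegral_sub_left_eq_self κ]
      _ = (∫⁻ y, κ y) ^ 2 * ∫⁻ y, ‖F y‖ₑ ^ 2 := by
          rw [lintegral_mul_const _ (hF.enorm.pow_const 2)]; ring
  exact (ENNReal.pow_le_pow_left_iff two_ne_zero).1 h3

/-! ### Dyadic dilations of symbols and their kernels -/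

/-- The symbol `ξ ↦ μ (2^{-n} ξ)`. -/
noncomputable def dyadicDilate (n : ℕ) (μ : 𝓢(Plane, ℂ)) : 𝓢(Plane, ℂ) :=
  SchwartzMap.compCLMOfContinuousLinearEquiv ℂ
    (ContinuousLinearEquiv.smulLeft (Units.mk0 (((2 : ℝ) ^ n)⁻¹) (by positivity))) μ

theorem dyadicDilate_apply (n : ℕ) (μ : 𝓢(Plane, ℂ)) (ξ : Plane) :
    dyadicDilate n μ ξ = μ (((2 : ℝ) ^ n)⁻¹ • ξ) := rfl

theorem fourier_dyadicDilate (n : ℕ) (μ : 𝓢(Plane, ℂ)) (y : Plane) :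
    𝓕 (dyadicDilate n μ) y = (((2 : ℝ) ^ n) ^ 2 : ℝ) * 𝓕 μ ((2 : ℝ) ^ n • y) := by
  rw [SchwartzMap.fourier_coe, SchwartzMap.fourier_coe, Real.fourier_eq, Real.fourier_eq]
  have h := Measure.integral_comp_inv_smul (volume : Measure Plane)
    (fun ξ => Real.fourierChar (-inner ℝ ξ ((2 : ℝ) ^ n • y)) • μ ξ) ((2 : ℝ) ^ n)
  rw [finrank_euclideanSpace_fin, abs_of_pos (by positivity), Complex.real_smul] at h
  rw [← h]
  congr 1
  ext ξ
  rw [dyadicDilate_apply, inner_smul_left, inner_smul_right]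
  congr 3
  simp only [conj_trivial]
  field_simp

/-- The moment of order `j` of the convolution kernel of the multiplier `μ(D)`. -/
noncomputable def kernelMoment (j : ℕ) (μ : 𝓢(Plane, ℂ)) : ℝ := ∫ y, ‖y‖ ^ j * ‖𝓕 μ y‖

/-- Each power of `‖y‖` in the kernel gains a factor `2 ^ (-n)`. The case `j = 1` is the gain in
commutator estimates. -/
theorem kernelMoment_dyadicDilate (j n : ℕ) (μ : 𝓢(Plane, ℂ)) :
    kernelMoment j (dyadicDilate n μ) = (((2 : ℝ) ^ n) ^ j)⁻¹ * kernelMoment j μ := by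
  have h := Measure.integral_comp_smul_of_nonneg (volume : Measure Plane)
    (fun y => ‖y‖ ^ j * ‖𝓕 μ y‖) ((2 : ℝ) ^ n) (hR := by positivity)
  rw [finrank_euclideanSpace_fin, smul_eq_mul] at h
  have h2 : kernelMoment j (dyadicDilate n μ) = ∫ y : Plane, (((2 : ℝ) ^ n) ^ 2) *
      (((2 : ℝ) ^ n) ^ j)⁻¹ * (‖(2 : ℝ) ^ n • y‖ ^ j * ‖𝓕 μ ((2 : ℝ) ^ n • y)‖) := by
    unfold kernelMoment
    congr 1
    ext y
    rw [fourier_dyadicDilate, norm_mul, Complex.norm_real, norm_smul,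
      Real.norm_of_nonneg (by positivity), Real.norm_of_nonneg (by positivity)]
    field_simp
    ring
  rw [h2, integral_const_mul, h]
  unfold kernelMoment
  field_simp

theorem kernelMoment_smul (j : ℕ) (c : ℂ) (μ : 𝓢(Plane, ℂ)) :
    kernelMoment j (c • μ) = ‖c‖ * kernelMoment j μ := by
  unfold kernelMoment
  rw [← integral_const_mul]
  congr 1
  ext y
  rw [FourierTransform.fourier_smul, smul_apply, norm_smul]
  ring

theorem lintegral_kernelMoment (j : ℕ) (μ : 𝓢(Plane, ℂ)) {A : ℝ} (hA : 0 ≤ A) :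
    ∫⁻ y, ENNReal.ofReal (A * (‖y‖ ^ j * ‖𝓕 μ y‖)) = ENNReal.ofReal (A * kernelMoment j μ) := by
  rw [← ofReal_integral_eq_lintegral_ofReal
    ((SchwartzMap.integrable_pow_mul volume (𝓕 μ) j).const_mul A)
    (Eventually.of_forall fun y => by positivity), integral_const_mul]
  rfl

/-- `L²` bound of an integral operator dominated by a convolution. -/
theorem eLpNorm_integral_kernel_le {T F : Plane → ℂ} {W : Plane → Plane → ℂ} {A : ℝ} (hA : 0 ≤ A)
    (j : ℕ) (μ : 𝓢(Plane, ℂ)) (hF : Continuous F) (hW : ∀ x y, ‖W x y‖ ≤ A * ‖y - x‖ ^ j)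
    (hT : ∀ x, T x = ∫ y, W x y * F y * 𝓕 μ (y - x)) :
    eLpNorm T 2 volume ≤ ENNReal.ofReal (A * kernelMoment j μ) * eLpNorm F 2 volume := by
  rw [← lintegral_kernelMoment j μ hA]
  refine eLpNorm_le_lintegral_kernel (κ := fun y => ENNReal.ofReal (A * (‖y‖ ^ j * ‖𝓕 μ y‖)))
    hF.measurable ?_ fun x => ?_
  · have := (𝓕 μ).continuous
    exact (Continuous.measurable (by fun_prop)).ennreal_ofReal
  · rw [hT]
    refine (enorm_integral_le_lintegral_enorm _).trans (lintegral_mono fun y => ?_)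
    rw [enorm_mul, enorm_mul, mul_comm ‖W x y‖ₑ, mul_assoc]
    gcongr
    rw [← mul_assoc, ENNReal.ofReal_mul (by positivity), ofReal_norm]
    gcongr
    rw [← ofReal_norm]
    exact ENNReal.ofReal_le_ofReal (hW x y)

theorem norm_integral_kernel_le {F : Plane → ℂ} {A : ℝ} (μ : 𝓢(Plane, ℂ))
    (hF : ∀ y, ‖F y‖ ≤ A) (x : Plane) :
    ‖∫ y, F y * 𝓕 μ (y - x)‖ ≤ A * kernelMoment 0 μ := by
  have hint : Integrable fun y => ‖𝓕 μ y‖ := (𝓕 μ).integrable.norm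
  calc ‖∫ y, F y * 𝓕 μ (y - x)‖ ≤ ∫ y, A * ‖𝓕 μ (y - x)‖ := by
        refine norm_integral_le_of_norm_le ((hint.comp_sub_right x).const_mul A)
          (Eventually.of_forall fun y => ?_)
        rw [norm_mul]
        gcongr
        exact hF y
    _ = A * kernelMoment 0 μ := by
        rw [integral_const_mul, integral_sub_right_eq_self (fun y => ‖𝓕 μ y‖) x]
        simp [kernelMoment]

end LosingTransport

namespace LosingTransport

/-! ### The symbols of the dyadic blocks -/

theorem DyadicCouple.χ_eq_zero (L : DyadicCouple) {ξ : Plane} (h : 4 / 3 < ‖ξ‖) : L.χ ξ = 0 := by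
  by_contra hc
  have : ‖ξ‖ ≤ 4 / 3 := L.χ_support (subset_tsupport _ hc)
  linarith

theorem DyadicCouple.φ_eq_zero_of_lt (L : DyadicCouple) {ξ : Plane} (h : ‖ξ‖ < 3 / 4) :
    L.φ ξ = 0 := by
  by_contra hc
  have : 3 / 4 ≤ ‖ξ‖ := (L.φ_support (subset_tsupport _ hc)).1
  linarith

theorem DyadicCouple.φ_eq_zero_of_gt (L : DyadicCouple) {ξ : Plane} (h : 8 / 3 < ‖ξ‖) :
    L.φ ξ = 0 := by
  by_contra hc
  have : ‖ξ‖ ≤ 8 / 3 := (L.φ_support (subset_tsupport _ hc)).2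
  linarith

theorem DyadicCouple.χ_eq_one (L : DyadicCouple) {ξ : Plane} (h : ‖ξ‖ < 3 / 4) : L.χ ξ = 1 := by
  have h1 := L.partition ξ
  have h2 : (fun q : ℕ => L.φ (((2 : ℝ) ^ q)⁻¹ • ξ)) = fun _ => 0 := by
    funext q
    refine L.φ_eq_zero_of_lt (lt_of_le_of_lt ?_ h)
    rw [norm_smul, norm_inv, norm_pow, Real.norm_ofNat]
    have : ((2 : ℝ) ^ q)⁻¹ ≤ 1 := inv_le_one_of_one_le₀ (one_le_pow₀ (by norm_num))
    nlinarith [norm_nonneg ξ]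
  rw [h2] at h1
  have := h1.unique hasSum_zero
  linarith

/-- Compare the partitions of unity at `ξ` and at `ξ / 2`: the series differ by their first term.
Consecutive low frequency symbols therefore differ by one block. -/
theorem DyadicCouple.χ_half (L : DyadicCouple) (ξ : Plane) :
    L.χ ((2 : ℝ)⁻¹ • ξ) = L.χ ξ + L.φ ξ := by
  have h1 := L.partition ξ
  have h2 := L.partition ((2 : ℝ)⁻¹ • ξ)
  rw [← hasSum_nat_add_iff' 1] at h1
  have h3 : (fun q : ℕ => L.φ (((2 : ℝ) ^ q)⁻¹ • (2 : ℝ)⁻¹ • ξ)) =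
      fun q : ℕ => L.φ (((2 : ℝ) ^ (q + 1))⁻¹ • ξ) := by
    funext q
    rw [smul_smul, pow_succ, mul_inv]
  rw [h3] at h2
  have := h1.unique h2
  simp at this
  linarith

/-- The symbol of `Δ_{n-1}` at unit scale. -/
noncomputable def DyadicCouple.motherSymbol (L : DyadicCouple) (n : ℕ) : 𝓢(Plane, ℂ) :=
  if n = 0 then dilatedSymbol L.χ L.χ_smooth L.χ_compact (2 * Real.pi) (by positivity)
  else dilatedSymbol L.φ L.φ_smooth L.φ_compact (4 * Real.pi) (by positivity)

/-- The symbol of `Δ_{n-1}`. -/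
noncomputable def DyadicCouple.blockSymbol (L : DyadicCouple) (n : ℕ) : 𝓢(Plane, ℂ) :=
  dyadicDilate n (L.motherSymbol n)

/-- The symbol of `S_N`. -/
noncomputable def DyadicCouple.lowSymbol (L : DyadicCouple) (N : ℕ) : 𝓢(Plane, ℂ) :=
  dyadicDilate N (L.motherSymbol 0)

theorem dilatedSymbol_apply (g : Plane → ℝ) (hg : ContDiff ℝ ∞ g)
    (hc : HasCompactSupport g) (a : ℝ) (ha : a ≠ 0) (ξ : Plane) :
    dilatedSymbol g hg hc a ha ξ = (g (a • ξ) : ℂ) := rfl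

theorem DyadicCouple.motherSymbol_zero_apply (L : DyadicCouple) (ξ : Plane) :
    L.motherSymbol 0 ξ = (L.χ ((2 * Real.pi) • ξ) : ℂ) := rfl

theorem DyadicCouple.motherSymbol_succ_apply (L : DyadicCouple) (n : ℕ) (ξ : Plane) :
    L.motherSymbol (n + 1) ξ = (L.φ ((4 * Real.pi) • ξ) : ℂ) := rfl

/-- The natural index is shifted by one so that it starts at zero. For Δ_n, with label `n + 1`, the
symbol φ(2^{-n}·2πξ) is the dilate of φ(4π·) by 2^{n+1}, which explains the 4π in `motherSymbol`. -/
theorem DyadicCouple.symbol_eq (L : DyadicCouple) (n : ℕ) :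
    L.symbol ((n : ℤ) - 1) = L.blockSymbol n := by
  ext ξ
  rw [blockSymbol, dyadicDilate_apply, symbol]
  rcases n with _ | n
  · simp [motherSymbol_zero_apply, dilatedSymbol_apply]
  · rw [if_neg (by push_cast; omega), if_neg (by push_cast; omega), motherSymbol_succ_apply,
      dilatedSymbol_apply, smul_smul]
    congr 3
    push_cast
    rw [add_sub_cancel_right, zpow_neg, zpow_natCast, pow_succ]
    field_simp
    ring

theorem DyadicCouple.block_eq (L : DyadicCouple) (n : ℕ) (u : 𝓢'(Plane, ℂ)) :
    L.block ((n : ℤ) - 1) u = multiplier (L.blockSymbol n) u := by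
  rw [block, symbol_eq]

theorem DyadicCouple.lowSymbol_succ (L : DyadicCouple) (N : ℕ) :
    L.lowSymbol (N + 1) = L.lowSymbol N + L.blockSymbol (N + 1) := by
  ext ξ
  rw [add_apply, lowSymbol, lowSymbol, blockSymbol, dyadicDilate_apply, dyadicDilate_apply,
    dyadicDilate_apply, motherSymbol_zero_apply, motherSymbol_zero_apply, motherSymbol_succ_apply]
  have h := L.χ_half ((2 * Real.pi) • ((2 : ℝ) ^ N)⁻¹ • ξ)
  have e1 : (2 : ℝ)⁻¹ • (2 * Real.pi) • ((2 : ℝ) ^ N)⁻¹ • ξ =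
      (2 * Real.pi) • ((2 : ℝ) ^ (N + 1))⁻¹ • ξ := by
    simp only [smul_smul]; congr 1; rw [pow_succ]; field_simp
  have e2 : (2 * Real.pi) • ((2 : ℝ) ^ N)⁻¹ • ξ =
      (4 * Real.pi) • ((2 : ℝ) ^ (N + 1))⁻¹ • ξ := by
    simp only [smul_smul]; congr 1; rw [pow_succ]; field_simp; ring
  rw [e1] at h
  rw [h, ← e2]
  push_cast
  ring

theorem DyadicCouple.lowSymbol_zero (L : DyadicCouple) : L.lowSymbol 0 = L.blockSymbol 0 := rfl

theorem DyadicCouple.sum_blockSymbol (L : DyadicCouple) (N : ℕ) :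
    ∑ n ∈ Finset.range (N + 1), L.blockSymbol n = L.lowSymbol N := by
  induction N with
  | zero => simp [lowSymbol_zero]
  | succ N ih => rw [Finset.sum_range_succ, ih, lowSymbol_succ]

theorem DyadicCouple.lowFreq_eq (L : DyadicCouple) (N : ℕ) (u : 𝓢'(Plane, ℂ)) :
    L.lowFreq N u = multiplier (L.lowSymbol N) u := by
  ext x
  rw [lowFreq, ← sum_blockSymbol, multiplier_sum_symbol]
  symm
  refine Finset.sum_bij (fun n _ => (n : ℤ) - 1) ?_ ?_ ?_ ?_
  · intro n hn
    rw [Finset.mem_range] at hn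
    rw [Finset.mem_Icc]
    omega
  · intro a _ b _ h
    simpa using h
  · intro p hp
    rw [Finset.mem_Icc] at hp
    refine ⟨(p + 1).toNat, ?_, ?_⟩
    · rw [Finset.mem_range]; omega
    · have := Int.toNat_of_nonneg (a := p + 1) (by omega)
      omega
  · intro n _
    rw [block_eq]

theorem multiplier_lowSymbol_eq_sum (L : DyadicCouple) (N : ℕ) (u : 𝓢'(Plane, ℂ)) (x : Plane) :
    multiplier (L.lowSymbol N) u x =
      ∑ n ∈ Finset.range (N + 1), multiplier (L.blockSymbol n) u x := by
  rw [← L.sum_blockSymbol, multiplier_sum_symbol]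

/-- The two kinds of symbol have the same outer radius: 4/3 divided by 2π and 8/3 divided by 4π are
both 2/(3π). -/
theorem DyadicCouple.motherSymbol_eq_zero (L : DyadicCouple) (n : ℕ) {η : Plane}
    (h : 2 / (3 * Real.pi) < ‖η‖) : L.motherSymbol n η = 0 := by
  rw [div_lt_iff₀ (by positivity)] at h
  rcases n with _ | n
  · rw [motherSymbol_zero_apply, L.χ_eq_zero, Complex.ofReal_zero]
    rw [norm_smul, Real.norm_of_nonneg (by positivity)]
    linarith
  · rw [motherSymbol_succ_apply, L.φ_eq_zero_of_gt, Complex.ofReal_zero]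
    rw [norm_smul, Real.norm_of_nonneg (by positivity)]
    linarith

/-- On the support of the block the argument of `χ` has norm at most 2/3, below the radius 3/4
inside which `χ` equals one. -/
theorem schwartzMul_blockSymbol_lowSymbol (L : DyadicCouple) {q N : ℕ} (h : q + 1 ≤ N) :
    schwartzMul (L.blockSymbol q) (L.lowSymbol N) = L.blockSymbol q := by
  ext ξ
  rw [schwartzMul_apply]
  by_cases h0 : 2 / (3 * Real.pi) < ‖((2 : ℝ) ^ q)⁻¹ • ξ‖
  · rw [DyadicCouple.blockSymbol, dyadicDilate_apply, L.motherSymbol_eq_zero q h0, zero_mul]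
  · rw [DyadicCouple.lowSymbol, dyadicDilate_apply, DyadicCouple.motherSymbol_zero_apply,
      L.χ_eq_one, Complex.ofReal_one, mul_one]
    push Not at h0
    rw [norm_smul, norm_inv, norm_pow, Real.norm_ofNat, le_div_iff₀ (by positivity)] at h0
    rw [norm_smul, norm_smul, norm_inv, norm_pow, Real.norm_ofNat,
      Real.norm_of_nonneg (by positivity)]
    have h1 : ((2 : ℝ) ^ N)⁻¹ ≤ 2⁻¹ * ((2 : ℝ) ^ q)⁻¹ := by
      rw [← mul_inv, ← pow_succ']
      exact inv_anti₀ (by positivity) (pow_le_pow_right₀ (by norm_num) h)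
    have h2 : 2 * Real.pi * (((2 : ℝ) ^ N)⁻¹ * ‖ξ‖) ≤
        2 * Real.pi * ((2⁻¹ * ((2 : ℝ) ^ q)⁻¹) * ‖ξ‖) := by gcongr
    nlinarith

/-! ### Auxiliary symbols -/

/-- A cut-off equal to one on the supports of the symbols at unit scale. -/
noncomputable def ballBump : ContDiffBump (0 : Plane) where
  rIn := 2 / (3 * Real.pi)
  rOut := 1
  rIn_pos := by positivity
  rIn_lt_rOut := by
    rw [div_lt_one (by positivity)]
    linarith [Real.pi_gt_three]

/-- A cut-off localized near the origin. -/
noncomputable def originBump : ContDiffBump (0 : Plane) where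
  rIn := 1 / (16 * Real.pi)
  rOut := 3 / (16 * Real.pi)
  rIn_pos := by positivity
  rIn_lt_rOut := by gcongr; norm_num

/-- The Schwartz function equal to one on the supports of the symbols at unit scale. -/
noncomputable def ballSymbol : 𝓢(Plane, ℂ) :=
  HasCompactSupport.toSchwartzMap (f := fun η => ((ballBump η : ℝ) : ℂ))
    (ballBump.hasCompactSupport.comp_left Complex.ofReal_zero)
    (Complex.ofRealCLM.contDiff.comp ballBump.contDiff)

/-- The bump removes the singularity of |η|^{-2} at the origin. It vanishes from the radius 3/(16π)
on, so the inverse is unchanged on the annulus. -/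
theorem normSq_add_originBump_pos (η : Plane) : 0 < ‖η‖ ^ 2 + originBump η := by
  by_cases h : η = 0
  · subst h
    rw [originBump.one_of_mem_closedBall (Metric.mem_closedBall_self originBump.rIn_pos.le)]
    positivity
  · have : 0 < ‖η‖ := norm_pos_iff.2 h
    have := originBump.nonneg (x := η)
    positivity

/-- A Schwartz function equal to `|η|^{-2}` on the annulus supporting the symbols at unit scale. -/
noncomputable def invNormSqSymbol : 𝓢(Plane, ℂ) :=
  HasCompactSupport.toSchwartzMap
    (f := fun η => ((ballBump η * (‖η‖ ^ 2 + originBump η)⁻¹ : ℝ) : ℂ))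
    ((ballBump.hasCompactSupport.mul_right).comp_left Complex.ofReal_zero)
    (Complex.ofRealCLM.contDiff.comp (ballBump.contDiff.mul
      (((contDiff_norm_sq ℝ).add originBump.contDiff).inv
        fun η => (normSq_add_originBump_pos η).ne')))

/-- The symbol of the `k`-th component of the inverse of the gradient, localized in an annulus. -/
noncomputable def annulusInverse (k : Fin 2) : 𝓢(Plane, ℂ) :=
  (-(1 / (4 * Real.pi ^ 2) : ℝ) : ℂ) • freqMul k invNormSqSymbol

/-- The symbol is supported in the annulus where `annulusInverse` inverts the gradient. -/
def IsAnnular (μ : 𝓢(Plane, ℂ)) : Prop :=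
  ∀ η, μ η ≠ 0 → 3 / (16 * Real.pi) ≤ ‖η‖ ∧ ‖η‖ ≤ 2 / (3 * Real.pi)

/-- Two factors 2πi give −4π², which the constant in `annulusInverse` cancels, while the squares of
the coordinates cancel |η|^{-2}. -/
theorem sum_coord_mul_annulusInverse {η : Plane} (h₁ : 3 / (16 * Real.pi) ≤ ‖η‖)
    (h₂ : ‖η‖ ≤ 2 / (3 * Real.pi)) :
    ∑ k, 2 * Real.pi * Complex.I * (η k : ℂ) * annulusInverse k η = 1 := by
  have hz : invNormSqSymbol η = ((‖η‖ ^ 2)⁻¹ : ℝ) := by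
    change ((ballBump η * (‖η‖ ^ 2 + originBump η)⁻¹ : ℝ) : ℂ) = _
    rw [ballBump.one_of_mem_closedBall (mem_closedBall_zero_iff.2 h₂),
      originBump.zero_of_le_dist (by rw [dist_zero_right]; exact h₁), one_mul, add_zero]
  have hη : 0 < ‖η‖ := lt_of_lt_of_le (by positivity) h₁
  have hn : ‖η‖ ^ 2 = η 0 ^ 2 + η 1 ^ 2 := by
    rw [EuclideanSpace.norm_sq_eq, Fin.sum_univ_two]
    simp
  have hpos : 0 < η 0 ^ 2 + η 1 ^ 2 := by rw [← hn]; positivity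
  simp only [annulusInverse, smul_apply, freqMul_apply, hz, smul_eq_mul, Fin.sum_univ_two]
  rw [hn]
  have h3 : ((η 0 : ℂ) ^ 2 + (η 1 : ℂ) ^ 2) ≠ 0 := by
    rw [← Complex.ofReal_pow, ← Complex.ofReal_pow, ← Complex.ofReal_add]
    exact Complex.ofReal_ne_zero.2 hpos.ne'
  have hpi : (Real.pi : ℂ) ≠ 0 := by exact_mod_cast Real.pi_ne_zero
  push_cast
  field_simp
  ring_nf
  rw [Complex.I_sq]
  ring

theorem isAnnular_motherSymbol (L : DyadicCouple) (n : ℕ) : IsAnnular (L.motherSymbol (n + 1)) := by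
  intro η h
  refine ⟨?_, ?_⟩
  · by_contra hc
    push Not at hc
    rw [lt_div_iff₀ (by positivity)] at hc
    refine h ?_
    rw [DyadicCouple.motherSymbol_succ_apply, L.φ_eq_zero_of_lt, Complex.ofReal_zero]
    rw [norm_smul, Real.norm_of_nonneg (by positivity)]
    linarith
  · by_contra hc
    exact h (L.motherSymbol_eq_zero _ (not_le.1 hc))

/-- The reflection of a symbol. -/
noncomputable def reflectSymbol (μ : 𝓢(Plane, ℂ)) : 𝓢(Plane, ℂ) :=
  SchwartzMap.compCLMOfContinuousLinearEquiv ℂ (ContinuousLinearEquiv.neg ℝ) μ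

theorem reflectSymbol_apply (μ : 𝓢(Plane, ℂ)) (ξ : Plane) : reflectSymbol μ ξ = μ (-ξ) := rfl

/-- Near the origin `χ` equals one at both `ξ` and `-ξ`, so its odd part vanishes there. This makes
the imaginary part of a low frequency cut-off controllable by its gradient. -/
theorem isAnnular_odd (L : DyadicCouple) :
    IsAnnular (L.motherSymbol 0 - reflectSymbol (L.motherSymbol 0)) := by
  intro η h
  rw [sub_apply, reflectSymbol_apply] at h
  refine ⟨?_, ?_⟩
  · by_contra hc
    push Not at hc
    rw [lt_div_iff₀ (by positivity)] at hc
    refine h ?_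
    have h1 : ‖(2 * Real.pi) • η‖ < 3 / 4 := by
      rw [norm_smul, Real.norm_of_nonneg (by positivity)]
      nlinarith [Real.pi_pos, norm_nonneg η]
    rw [DyadicCouple.motherSymbol_zero_apply, DyadicCouple.motherSymbol_zero_apply, L.χ_eq_one h1,
      L.χ_eq_one (by rwa [smul_neg, norm_neg]), sub_self]
  · by_contra hc
    push Not at hc
    refine h ?_
    rw [L.motherSymbol_eq_zero _ hc, L.motherSymbol_eq_zero _ (by rwa [norm_neg]), sub_self]

/-- A harmless cut-off is inserted so that a derivative can act on its kernel and leave the block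
untouched. -/
theorem schwartzMul_ballSymbol (L : DyadicCouple) (n : ℕ) :
    schwartzMul (dyadicDilate n ballSymbol) (L.blockSymbol n) = L.blockSymbol n := by
  ext ξ
  rw [schwartzMul_apply, DyadicCouple.blockSymbol, dyadicDilate_apply, dyadicDilate_apply]
  by_cases h0 : 2 / (3 * Real.pi) < ‖((2 : ℝ) ^ n)⁻¹ • ξ‖
  · rw [L.motherSymbol_eq_zero n h0, mul_zero]
  · have : ballSymbol (((2 : ℝ) ^ n)⁻¹ • ξ) = 1 := by
      change ((ballBump (((2 : ℝ) ^ n)⁻¹ • ξ) : ℝ) : ℂ) = 1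
      rw [ballBump.one_of_mem_closedBall (mem_closedBall_zero_iff.2 (not_lt.1 h0)), Complex.ofReal_one]
    rw [this, one_mul]

theorem freqMul_schwartzMul_left (i : Fin 2) (m₁ m₂ : 𝓢(Plane, ℂ)) :
    freqMul i (schwartzMul m₁ m₂) = schwartzMul (freqMul i m₁) m₂ := by
  ext ξ
  simp only [freqMul_apply, schwartzMul_apply]
  ring

theorem freqMul_schwartzMul_right (i : Fin 2) (m₁ m₂ : 𝓢(Plane, ℂ)) :
    freqMul i (schwartzMul m₁ m₂) = schwartzMul m₁ (freqMul i m₂) := by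
  ext ξ
  simp only [freqMul_apply, schwartzMul_apply]
  ring

theorem freqMul_dyadicDilate (i : Fin 2) (n : ℕ) (μ : 𝓢(Plane, ℂ)) :
    freqMul i (dyadicDilate n μ) = ((2 : ℂ) ^ n) • dyadicDilate n (freqMul i μ) := by
  ext ξ
  rw [smul_apply, freqMul_apply, dyadicDilate_apply, dyadicDilate_apply, freqMul_apply]
  simp only [PiLp.smul_apply, smul_eq_mul]
  push_cast
  field_simp

/-- An annular multiplier is a divergence. The factor 2^{-n} of the potentials undoes the size 2^n
of the gradient at that scale. -/
theorem sum_freqMul_annulusInverse {μ : 𝓢(Plane, ℂ)} (hμ : IsAnnular μ) (n : ℕ) :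
    ∑ k, freqMul k (schwartzMul (((2 : ℂ) ^ n)⁻¹ • dyadicDilate n (annulusInverse k))
      (dyadicDilate n μ)) = dyadicDilate n μ := by
  ext ξ
  rw [sum_apply]
  simp only [freqMul_apply, schwartzMul_apply, smul_apply, smul_eq_mul, dyadicDilate_apply]
  by_cases h : μ (((2 : ℝ) ^ n)⁻¹ • ξ) = 0
  · simp [h]
  · have h2 := sum_coord_mul_annulusInverse (hμ _ h).1 (hμ _ h).2
    simp only [PiLp.smul_apply, smul_eq_mul] at h2
    calc _ = (∑ k, 2 * Real.pi * Complex.I * ((((2 : ℝ) ^ n)⁻¹ * ξ k : ℝ) : ℂ) *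
          annulusInverse k (((2 : ℝ) ^ n)⁻¹ • ξ)) * μ (((2 : ℝ) ^ n)⁻¹ • ξ) := by
          rw [Finset.sum_mul]
          refine Finset.sum_congr rfl fun k _ => ?_
          push_cast
          ring
      _ = _ := by rw [h2, one_mul]

end LosingTransport

namespace LosingTransport

/-! ### Multipliers acting on functions of temperate growth -/

/-- The multiplier `m(D)` acting on a function. -/
noncomputable def convMultiplier (m : 𝓢(Plane, ℂ)) (F : Plane → ℂ) (x : Plane) : ℂ :=
  ∫ y, F y * 𝓕 m (y - x)

theorem multiplier_schwartzMul_eq (m₁ m₂ : 𝓢(Plane, ℂ)) (u : 𝓢'(Plane, ℂ)) :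
    multiplier (schwartzMul m₁ m₂) u = convMultiplier m₁ (multiplier m₂ u) :=
  funext fun x => multiplier_schwartzMul m₁ m₂ u x

theorem integrable_convMultiplier {F : Plane → ℂ} (hF : F.HasTemperateGrowth) (m : 𝓢(Plane, ℂ))
    (x : Plane) : Integrable fun y => F y * 𝓕 m (y - x) :=
  integrable_temperate_mul_schwartz hF ((𝓕 m).compSubConstCLM ℂ x)

/-- A function of temperate growth is a tempered distribution, so the smoothness of `multiplier`
applies. -/
theorem continuous_convMultiplier {F : Plane → ℂ} (hF : F.HasTemperateGrowth)
    (m : 𝓢(Plane, ℂ)) : Continuous (convMultiplier m F) := by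
  have h : convMultiplier m F = multiplier m (hF.toTemperedDistribution (μ := volume)) := by
    ext x
    rw [multiplier, Function.HasTemperateGrowth.toTemperedDistribution_apply volume hF, convMultiplier]
    congr 1
    ext y
    rw [SchwartzMap.compSubConstCLM_apply, smul_eq_mul, mul_comm]
  rw [h]
  exact (contDiff_multiplier _ _).continuous

theorem convMultiplier_add {F G : Plane → ℂ} (hF : F.HasTemperateGrowth)
    (hG : G.HasTemperateGrowth) (m : 𝓢(Plane, ℂ)) (x : Plane) :
    convMultiplier m (F + G) x = convMultiplier m F x + convMultiplier m G x := by
  unfold convMultiplier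
  rw [← integral_add (integrable_convMultiplier hF m x) (integrable_convMultiplier hG m x)]
  congr 1
  ext y
  rw [Pi.add_apply, add_mul]

theorem convMultiplier_sum {ι : Type*} (s : Finset ι) {F : ι → Plane → ℂ}
    (hF : ∀ j ∈ s, (F j).HasTemperateGrowth) (m : 𝓢(Plane, ℂ)) (x : Plane) :
    convMultiplier m (fun y => ∑ j ∈ s, F j y) x = ∑ j ∈ s, convMultiplier m (F j) x := by
  unfold convMultiplier
  rw [← integral_finsetSum s fun j hj => integrable_convMultiplier (hF j hj) m x]
  simp only [Finset.sum_mul]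

theorem integral_partialDeriv_mul_kernel {F : Plane → ℂ} (hF : F.HasTemperateGrowth)
    (m : 𝓢(Plane, ℂ)) (i : Fin 2) (x : Plane) :
    ∫ y, partialDeriv i F y * 𝓕 m (y - x) = ∫ y, F y * 𝓕 (freqMul i m) (y - x) := by
  have h := integral_partialDeriv_mul hF ((𝓕 m).compSubConstCLM ℂ x) i
  rw [lineDerivOp_translate, lineDerivOp_fourier] at h
  refine h.trans ?_
  rw [← integral_neg]
  congr 1
  ext y
  simp

theorem convMultiplier_partialDeriv {F : Plane → ℂ} (hF : F.HasTemperateGrowth)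
    (m : 𝓢(Plane, ℂ)) (i : Fin 2) :
    convMultiplier m (partialDeriv i F) = convMultiplier (freqMul i m) F :=
  funext fun x => integral_partialDeriv_mul_kernel hF m i x

theorem eLpNorm_convMultiplier_le {F : Plane → ℂ} (hF : Continuous F) (m : 𝓢(Plane, ℂ)) :
    eLpNorm (convMultiplier m F) 2 volume ≤
      ENNReal.ofReal (kernelMoment 0 m) * eLpNorm F 2 volume := by
  have := eLpNorm_integral_kernel_le (T := convMultiplier m F) (F := F) (W := fun _ _ => 1)
    (A := 1) zero_le_one 0 m hF (by simp) (fun x => by simp [convMultiplier])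
  rwa [one_mul] at this

theorem eLpNorm_convMultiplier_mul_le {F w : Plane → ℂ} {B : ℝ} (hB : 0 ≤ B) (hF : Continuous F)
    (hw : ∀ y, ‖w y‖ ≤ B) (m : 𝓢(Plane, ℂ)) :
    eLpNorm (convMultiplier m (w * F)) 2 volume ≤
      ENNReal.ofReal (B * kernelMoment 0 m) * eLpNorm F 2 volume :=
  eLpNorm_integral_kernel_le (W := fun _ y => w y) hB 0 m hF (by simpa using hw)
    (fun x => by simp [convMultiplier])

/-- The commutator of a multiplier with the multiplication by a Lipschitz function. -/
theorem eLpNorm_commutator_le {F w : Plane → ℂ} {l : ℝ} (hl : 0 ≤ l) (hF : F.HasTemperateGrowth)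
    (hw : w.HasTemperateGrowth) (hlip : ∀ x y, ‖w y - w x‖ ≤ l * ‖y - x‖) (m : 𝓢(Plane, ℂ)) :
    eLpNorm (fun x => convMultiplier m (w * F) x - w x * convMultiplier m F x) 2 volume ≤
      ENNReal.ofReal (l * kernelMoment 1 m) * eLpNorm F 2 volume := by
  refine eLpNorm_integral_kernel_le (W := fun x y => w y - w x) hl 1 m hF.1.continuous
    (by simpa using hlip) fun x => ?_
  unfold convMultiplier
  rw [← integral_const_mul, ← integral_sub (integrable_convMultiplier (hw.mul hF) m x)
    ((integrable_convMultiplier hF m x).const_mul _)]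
  congr 1
  ext y
  rw [Pi.mul_apply]
  ring

theorem continuous_commutator {F w : Plane → ℂ} (hF : F.HasTemperateGrowth)
    (hw : w.HasTemperateGrowth) (m : 𝓢(Plane, ℂ)) :
    Continuous fun x => convMultiplier m (w * F) x - w x * convMultiplier m F x :=
  (continuous_convMultiplier (hw.mul hF) m).sub
    (hw.1.continuous.mul (continuous_convMultiplier hF m))

theorem norm_sub_le_of_partialDeriv_le {w : Plane → ℂ} (hw : Differentiable ℝ w) {l : ℝ}
    (h : ∀ i x, ‖partialDeriv i w x‖ ≤ l) (x y : Plane) : ‖w y - w x‖ ≤ 2 * l * ‖y - x‖ := by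
  refine convex_univ.norm_image_sub_le_of_norm_fderiv_le (𝕜 := ℝ) (fun z _ => hw z)
    (fun z _ => ?_) (mem_univ x) (mem_univ y)
  have hl : 0 ≤ l := (norm_nonneg _).trans (h 0 0)
  refine ContinuousLinearMap.opNorm_le_bound _ (by positivity) fun e => ?_
  have he : e = ∑ i, e i • basisVec i := by
    ext j; fin_cases j <;> simp [Fin.sum_univ_two]
  conv_lhs => rw [he]
  rw [map_sum, Fin.sum_univ_two, map_smul, map_smul]
  refine (norm_add_le _ _).trans ?_
  rw [norm_smul, norm_smul]
  have h0 := PiLp.norm_apply_le e 0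
  have h1 := PiLp.norm_apply_le e 1
  have h2 := h 0 z
  have h3 := h 1 z
  calc _ ≤ ‖e‖ * l + ‖e‖ * l := by gcongr
    _ = _ := by ring

/-! ### Uniform bounds of the kernels -/

/-- A common bound of the moments of all the kernels at unit scale. -/
def KernelBound (L : DyadicCouple) (K : ℝ) : Prop :=
  0 ≤ K ∧ (∀ k, kernelMoment 0 (annulusInverse k) ≤ K) ∧
  (∀ i, kernelMoment 0 (freqMul i ballSymbol) ≤ K) ∧
  (∀ n, kernelMoment 0 (L.motherSymbol n) ≤ K) ∧
  (∀ n, kernelMoment 1 (L.motherSymbol n) ≤ K) ∧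
  (∀ n i, kernelMoment 0 (freqMul i (L.motherSymbol n)) ≤ K) ∧
  (∀ n i j, kernelMoment 0 (freqMul j (freqMul i (L.motherSymbol n))) ≤ K) ∧
  (∀ n i j, kernelMoment 1 (freqMul j (freqMul i (L.motherSymbol n))) ≤ K)

/-- There are only two distinct mother symbols, the one at `0` and the one common to all larger
indices. -/
theorem exists_bound_motherSymbol (L : DyadicCouple) {ι : Type} [Finite ι]
    (f : ι → 𝓢(Plane, ℂ) → ℝ) : ∃ K, ∀ n i, f i (L.motherSymbol n) ≤ K := by
  obtain ⟨K₀, h₀⟩ := (finite_range fun i => f i (L.motherSymbol 0)).bddAbove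
  obtain ⟨K₁, h₁⟩ := (finite_range fun i => f i (L.motherSymbol 1)).bddAbove
  refine ⟨max K₀ K₁, fun n i => ?_⟩
  rcases n with _ | n
  · exact (h₀ ⟨i, rfl⟩).trans (le_max_left _ _)
  · exact (h₁ ⟨i, rfl⟩ : f i (L.motherSymbol 1) ≤ K₁).trans (le_max_right _ _)

theorem exists_kernelBound (L : DyadicCouple) : ∃ K, KernelBound L K := by
  obtain ⟨K₁, h₁⟩ := (finite_range fun k => kernelMoment 0 (annulusInverse k)).bddAbove
  obtain ⟨K₂, h₂⟩ := (finite_range fun i => kernelMoment 0 (freqMul i ballSymbol)).bddAbove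
  obtain ⟨K₃, h₃⟩ := exists_bound_motherSymbol L fun (j : Fin 2) m => kernelMoment j m
  obtain ⟨K₄, h₄⟩ := exists_bound_motherSymbol L fun i m => kernelMoment 0 (freqMul i m)
  obtain ⟨K₅, h₅⟩ := exists_bound_motherSymbol L fun (i : Fin 2 × Fin 2 × Fin 2) m =>
    kernelMoment i.1 (freqMul i.2.1 (freqMul i.2.2 m))
  have a₁ := abs_nonneg K₁
  have a₂ := abs_nonneg K₂
  have a₃ := abs_nonneg K₃
  have a₄ := abs_nonneg K₄
  have a₅ := abs_nonneg K₅
  refine ⟨|K₁| + |K₂| + |K₃| + |K₄| + |K₅|, by positivity, fun k => ?_, fun i => ?_, fun n => ?_,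
    fun n => ?_, fun n i => ?_, fun n i j => ?_, fun n i j => ?_⟩
  · have := (h₁ ⟨k, rfl⟩).trans (le_abs_self _)
    simp only at this
    linarith
  · have := (h₂ ⟨i, rfl⟩).trans (le_abs_self _)
    simp only at this
    linarith
  · have := (h₃ n 0).trans (le_abs_self _)
    simp only [Fin.val_zero] at this
    linarith
  · have := (h₃ n 1).trans (le_abs_self _)
    simp only [Fin.val_one] at this
    linarith
  · have := (h₄ n i).trans (le_abs_self _)
    linarith
  · have := (h₅ n (0, j, i)).trans (le_abs_self _)
    simp only [Fin.val_zero] at this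
    linarith
  · have := (h₅ n (1, j, i)).trans (le_abs_self _)
    simp only [Fin.val_one] at this
    linarith

section KernelBound

variable {L : DyadicCouple} {K : ℝ}

theorem KernelBound.block (hK : KernelBound L K) (q : ℕ) :
    kernelMoment 0 (L.blockSymbol q) ≤ K := by
  rw [DyadicCouple.blockSymbol, kernelMoment_dyadicDilate, pow_zero, inv_one, one_mul]
  exact hK.2.2.2.1 q

theorem KernelBound.block_one (hK : KernelBound L K) (q : ℕ) :
    kernelMoment 1 (L.blockSymbol q) ≤ (2 ^ q)⁻¹ * K := by
  rw [DyadicCouple.blockSymbol, kernelMoment_dyadicDilate, pow_one]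
  gcongr
  exact hK.2.2.2.2.1 q

theorem freqMul_blockSymbol (L : DyadicCouple) (q : ℕ) (i : Fin 2) :
    freqMul i (L.blockSymbol q) = ((2 : ℂ) ^ q) • dyadicDilate q (freqMul i (L.motherSymbol q)) :=
  freqMul_dyadicDilate i q _

theorem freqMul_smul (i : Fin 2) (c : ℂ) (m : 𝓢(Plane, ℂ)) :
    freqMul i (c • m) = c • freqMul i m := by
  rw [freqMul, map_smul, freqMul]

theorem freqMul_freqMul_blockSymbol (L : DyadicCouple) (q : ℕ) (i j : Fin 2) :
    freqMul j (freqMul i (L.blockSymbol q)) = ((2 : ℂ) ^ q * (2 : ℂ) ^ q) •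
      dyadicDilate q (freqMul j (freqMul i (L.motherSymbol q))) := by
  rw [freqMul_blockSymbol, freqMul_smul, freqMul_dyadicDilate, smul_smul]

theorem KernelBound.freqMul_block (hK : KernelBound L K) (q : ℕ) (i : Fin 2) :
    kernelMoment 0 (freqMul i (L.blockSymbol q)) ≤ 2 ^ q * K := by
  rw [freqMul_blockSymbol, kernelMoment_smul, kernelMoment_dyadicDilate, pow_zero, inv_one,
    one_mul, norm_pow, Complex.norm_ofNat]
  gcongr
  exact hK.2.2.2.2.2.1 q i

theorem KernelBound.freqMul_freqMul_block (hK : KernelBound L K) (q : ℕ) (i j : Fin 2) :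
    kernelMoment 0 (freqMul j (freqMul i (L.blockSymbol q))) ≤ 2 ^ q * 2 ^ q * K := by
  rw [freqMul_freqMul_blockSymbol, kernelMoment_smul, kernelMoment_dyadicDilate, pow_zero, inv_one,
    one_mul, norm_mul, norm_pow, Complex.norm_ofNat]
  gcongr
  exact hK.2.2.2.2.2.2.1 q i j

theorem KernelBound.freqMul_freqMul_block_one (hK : KernelBound L K) (q : ℕ) (i j : Fin 2) :
    kernelMoment 1 (freqMul j (freqMul i (L.blockSymbol q))) ≤ 2 ^ q * K := by
  rw [freqMul_freqMul_blockSymbol, kernelMoment_smul, kernelMoment_dyadicDilate, pow_one,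
    norm_mul, norm_pow, Complex.norm_ofNat]
  calc (2 : ℝ) ^ q * 2 ^ q * ((2 ^ q)⁻¹ * kernelMoment 1 (freqMul j (freqMul i (L.motherSymbol q))))
      = 2 ^ q * kernelMoment 1 (freqMul j (freqMul i (L.motherSymbol q))) := by field_simp
    _ ≤ _ := by gcongr; exact hK.2.2.2.2.2.2.2 q i j

/-! ### Bernstein inequalities -/

/-- The derivative is placed on the kernel of the dilated `ballSymbol`, so the block of `ρ` itself
appears on the right. -/
theorem KernelBound.eLpNorm_gradient_block_le (hK : KernelBound L K) (ρ : 𝓢'(Plane, ℂ)) (p : ℕ)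
    (i : Fin 2) :
    eLpNorm (multiplier (L.blockSymbol p) (∂_{basisVec i} ρ)) 2 volume ≤
      ENNReal.ofReal (2 ^ p * K) * eLpNorm (multiplier (L.blockSymbol p) ρ) 2 volume := by
  rw [multiplier_lineDeriv]
  conv_lhs => rw [← schwartzMul_ballSymbol]
  rw [freqMul_schwartzMul_left, multiplier_schwartzMul_eq]
  refine (eLpNorm_convMultiplier_le (contDiff_multiplier _ _).continuous _).trans ?_
  gcongr
  rw [freqMul_dyadicDilate, kernelMoment_smul, kernelMoment_dyadicDilate, pow_zero, inv_one,
    one_mul, norm_pow, Complex.norm_ofNat]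
  gcongr
  exact hK.2.2.1 i

theorem KernelBound.annulusInverse_le (hK : KernelBound L K) (n : ℕ) (k : Fin 2) :
    kernelMoment 0 (((2 : ℂ) ^ n)⁻¹ • dyadicDilate n (annulusInverse k)) ≤ (2 ^ n)⁻¹ * K := by
  rw [kernelMoment_smul, kernelMoment_dyadicDilate, pow_zero, inv_one, one_mul, norm_inv, norm_pow,
    Complex.norm_ofNat]
  gcongr
  exact hK.2.1 k

/-- A dyadic block of positive index is a divergence. -/
theorem KernelBound.exists_potential (hK : KernelBound L K) (ρ : 𝓢'(Plane, ℂ)) (p : ℕ) :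
    ∃ g : Fin 2 → Plane → ℂ, (∀ k, (g k).HasTemperateGrowth) ∧
      (∀ x, multiplier (L.blockSymbol (p + 1)) ρ x = ∑ k, partialDeriv k (g k) x) ∧
      ∀ k, eLpNorm (g k) 2 volume ≤ ENNReal.ofReal ((2 ^ (p + 1))⁻¹ * K) *
        eLpNorm (multiplier (L.blockSymbol (p + 1)) ρ) 2 volume := by
  refine ⟨fun k => multiplier (schwartzMul
    (((2 : ℂ) ^ (p + 1))⁻¹ • dyadicDilate (p + 1) (annulusInverse k)) (L.blockSymbol (p + 1))) ρ,
    fun k => hasTemperateGrowth_multiplier _ _, fun x => ?_, fun k => ?_⟩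
  · have h : ∀ (k : Fin 2) (m : 𝓢(Plane, ℂ)),
        partialDeriv k (multiplier m ρ) x = multiplier (freqMul k m) ρ x := fun k m =>
      (congrFun (partialDeriv_multiplier _ _ _) x).trans (congrFun (multiplier_lineDeriv _ _ _) x)
    simp_rw [h]
    rw [← multiplier_sum_symbol]
    congr 1
    exact (sum_freqMul_annulusInverse (isAnnular_motherSymbol L p) (p + 1)).symm
  · beta_reduce
    rw [multiplier_schwartzMul_eq]
    refine (eLpNorm_convMultiplier_le (contDiff_multiplier _ _).continuous _).trans ?_
    gcongr
    exact hK.annulusInverse_le _ _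

/-- Reverse Bernstein inequality in L^∞: the symbol is a sum of derivatives of potentials, and the
derivatives are passed to `u`. The 2 counts the components of the gradient. -/
theorem KernelBound.norm_annular_le (hK : KernelBound L K) {μ : 𝓢(Plane, ℂ)} (hμ : IsAnnular μ)
    (n : ℕ) (u : 𝓢'(Plane, ℂ)) {B : ℝ}
    (hB : ∀ k y, ‖multiplier (dyadicDilate n μ) (∂_{basisVec k} u) y‖ ≤ B) (x : Plane) :
    ‖multiplier (dyadicDilate n μ) u x‖ ≤ 2 * K * B * (2 ^ n)⁻¹ := by
  have hB0 : 0 ≤ B := (norm_nonneg _).trans (hB 0 0)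
  rw [← sum_freqMul_annulusInverse hμ n, multiplier_sum_symbol]
  have h : ∀ k, ‖multiplier (freqMul k (schwartzMul
      (((2 : ℂ) ^ n)⁻¹ • dyadicDilate n (annulusInverse k)) (dyadicDilate n μ))) u x‖ ≤
      B * ((2 ^ n)⁻¹ * K) := by
    intro k
    rw [freqMul_schwartzMul_right, multiplier_schwartzMul, ← multiplier_lineDeriv]
    refine (norm_integral_kernel_le _ (hB k) x).trans ?_
    gcongr
    exact hK.annulusInverse_le _ _
  refine (norm_sum_le _ _).trans ((Finset.sum_le_sum fun k _ => h k).trans (le_of_eq ?_))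
  rw [Fin.sum_univ_two]
  ring

end KernelBound

end LosingTransport

namespace LosingTransport

/-! ### Localized advection terms -/

/-- `Δ_q (w · ∇ Δ_p ρ)`. -/
noncomputable def advBlock (L : DyadicCouple) (q p : ℕ) (ρ : 𝓢'(Plane, ℂ)) (w : Fin 2 → Plane → ℂ)
    (x : Plane) : ℂ :=
  ∑ i, convMultiplier (L.blockSymbol q) (w i * multiplier (L.blockSymbol p) (∂_{basisVec i} ρ)) x

section AdvBlock

variable {L : DyadicCouple} {K : ℝ} {w : Fin 2 → Plane → ℂ}

theorem continuous_advBlock (hw : ∀ i, (w i).HasTemperateGrowth) (q p : ℕ) (ρ : 𝓢'(Plane, ℂ)) :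
    Continuous (advBlock L q p ρ w) :=
  continuous_finsetSum _ fun i _ =>
    continuous_convMultiplier ((hw i).mul (hasTemperateGrowth_multiplier _ _)) _

theorem advBlock_add {w' : Fin 2 → Plane → ℂ} (hw : ∀ i, (w i).HasTemperateGrowth)
    (hw' : ∀ i, (w' i).HasTemperateGrowth) (q p : ℕ) (ρ : 𝓢'(Plane, ℂ)) (x : Plane) :
    advBlock L q p ρ (fun i => w i + w' i) x = advBlock L q p ρ w x + advBlock L q p ρ w' x := by
  unfold advBlock
  rw [← Finset.sum_add_distrib]
  refine Finset.sum_congr rfl fun i _ => ?_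
  rw [← convMultiplier_add ((hw i).mul (hasTemperateGrowth_multiplier _ _))
    ((hw' i).mul (hasTemperateGrowth_multiplier _ _)), add_mul]

theorem eLpNorm_sum_two_le {F : Fin 2 → Plane → ℂ} (hF : ∀ i, Continuous (F i)) {c : ENNReal}
    (h : ∀ i, eLpNorm (F i) 2 volume ≤ c) :
    eLpNorm (fun x => ∑ i, F i x) 2 volume ≤ 2 * c := by
  have h1 : (fun x => ∑ i, F i x) = ∑ i, F i := by ext x; simp
  rw [h1]
  refine (eLpNorm_sum_le (fun i _ => (hF i).aestronglyMeasurable) one_le_two).trans ?_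
  rw [Fin.sum_univ_two, two_mul]
  gcongr <;> exact h _

theorem two_mul_ofReal {a : ℝ} : 2 * ENNReal.ofReal a = ENNReal.ofReal (2 * a) := by
  rw [ENNReal.ofReal_mul zero_le_two, ENNReal.ofReal_ofNat]

theorem ofReal_mul_le_ofReal_mul {a b c : ℝ} {E F : ENNReal} (hab : a ≤ b) (hb : 0 ≤ b)
    (h : E ≤ ENNReal.ofReal c * F) : ENNReal.ofReal a * E ≤ ENNReal.ofReal (b * c) * F := by
  rw [ENNReal.ofReal_mul hb, mul_assoc]
  exact mul_le_mul' (ENNReal.ofReal_le_ofReal hab) h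

theorem ofReal_mul_le_of_le {a b : ℝ} (hab : a ≤ b) (F : ENNReal) :
    ENNReal.ofReal a * F ≤ ENNReal.ofReal b * F :=
  mul_le_mul' (ENNReal.ofReal_le_ofReal hab) le_rfl

/-- The derivative remains on the block of `ρ` and costs 2^p by Bernstein; this is the better bound
for `p ≤ q`. -/
theorem KernelBound.eLpNorm_advBlock_le_low (hK : KernelBound L K)
    (hw : ∀ i, (w i).HasTemperateGrowth) {B : ℝ} (hB : ∀ i y, ‖w i y‖ ≤ B) (q p : ℕ)
    (ρ : 𝓢'(Plane, ℂ)) :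
    eLpNorm (advBlock L q p ρ w) 2 volume ≤
      ENNReal.ofReal (2 * (B * K * (2 ^ p * K))) *
        eLpNorm (multiplier (L.blockSymbol p) ρ) 2 volume := by
  have hB0 : 0 ≤ B := (norm_nonneg _).trans (hB 0 0)
  have hK0 := hK.1
  rw [← two_mul_ofReal, mul_assoc]
  refine eLpNorm_sum_two_le (fun i =>
    continuous_convMultiplier ((hw i).mul (hasTemperateGrowth_multiplier _ _)) _) fun i => ?_
  refine (eLpNorm_convMultiplier_mul_le hB0 (contDiff_multiplier _ _).continuous (hB i) _).trans ?_
  exact ofReal_mul_le_ofReal_mul (mul_le_mul_of_nonneg_left (hK.block q) hB0) (by positivity)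
    (hK.eLpNorm_gradient_block_le ρ p i)

/-- For a divergence free field the derivative falls on the kernel. -/
theorem advBlock_eq_of_divergence (hw : ∀ i, (w i).HasTemperateGrowth)
    (hdiv : ∀ y, ∑ i, partialDeriv i (w i) y = 0) (q p : ℕ) (ρ : 𝓢'(Plane, ℂ)) (x : Plane) :
    advBlock L q p ρ w x = ∑ i, convMultiplier (freqMul i (L.blockSymbol q))
      (w i * multiplier (L.blockSymbol p) ρ) x := by
  have hρ := hasTemperateGrowth_multiplier (L.blockSymbol p) ρ
  have h1 : ∀ i, convMultiplier (freqMul i (L.blockSymbol q))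
      (w i * multiplier (L.blockSymbol p) ρ) x = convMultiplier (L.blockSymbol q)
        (partialDeriv i (w i) * multiplier (L.blockSymbol p) ρ) x +
      convMultiplier (L.blockSymbol q)
        (w i * multiplier (L.blockSymbol p) (∂_{basisVec i} ρ)) x := by
    intro i
    rw [← convMultiplier_partialDeriv ((hw i).mul hρ), ← convMultiplier_add
      ((hasTemperateGrowth_partialDeriv (hw i) i).mul hρ)
      ((hw i).mul (hasTemperateGrowth_multiplier _ _)), ← partialDeriv_multiplier]
    congr 1
    ext y
    exact partialDeriv_mul (hw i) hρ i y
  rw [Finset.sum_congr rfl fun i _ => h1 i, Finset.sum_add_distrib, ← convMultiplier_sum _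
    fun i _ => (hasTemperateGrowth_partialDeriv (hw i) i).mul hρ]
  have h2 : (fun y => ∑ i, (partialDeriv i (w i) * multiplier (L.blockSymbol p) ρ) y) =
      fun _ => 0 := by
    ext y
    simp only [Pi.mul_apply]
    rw [← Finset.sum_mul, hdiv, zero_mul]
  rw [h2]
  simp [convMultiplier, advBlock]

/-- The divergence condition puts the derivative on the kernel of the outer block, so the cost is
2^q instead of 2^p. -/
theorem KernelBound.eLpNorm_advBlock_le_high (hK : KernelBound L K)
    (hw : ∀ i, (w i).HasTemperateGrowth) (hdiv : ∀ y, ∑ i, partialDeriv i (w i) y = 0)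
    {B : ℝ} (hB : ∀ i y, ‖w i y‖ ≤ B) (q p : ℕ) (ρ : 𝓢'(Plane, ℂ)) :
    eLpNorm (advBlock L q p ρ w) 2 volume ≤
      ENNReal.ofReal (2 * (B * (2 ^ q * K))) *
        eLpNorm (multiplier (L.blockSymbol p) ρ) 2 volume := by
  have hB0 : 0 ≤ B := (norm_nonneg _).trans (hB 0 0)
  rw [← two_mul_ofReal, mul_assoc, funext (advBlock_eq_of_divergence hw hdiv q p ρ)]
  refine eLpNorm_sum_two_le (fun i =>
    continuous_convMultiplier ((hw i).mul (hasTemperateGrowth_multiplier _ _)) _) fun i => ?_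
  refine (eLpNorm_convMultiplier_mul_le hB0 (contDiff_multiplier _ _).continuous (hB i) _).trans ?_
  gcongr
  exact hK.freqMul_block q i

/-- Both bounds together. -/
theorem KernelBound.eLpNorm_advBlock_le (hK : KernelBound L K)
    (hw : ∀ i, (w i).HasTemperateGrowth) (hdiv : ∀ y, ∑ i, partialDeriv i (w i) y = 0)
    {B : ℝ} (hB : ∀ i y, ‖w i y‖ ≤ B) (q p : ℕ) (ρ : 𝓢'(Plane, ℂ)) :
    eLpNorm (advBlock L q p ρ w) 2 volume ≤
      ENNReal.ofReal (2 * K * (K + 1) * (B * 2 ^ (min p q))) *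
        eLpNorm (multiplier (L.blockSymbol p) ρ) 2 volume := by
  have hB0 : 0 ≤ B := (norm_nonneg _).trans (hB 0 0)
  have hK0 := hK.1
  rcases le_total p q with h | h
  · refine (hK.eLpNorm_advBlock_le_low hw hB q p ρ).trans (ofReal_mul_le_of_le ?_ _)
    rw [min_eq_left h]
    have : 0 ≤ K * (B * 2 ^ p) := by positivity
    linarith
  · refine (hK.eLpNorm_advBlock_le_high hw hdiv hB q p ρ).trans (ofReal_mul_le_of_le ?_ _)
    rw [min_eq_right h]
    have : 0 ≤ K * (B * 2 ^ q) * K := by positivity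
    linarith

/-! ### Commutators of the blocks with transport. -/

/-- The transported block `w · ∇ Δ_q Δ_p ρ`. -/
noncomputable def transportBlock (L : DyadicCouple) (q p : ℕ) (ρ : 𝓢'(Plane, ℂ))
    (w : Fin 2 → Plane → ℂ) (x : Plane) : ℂ :=
  ∑ i, w i x *
    convMultiplier (L.blockSymbol q) (multiplier (L.blockSymbol p) (∂_{basisVec i} ρ)) x

theorem continuous_transportBlock (hw : ∀ i, Continuous (w i)) (q p : ℕ) (ρ : 𝓢'(Plane, ℂ)) :
    Continuous (transportBlock L q p ρ w) :=
  continuous_finsetSum _ fun i _ =>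
    (hw i).mul (continuous_convMultiplier (hasTemperateGrowth_multiplier _ _) _)

/-- The first moment of the outer kernel gains 2^{-q} against the Lipschitz constant, and Bernstein
costs 2^p. The quotient is a decay when `p ≤ q`. -/
theorem KernelBound.eLpNorm_advBlock_sub_le_low (hK : KernelBound L K)
    (hw : ∀ i, (w i).HasTemperateGrowth) {l : ℝ} (hl : 0 ≤ l)
    (hlip : ∀ i x y, ‖w i y - w i x‖ ≤ l * ‖y - x‖) (q p : ℕ) (ρ : 𝓢'(Plane, ℂ)) :
    eLpNorm (fun x => advBlock L q p ρ w x - transportBlock L q p ρ w x) 2 volume ≤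
      ENNReal.ofReal (2 * (l * ((2 ^ q)⁻¹ * K) * (2 ^ p * K))) *
        eLpNorm (multiplier (L.blockSymbol p) ρ) 2 volume := by
  have hK0 := hK.1
  rw [← two_mul_ofReal, mul_assoc]
  simp only [advBlock, transportBlock, ← Finset.sum_sub_distrib]
  refine eLpNorm_sum_two_le (fun i =>
    continuous_commutator (hasTemperateGrowth_multiplier _ _) (hw i) _) fun i => ?_
  refine (eLpNorm_commutator_le hl (hasTemperateGrowth_multiplier _ _) (hw i) (hlip i) _).trans ?_
  exact ofReal_mul_le_ofReal_mul (mul_le_mul_of_nonneg_left (hK.block_one q) hl) (by positivity)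
    (hK.eLpNorm_gradient_block_le ρ p i)

theorem partialDeriv_sub_const_mul {F G : Plane → ℂ} (hF : F.HasTemperateGrowth)
    (hG : G.HasTemperateGrowth) (c : ℂ) (i : Fin 2) (y : Plane) :
    partialDeriv i (fun z => (F z - c) * G z) y =
      partialDeriv i F y * G y + (F y - c) * partialDeriv i G y := by
  have h1 : DifferentiableAt ℝ F y := hF.1.contDiffAt.differentiableAt (by simp)
  have h2 : DifferentiableAt ℝ G y := hG.1.contDiffAt.differentiableAt (by simp)
  rw [partialDeriv, fderiv_fun_mul (h1.sub_const c) h2, fderiv_sub_const]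
  simp only [add_apply, smul_apply, smul_eq_mul]
  ring

theorem hasTemperateGrowth_sub_const {F : Plane → ℂ} (hF : F.HasTemperateGrowth) (c : ℂ) :
    (fun z => F z - c).HasTemperateGrowth :=
  hF.sub (Function.HasTemperateGrowth.const c)

/-- The commutator with a divergence free field, with all the derivatives on the kernel: here
`g` is a potential of the transported function. -/
theorem advBlock_sub_transportBlock_eq (hw : ∀ i, (w i).HasTemperateGrowth)
    (hdiv : ∀ y, ∑ i, partialDeriv i (w i) y = 0) (q p : ℕ) (ρ : 𝓢'(Plane, ℂ))
    {g : Fin 2 → Plane → ℂ} (hg : ∀ k, (g k).HasTemperateGrowth)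
    (hgρ : ∀ x, multiplier (L.blockSymbol p) ρ x = ∑ k, partialDeriv k (g k) x) (x : Plane) :
    advBlock L q p ρ w x - transportBlock L q p ρ w x =
      ∑ i, ∑ k, ((∫ y, (w i y - w i x) * g k y *
          𝓕 (freqMul k (freqMul i (L.blockSymbol q))) (y - x)) -
        ∫ y, partialDeriv k (w i) y * g k y * 𝓕 (freqMul i (L.blockSymbol q)) (y - x)) := by
  have hρ := hasTemperateGrowth_multiplier (L.blockSymbol p) ρ
  have hW : ∀ i, (fun z => w i z - w i x).HasTemperateGrowth :=
    fun i => hasTemperateGrowth_sub_const (hw i) _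
  -- The commutator at `x` is the advection by the field frozen to zero at `x`. Subtracting a
  -- constant does not change the divergence.
  have step1 : advBlock L q p ρ w x - transportBlock L q p ρ w x =
      advBlock L q p ρ (fun i z => w i z - w i x) x := by
    unfold advBlock transportBlock
    rw [← Finset.sum_sub_distrib]
    refine Finset.sum_congr rfl fun i _ => ?_
    unfold convMultiplier
    rw [← integral_const_mul, ← integral_sub (integrable_convMultiplier ((hw i).mul
      (hasTemperateGrowth_multiplier _ _)) _ x) ((integrable_convMultiplier
      (hasTemperateGrowth_multiplier _ _) _ x).const_mul _)]
    congr 1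
    ext y
    simp only [Pi.mul_apply]
    ring
  have hpd : ∀ i k y, partialDeriv k (fun z => w i z - w i x) y = partialDeriv k (w i) y := by
    intro i k y
    rw [partialDeriv, fderiv_sub_const]
  rw [step1, advBlock_eq_of_divergence hW (fun y => by simp only [hpd, hdiv])]
  refine Finset.sum_congr rfl fun i _ => ?_
  have step2 : ∀ k, (∫ y, (w i y - w i x) * partialDeriv k (g k) y *
      𝓕 (freqMul i (L.blockSymbol q)) (y - x)) =
      (∫ y, (w i y - w i x) * g k y * 𝓕 (freqMul k (freqMul i (L.blockSymbol q))) (y - x)) -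
        ∫ y, partialDeriv k (w i) y * g k y * 𝓕 (freqMul i (L.blockSymbol q)) (y - x) := by
    intro k
    have h2 := hasTemperateGrowth_partialDeriv ((hW i).mul (hg k)) k
    have h3 := (hasTemperateGrowth_partialDeriv (hw i) k).mul (hg k)
    rw [← integral_partialDeriv_mul_kernel (F := fun y => (w i y - w i x) * g k y)
      ((hW i).mul (hg k))]
    refine Eq.trans ?_ (integral_sub (integrable_convMultiplier h2 _ x)
      (integrable_convMultiplier h3 _ x))
    congr 1
    ext y
    change _ = partialDeriv k (fun z => (w i z - w i x) * g k z) y * _ - _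
    rw [partialDeriv_sub_const_mul (hw i) (hg k)]
    ring
  rw [← Finset.sum_congr rfl fun k _ => step2 k, ← integral_finsetSum]
  · unfold convMultiplier
    congr 1
    ext y
    rw [Pi.mul_apply, hgρ, Finset.mul_sum, Finset.sum_mul]
  · exact fun k _ => integrable_convMultiplier
      ((hW i).mul (hasTemperateGrowth_partialDeriv (hg k) k)) _ x

theorem eLpNorm_sum_sub_two_le {F G : Fin 2 → Fin 2 → Plane → ℂ}
    (hF : ∀ i k, AEStronglyMeasurable (F i k) volume)
    (hG : ∀ i k, AEStronglyMeasurable (G i k) volume) {c d : ENNReal}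
    (h : ∀ i k, eLpNorm (F i k) 2 volume ≤ c) (h' : ∀ i k, eLpNorm (G i k) 2 volume ≤ d) :
    eLpNorm (fun x => ∑ i, ∑ k, (F i k x - G i k x)) 2 volume ≤ 4 * (c + d) := by
  have h1 : (fun x => ∑ i, ∑ k, (F i k x - G i k x)) = ∑ i, ∑ k, (F i k - G i k) := by
    ext x; simp
  have h2 : ∀ i k, eLpNorm (F i k - G i k) 2 volume ≤ c + d := fun i k =>
    (eLpNorm_sub_le (hF i k) (hG i k) one_le_two).trans (add_le_add (h i k) (h' i k))
  rw [h1, Fin.sum_univ_two, Fin.sum_univ_two, Fin.sum_univ_two]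
  have hm : ∀ i k, AEStronglyMeasurable (F i k - G i k) volume := fun i k => (hF i k).sub (hG i k)
  refine (eLpNorm_add_le ((hm 0 0).add (hm 0 1)) ((hm 1 0).add (hm 1 1)) one_le_two).trans ?_
  refine (add_le_add (eLpNorm_add_le (hm 0 0) (hm 0 1) one_le_two)
    (eLpNorm_add_le (hm 1 0) (hm 1 1) one_le_two)).trans ?_
  calc _ ≤ (c + d + (c + d)) + ((c + d) + (c + d)) := by gcongr <;> exact h2 _ _
    _ = 4 * (c + d) := by ring

theorem continuous_integral_sub_mul_kernel {F G : Plane → ℂ} (hF : F.HasTemperateGrowth)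
    (hG : G.HasTemperateGrowth) (m : 𝓢(Plane, ℂ)) :
    Continuous fun x => ∫ y, (F y - F x) * G y * 𝓕 m (y - x) := by
  have h : (fun x => ∫ y, (F y - F x) * G y * 𝓕 m (y - x)) =
      fun x => convMultiplier m (F * G) x - F x * convMultiplier m G x := by
    ext x
    unfold convMultiplier
    rw [← integral_const_mul, ← integral_sub (integrable_convMultiplier (hF.mul hG) m x)
      ((integrable_convMultiplier hG m x).const_mul _)]
    congr 1
    ext y
    rw [Pi.mul_apply]
    ring
  rw [h]
  exact continuous_commutator hG hF m

/-- The potential gains 2^{-(p+1)}. Two derivatives on the kernel cost 2^{2q}, reduced to 2^q by the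
first moment and the Lipschitz bound; when the second derivative hits the field instead, the cost is
2^q directly. The constant is 12 = 4·(2+1): four pairs of indices, Lipschitz constant `2 * l`,
derivative bound `l`. -/
theorem KernelBound.eLpNorm_advBlock_sub_le_high (hK : KernelBound L K)
    (hw : ∀ i, (w i).HasTemperateGrowth) (hdiv : ∀ y, ∑ i, partialDeriv i (w i) y = 0)
    {l : ℝ} (hl : 0 ≤ l) (hder : ∀ i k x, ‖partialDeriv k (w i) x‖ ≤ l)
    (hlip : ∀ i x y, ‖w i y - w i x‖ ≤ 2 * l * ‖y - x‖) (q p : ℕ) (ρ : 𝓢'(Plane, ℂ)) :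
    eLpNorm (fun x => advBlock L q (p + 1) ρ w x - transportBlock L q (p + 1) ρ w x) 2 volume ≤
      ENNReal.ofReal (12 * (l * (2 ^ q * K) * ((2 ^ (p + 1))⁻¹ * K))) *
        eLpNorm (multiplier (L.blockSymbol (p + 1)) ρ) 2 volume := by
  have hK0 := hK.1
  obtain ⟨g, hg, hgρ, hgn⟩ := hK.exists_potential ρ p
  rw [funext (advBlock_sub_transportBlock_eq hw hdiv q (p + 1) ρ hg hgρ)]
  set E := eLpNorm (multiplier (L.blockSymbol (p + 1)) ρ) 2 volume
  refine (eLpNorm_sum_sub_two_le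
    (c := ENNReal.ofReal (2 * l * (2 ^ q * K)) * (ENNReal.ofReal ((2 ^ (p + 1))⁻¹ * K) * E))
    (d := ENNReal.ofReal (l * (2 ^ q * K)) * (ENNReal.ofReal ((2 ^ (p + 1))⁻¹ * K) * E))
    (fun i k => (continuous_integral_sub_mul_kernel (hw i) (hg k) _).aestronglyMeasurable)
    (fun i k => (continuous_convMultiplier ((hasTemperateGrowth_partialDeriv (hw i) k).mul (hg k))
      _).aestronglyMeasurable) (fun i k => ?_) fun i k => ?_).trans (le_of_eq ?_)
  · refine (eLpNorm_integral_kernel_le (F := g k) (W := fun x y => w i y - w i x) (A := 2 * l)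
      (by positivity) 1 _ (hg k).1.continuous (by simpa using hlip i) fun x => rfl).trans ?_
    gcongr
    · exact hK.freqMul_freqMul_block_one q i k
    · exact hgn k
  · refine (eLpNorm_integral_kernel_le (F := g k) (W := fun x y => partialDeriv k (w i) y)
      hl 0 _ (hg k).1.continuous (fun _ y => by simpa using hder i k y) fun x => rfl).trans ?_
    gcongr
    · exact hK.freqMul_block q i
    · exact hgn k
  · rw [← add_mul, ← ENNReal.ofReal_add (by positivity) (by positivity), ← mul_assoc, ← mul_assoc,
      show (4 : ENNReal) = ENNReal.ofReal 4 by simp, ← ENNReal.ofReal_mul (by positivity),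
      ← ENNReal.ofReal_mul (by positivity)]
    congr 2
    ring

theorem KernelBound.eLpNorm_advBlock_sub_le (hK : KernelBound L K)
    (hw : ∀ i, (w i).HasTemperateGrowth) (hdiv : ∀ y, ∑ i, partialDeriv i (w i) y = 0)
    {l : ℝ} (hder : ∀ i k x, ‖partialDeriv k (w i) x‖ ≤ l) (q p : ℕ) (ρ : 𝓢'(Plane, ℂ)) :
    eLpNorm (fun x => advBlock L q p ρ w x - transportBlock L q p ρ w x) 2 volume ≤
      ENNReal.ofReal (12 * K * K * (l * (2 ^ (min p q) * (2 ^ (max p q))⁻¹))) *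
        eLpNorm (multiplier (L.blockSymbol p) ρ) 2 volume := by
  have hK0 := hK.1
  have hl : 0 ≤ l := (norm_nonneg _).trans (hder 0 0 0)
  have hlip : ∀ i x y, ‖w i y - w i x‖ ≤ 2 * l * ‖y - x‖ := fun i x y =>
    norm_sub_le_of_partialDeriv_le ((hw i).1.differentiable (by simp)) (hder i) x y
  rcases le_or_gt p q with h | h
  · refine (hK.eLpNorm_advBlock_sub_le_low hw (by positivity) hlip q p ρ).trans (ofReal_mul_le_of_le ?_ _)
    rw [min_eq_left h, max_eq_right h]
    have : 0 ≤ K * K * (l * (2 ^ p * (2 ^ q)⁻¹)) := by positivity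
    linarith
  · obtain ⟨p, rfl⟩ := Nat.exists_eq_add_one_of_ne_zero (by omega : p ≠ 0)
    refine (hK.eLpNorm_advBlock_sub_le_high hw hdiv hl hder hlip q p ρ).trans (ofReal_mul_le_of_le ?_ _)
    rw [min_eq_right h.le, max_eq_left h.le]
    apply le_of_eq
    ring

/-- The bound of `Δ_q Δ_p ∂_i ρ`. -/
theorem KernelBound.eLpNorm_convMultiplier_gradient_le (hK : KernelBound L K) (q p : ℕ)
    (ρ : 𝓢'(Plane, ℂ)) (i : Fin 2) :
    eLpNorm (convMultiplier (L.blockSymbol q) (multiplier (L.blockSymbol p) (∂_{basisVec i} ρ)))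
      2 volume ≤ ENNReal.ofReal (2 * K * K * (2 ^ q * (2 ^ (min p q) * (2 ^ (max p q))⁻¹))) *
        eLpNorm (multiplier (L.blockSymbol p) ρ) 2 volume := by
  have hK0 := hK.1
  rcases le_or_gt p q with h | h
  · refine (eLpNorm_convMultiplier_le (contDiff_multiplier _ _).continuous _).trans ?_
    refine (mul_le_mul' (ENNReal.ofReal_le_ofReal (hK.block q))
      (hK.eLpNorm_gradient_block_le ρ p i)).trans ?_
    rw [← mul_assoc, ← ENNReal.ofReal_mul hK0, min_eq_left h, max_eq_right h]
    refine ofReal_mul_le_of_le ?_ _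
    have : (2 : ℝ) ^ q * (2 ^ p * (2 ^ q)⁻¹) = 2 ^ p := by field_simp
    rw [this]
    have : 0 ≤ K * K * 2 ^ p := by positivity
    linarith
  · obtain ⟨p, rfl⟩ := Nat.exists_eq_add_one_of_ne_zero (by omega : p ≠ 0)
    obtain ⟨g, hg, hgρ, hgn⟩ := hK.exists_potential ρ p
    -- Both the gradient and the divergence form of the block are transferred to the outer kernel:
    -- 2^{2q} against the gain 2^{-(p+1)} of the potential.
    have h1 : convMultiplier (L.blockSymbol q)
        (multiplier (L.blockSymbol (p + 1)) (∂_{basisVec i} ρ)) = fun x => ∑ k,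
        convMultiplier (freqMul k (freqMul i (L.blockSymbol q))) (g k) x := by
      ext x
      rw [← partialDeriv_multiplier, convMultiplier_partialDeriv (hasTemperateGrowth_multiplier _ _),
        funext hgρ, convMultiplier_sum _ fun k _ => hasTemperateGrowth_partialDeriv (hg k) k]
      refine Finset.sum_congr rfl fun k _ => ?_
      rw [convMultiplier_partialDeriv (hg k)]
    rw [h1]
    refine (eLpNorm_sum_two_le (fun k => continuous_convMultiplier (hg k) _) fun k =>
      (eLpNorm_convMultiplier_le (hg k).1.continuous _).trans (mul_le_mul'
        (ENNReal.ofReal_le_ofReal (hK.freqMul_freqMul_block q i k)) (hgn k))).trans ?_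
    rw [← mul_assoc, ← mul_assoc, two_mul_ofReal, ← ENNReal.ofReal_mul (by positivity),
      min_eq_right h.le, max_eq_left h.le]
    refine ofReal_mul_le_of_le ?_ _
    apply le_of_eq
    ring

theorem KernelBound.eLpNorm_transportBlock_le (hK : KernelBound L K)
    (hw : ∀ i, Continuous (w i)) {B : ℝ} (hB : ∀ i y, ‖w i y‖ ≤ B) (q p : ℕ) (ρ : 𝓢'(Plane, ℂ)) :
    eLpNorm (transportBlock L q p ρ w) 2 volume ≤
      ENNReal.ofReal (4 * K * K * (B * 2 ^ q * (2 ^ (min p q) * (2 ^ (max p q))⁻¹))) *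
        eLpNorm (multiplier (L.blockSymbol p) ρ) 2 volume := by
  have hK0 := hK.1
  have hB0 : 0 ≤ B := (norm_nonneg _).trans (hB 0 0)
  refine (eLpNorm_sum_two_le (fun i =>
    (hw i).mul (continuous_convMultiplier (hasTemperateGrowth_multiplier _ _) _)) fun i =>
    (eLpNorm_le_nnreal_smul_eLpNorm_of_ae_le_mul (c := B.toNNReal) (g := convMultiplier
      (L.blockSymbol q) (multiplier (L.blockSymbol p) (∂_{basisVec i} ρ)))
      (Eventually.of_forall fun x => ?_) 2).trans (?_ : _ ≤
      ENNReal.ofReal B * (ENNReal.ofReal (2 * K * K * (2 ^ q * (2 ^ (min p q) * (2 ^ (max p q))⁻¹))) *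
        eLpNorm (multiplier (L.blockSymbol p) ρ) 2 volume))).trans ?_
  · rw [← NNReal.coe_le_coe]
    simp only [coe_nnnorm, NNReal.coe_mul, Real.coe_toNNReal B hB0]
    rw [Pi.mul_apply, norm_mul]
    exact mul_le_mul_of_nonneg_right (hB i x) (norm_nonneg _)
  · rw [ENNReal.smul_def, smul_eq_mul]
    exact mul_le_mul' le_rfl (hK.eLpNorm_convMultiplier_gradient_le q p ρ i)
  · rw [← mul_assoc, ← mul_assoc, two_mul_ofReal, ← ENNReal.ofReal_mul (by positivity)]
    refine ofReal_mul_le_of_le ?_ _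
    apply le_of_eq
    ring

end AdvBlock

end LosingTransport

namespace LosingTransport

/-! ### Fields with a logarithmically growing Lipschitz norm -/

/-- The vector field is real, divergence free, and the gradients of its low frequency cut-offs
grow at most like `√(1 + N)`. -/
structure GradBound (L : DyadicCouple) (v : Fin 2 → 𝓢'(Plane, ℂ)) (A : ℝ) : Prop where
  nonneg : 0 ≤ A
  real : ∀ i, IsRealDistribution (v i)
  div : divergence v = 0
  bound : ∀ N i k x,
    ‖multiplier (L.lowSymbol N) (∂_{basisVec k} (v i)) x‖ ≤ A * Real.sqrt (1 + N)

section GradBound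

variable {L : DyadicCouple} {K A : ℝ} {v : Fin 2 → 𝓢'(Plane, ℂ)}

theorem GradBound.sum_partialDeriv (hv : GradBound L v A) (m : 𝓢(Plane, ℂ)) (y : Plane) :
    ∑ i, partialDeriv i (multiplier m (v i)) y = 0 := by
  have h : ∀ i, partialDeriv i (multiplier m (v i)) y = multiplier m (∂_{basisVec i} (v i)) y :=
    fun i => congrFun (partialDeriv_multiplier _ _ _) y
  rw [Finset.sum_congr rfl fun i _ => h i, ← multiplier_sum_distribution]
  have h2 := hv.div
  rw [divergence] at h2
  rw [h2]
  rfl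

theorem GradBound.norm_partialDeriv_low_le (hv : GradBound L v A) (N : ℕ) (i k : Fin 2)
    (x : Plane) : ‖partialDeriv k (multiplier (L.lowSymbol N) (v i)) x‖ ≤ A * Real.sqrt (1 + N) := by
  rw [partialDeriv_multiplier]
  exact hv.bound N i k x

/-- A block is the difference of two consecutive low frequency cut-offs, so its gradient is bounded,
and it is annular, so reverse Bernstein applies. The index `r + 1` excludes the lowest block, which
is not annular. -/
theorem GradBound.norm_block_le (hK : KernelBound L K) (hv : GradBound L v A) (r : ℕ) (i : Fin 2)
    (x : Plane) : ‖multiplier (L.blockSymbol (r + 1)) (v i) x‖ ≤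
      4 * K * A * ((2 ^ (r + 1))⁻¹ * Real.sqrt (1 + (r + 1 : ℕ))) := by
  have hB : ∀ k y, ‖multiplier (dyadicDilate (r + 1) (L.motherSymbol (r + 1)))
      (∂_{basisVec k} (v i)) y‖ ≤ 2 * (A * Real.sqrt (1 + (r + 1 : ℕ))) := by
    intro k y
    have h1 : L.blockSymbol (r + 1) = L.lowSymbol (r + 1) - L.lowSymbol r := by
      rw [L.lowSymbol_succ, add_sub_cancel_left]
    have h2 := hv.bound (r + 1) i k y
    have h3 := hv.bound r i k y
    change ‖multiplier (L.blockSymbol (r + 1)) _ y‖ ≤ _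
    rw [h1, multiplier_sub_symbol, two_mul]
    refine (norm_sub_le _ _).trans (add_le_add h2 (h3.trans ?_))
    have := hv.nonneg
    gcongr
    exact_mod_cast Nat.le_succ r
  refine (hK.norm_annular_le (isAnnular_motherSymbol L r) (r + 1) (v i) hB x).trans (le_of_eq ?_)
  ring

theorem conj_multiplier_lowSymbol {u : 𝓢'(Plane, ℂ)} (hu : IsRealDistribution u) (N : ℕ)
    (x : Plane) : (starRingEnd ℂ) (multiplier (L.lowSymbol N) u x) =
      multiplier (dyadicDilate N (reflectSymbol (L.motherSymbol 0))) u x := by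
  refine hu.conj_multiplier (fun ξ => ?_) x
  rw [dyadicDilate_apply, reflectSymbol_apply, DyadicCouple.lowSymbol, dyadicDilate_apply, smul_neg,
    DyadicCouple.motherSymbol_zero_apply, Complex.conj_ofReal]

theorem dyadicDilate_sub (n : ℕ) (μ ν : 𝓢(Plane, ℂ)) :
    dyadicDilate n (μ - ν) = dyadicDilate n μ - dyadicDilate n ν := by
  ext ξ
  simp only [dyadicDilate_apply, sub_apply]

theorem multiplier_odd_eq {u : 𝓢'(Plane, ℂ)} (hu : IsRealDistribution u) (N : ℕ)
    (x : Plane) : multiplier (dyadicDilate N (L.motherSymbol 0 - reflectSymbol (L.motherSymbol 0)))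
      u x = multiplier (L.lowSymbol N) u x - (starRingEnd ℂ) (multiplier (L.lowSymbol N) u x) := by
  rw [conj_multiplier_lowSymbol hu, dyadicDilate_sub, multiplier_sub_symbol]
  rfl

/-- The imaginary part of `S_N v` is small. -/
theorem GradBound.norm_sub_re_le (hK : KernelBound L K) (hv : GradBound L v A) (N : ℕ) (i : Fin 2)
    (x : Plane) :
    ‖multiplier (L.lowSymbol N) (v i) x - ((multiplier (L.lowSymbol N) (v i) x).re : ℂ)‖ ≤
      2 * K * A * ((2 ^ N)⁻¹ * Real.sqrt (1 + N)) := by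
  -- The multiplier with the odd symbol is the cut-off minus its conjugate, twice the quantity to be
  -- bounded. Reverse Bernstein therefore needs its gradient only.
  have hB : ∀ k y, ‖multiplier
      (dyadicDilate N (L.motherSymbol 0 - reflectSymbol (L.motherSymbol 0)))
      (∂_{basisVec k} (v i)) y‖ ≤ 2 * (A * Real.sqrt (1 + N)) := by
    intro k y
    rw [multiplier_odd_eq ((hv.real i).lineDeriv k), two_mul]
    refine (norm_sub_le _ _).trans (add_le_add (hv.bound N i k y) ?_)
    rw [RCLike.norm_conj]
    exact hv.bound N i k y
  have h := hK.norm_annular_le (isAnnular_odd L) N (v i) hB x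
  rw [multiplier_odd_eq (hv.real i)] at h
  set z := multiplier (L.lowSymbol N) (v i) x
  have h2 : z - (starRingEnd ℂ) z = 2 * (z - (z.re : ℂ)) := by
    apply Complex.ext
    · simp
    · simp; ring
  rw [h2, norm_mul, Complex.norm_ofNat] at h
  linarith

/-- The sum is controlled by its lower end. Adding three times the upper term makes the induction
telescope, because consecutive square roots have ratio at most 3/2. -/
theorem sum_Ioc_sqrt_le {m N : ℕ} (h : m ≤ N) :
    ∑ r ∈ Finset.Ioc m N, ((2 : ℝ) ^ r)⁻¹ * Real.sqrt (1 + r) ≤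
      3 * ((2 ^ m)⁻¹ * Real.sqrt (1 + m)) := by
  suffices ∑ r ∈ Finset.Ioc m N, ((2 : ℝ) ^ r)⁻¹ * Real.sqrt (1 + r) +
      3 * ((2 ^ N)⁻¹ * Real.sqrt (1 + N)) ≤ 3 * ((2 ^ m)⁻¹ * Real.sqrt (1 + m)) from
    le_trans (le_add_of_nonneg_right (by positivity)) this
  induction N, h using Nat.le_induction with
  | base => simp
  | succ N hN ih =>
    refine le_trans ?_ ih
    rw [← Finset.insert_Ioc_right_eq_Ioc_add_one hN, Finset.sum_insert (by simp)]
    have h1 : Real.sqrt (1 + (N + 1 : ℕ)) * 4 ≤ Real.sqrt (1 + N) * 6 := by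
      have : Real.sqrt (1 + (N + 1 : ℕ)) ≤ Real.sqrt (1 + N) * (3 / 2) := by
        rw [Real.sqrt_le_iff]
        refine ⟨by positivity, ?_⟩
        rw [mul_pow, Real.sq_sqrt (by positivity)]
        push_cast
        have : (0 : ℝ) ≤ N := Nat.cast_nonneg N
        linarith
      linarith
    have h2 : ((2 : ℝ) ^ (N + 1))⁻¹ = (2 ^ N)⁻¹ / 2 := by rw [pow_succ]; field_simp
    rw [h2]
    have h3 : (0 : ℝ) ≤ (2 ^ N)⁻¹ := by positivity
    nlinarith [mul_le_mul_of_nonneg_left h1 h3]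

/-- The decay factor `2^{-|p-q|}`. -/
noncomputable def decay (p q : ℕ) : ℝ := 2 ^ (min p q) * (2 ^ (max p q))⁻¹

theorem decay_nonneg (p q : ℕ) : 0 ≤ decay p q := by unfold decay; positivity

theorem multiplier_low_eq_add (L : DyadicCouple) {m N : ℕ} (h : m ≤ N) (u : 𝓢'(Plane, ℂ))
    (x : Plane) : multiplier (L.lowSymbol N) u x = multiplier (L.lowSymbol m) u x +
      ∑ r ∈ Finset.Ioc m N, multiplier (L.blockSymbol r) u x := by
  induction N, h using Nat.le_induction with
  | base => simp
  | succ N hN ih =>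
    rw [L.lowSymbol_succ, multiplier_add_symbol, ih,
      ← Finset.insert_Ioc_right_eq_Ioc_add_one hN, Finset.sum_insert (by simp)]
    ring

theorem GradBound.sum_norm_block_le (hK : KernelBound L K) (hv : GradBound L v A) {m N : ℕ}
    (h : m ≤ N) (i : Fin 2) (x : Plane) :
    ∑ r ∈ Finset.Ioc m N, ‖multiplier (L.blockSymbol r) (v i) x‖ ≤
      12 * K * A * ((2 ^ m)⁻¹ * Real.sqrt (1 + m)) := by
  have hA := hv.nonneg
  have hK0 := hK.1
  calc _ ≤ ∑ r ∈ Finset.Ioc m N, 4 * K * A * ((2 ^ r)⁻¹ * Real.sqrt (1 + r)) := by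
        refine Finset.sum_le_sum fun r hr => ?_
        rw [Finset.mem_Ioc] at hr
        obtain ⟨r, rfl⟩ := Nat.exists_eq_add_one_of_ne_zero (by omega : r ≠ 0)
        exact hv.norm_block_le hK r i x
    _ ≤ 4 * K * A * (3 * ((2 ^ m)⁻¹ * Real.sqrt (1 + m))) := by
        rw [← Finset.mul_sum]
        gcongr
        exact sum_Ioc_sqrt_le h
    _ = _ := by ring

/-- The difference consists of the imaginary part at level `q` (constant 2) and of the blocks
between `q` and `m` (constant 12), both small like 2^{-q}√(1+q). -/
theorem GradBound.norm_low_sub_re_le (hK : KernelBound L K) (hv : GradBound L v A) {q m : ℕ}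
    (h : q ≤ m) (i : Fin 2) (x : Plane) :
    ‖multiplier (L.lowSymbol m) (v i) x - ((multiplier (L.lowSymbol q) (v i) x).re : ℂ)‖ ≤
      14 * K * A * ((2 ^ q)⁻¹ * Real.sqrt (1 + q)) := by
  rw [multiplier_low_eq_add L h, add_sub_right_comm]
  refine (norm_add_le _ _).trans ((add_le_add (hv.norm_sub_re_le hK q i x)
    ((norm_sum_le _ _).trans (hv.sum_norm_block_le hK h i x))).trans (le_of_eq ?_))
  ring

/-- The transport field of the `q`-th block. -/
noncomputable def transportField (L : DyadicCouple) (q : ℕ) (v : Fin 2 → 𝓢'(Plane, ℂ)) (i : Fin 2)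
    (x : Plane) : ℝ := (multiplier (L.lowSymbol q) (v i) x).re

theorem continuous_transportField (L : DyadicCouple) (q : ℕ) (v : Fin 2 → 𝓢'(Plane, ℂ))
    (i : Fin 2) : Continuous (transportField L q v i) :=
  Complex.continuous_re.comp (contDiff_multiplier _ _).continuous

theorem advBlock_low_eq (q p : ℕ) {m N : ℕ} (h : m ≤ N) (v : Fin 2 → 𝓢'(Plane, ℂ))
    (ρ : 𝓢'(Plane, ℂ)) (x : Plane) :
    advBlock L q p ρ (fun i => multiplier (L.lowSymbol N) (v i)) x =
      advBlock L q p ρ (fun i => multiplier (L.lowSymbol m) (v i)) x +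
        ∑ r ∈ Finset.Ioc m N, advBlock L q p ρ (fun i => multiplier (L.blockSymbol r) (v i)) x := by
  induction N, h using Nat.le_induction with
  | base => simp
  | succ N hN ih =>
    rw [← Finset.insert_Ioc_right_eq_Ioc_add_one hN, Finset.sum_insert (by simp), add_left_comm,
      ← ih, ← advBlock_add (fun i => hasTemperateGrowth_multiplier _ _)
        (fun i => hasTemperateGrowth_multiplier _ _)]
    congr 1
    ext i y
    rw [L.lowSymbol_succ, multiplier_add_symbol, add_comm]
    rfl

/-- The contribution of `Δ_p ρ` to the remainder. -/
theorem GradBound.eLpNorm_block_le (hK : KernelBound L K) (hv : GradBound L v A) {q p N : ℕ}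
    (hN : max p q ≤ N) (ρ : 𝓢'(Plane, ℂ)) :
    eLpNorm (fun x => transportBlock L q p ρ (fun i x => (transportField L q v i x : ℂ)) x -
      advBlock L q p ρ (fun i => multiplier (L.lowSymbol N) (v i)) x) 2 volume ≤
      ENNReal.ofReal (100 * (K + 1) ^ 3 * (A * Real.sqrt (1 + (max p q : ℕ)) * decay p q)) *
        eLpNorm (multiplier (L.blockSymbol p) ρ) 2 volume := by
  have hA := hv.nonneg
  have hK0 := hK.1
  set m := max p q
  set E := eLpNorm (multiplier (L.blockSymbol p) ρ) 2 volume
  set S := fun i => multiplier (L.lowSymbol m) (v i)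
  have hS : ∀ i, (S i).HasTemperateGrowth := fun i => hasTemperateGrowth_multiplier _ _
  set b : Fin 2 → Plane → ℂ := fun i x => (transportField L q v i x : ℂ)
  have hb : ∀ i, Continuous (b i) := fun i =>
    Complex.continuous_ofReal.comp (continuous_transportField L q v i)
  -- With `m = max p q`, there are three sources: the commutator with S_m v, the replacement of S_m
  -- v by the real field of level `q`, and the blocks of v above `m`. In the second, the smallness
  -- 2^{-q} pays for the derivative. In the third, 2^{-r} summed over r > m against 2^{min p q}
  -- gives the decay.
  have hsplit : (fun x => transportBlock L q p ρ b x -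
      advBlock L q p ρ (fun i => multiplier (L.lowSymbol N) (v i)) x) =
      -((fun x => advBlock L q p ρ S x - transportBlock L q p ρ S x) +
        transportBlock L q p ρ (fun i x => S i x - b i x) +
        ∑ r ∈ Finset.Ioc m N, advBlock L q p ρ (fun i => multiplier (L.blockSymbol r) (v i))) := by
    ext x
    rw [advBlock_low_eq q p hN]
    simp only [Pi.neg_apply, Pi.add_apply, Finset.sum_apply, transportBlock, sub_mul,
      Finset.sum_sub_distrib]
    ring
  have c1 : Continuous fun x => advBlock L q p ρ S x - transportBlock L q p ρ S x :=
    (continuous_advBlock hS q p ρ).sub (continuous_transportBlock (fun i => (hS i).1.continuous) _ _ _)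
  have c2 : Continuous (transportBlock L q p ρ (fun i x => S i x - b i x)) :=
    continuous_transportBlock (fun i => (hS i).1.continuous.sub (hb i)) _ _ _
  have c3 : ∀ r, Continuous (advBlock L q p ρ (fun i => multiplier (L.blockSymbol r) (v i))) :=
    fun r => continuous_advBlock (fun i => hasTemperateGrowth_multiplier _ _) _ _ _
  have e1 : eLpNorm (fun x => advBlock L q p ρ S x - transportBlock L q p ρ S x) 2 volume ≤
      ENNReal.ofReal (12 * K * K * (A * Real.sqrt (1 + m) * decay p q)) * E :=
    hK.eLpNorm_advBlock_sub_le hS (hv.sum_partialDeriv _)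
      (fun i k x => hv.norm_partialDeriv_low_le m i k x) q p ρ
  have e2 : eLpNorm (transportBlock L q p ρ (fun i x => S i x - b i x)) 2 volume ≤
      ENNReal.ofReal (56 * K * K * K * (A * Real.sqrt (1 + m) * decay p q)) * E := by
    refine (hK.eLpNorm_transportBlock_le (fun i => (hS i).1.continuous.sub (hb i))
      (fun i x => hv.norm_low_sub_re_le hK (le_max_right p q) i x) q p ρ).trans
      (ofReal_mul_le_of_le ?_ _)
    have h1 : Real.sqrt (1 + q) ≤ Real.sqrt (1 + m) := by
      gcongr
      exact le_max_right p q
    calc _ = 56 * K * K * K * (A * Real.sqrt (1 + q) * decay p q) := by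
          rw [decay]
          field_simp
          ring
      _ ≤ _ := by
          have := decay_nonneg p q
          gcongr
  have e3 : eLpNorm (∑ r ∈ Finset.Ioc m N, advBlock L q p ρ
      (fun i => multiplier (L.blockSymbol r) (v i))) 2 volume ≤
      ENNReal.ofReal (24 * K * K * (K + 1) * (A * Real.sqrt (1 + m) * decay p q)) * E := by
    refine (eLpNorm_sum_le (fun r _ => (c3 r).aestronglyMeasurable) one_le_two).trans ?_
    have h1 : ∀ r ∈ Finset.Ioc m N, eLpNorm (advBlock L q p ρ
        (fun i => multiplier (L.blockSymbol r) (v i))) 2 volume ≤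
        ENNReal.ofReal (2 * K * (K + 1) *
          (4 * K * A * ((2 ^ r)⁻¹ * Real.sqrt (1 + r)) * 2 ^ (min p q))) * E := by
      intro r hr
      rw [Finset.mem_Ioc] at hr
      obtain ⟨r, rfl⟩ := Nat.exists_eq_add_one_of_ne_zero (by omega : r ≠ 0)
      exact hK.eLpNorm_advBlock_le (fun i => hasTemperateGrowth_multiplier _ _)
        (hv.sum_partialDeriv _) (fun i x => hv.norm_block_le hK r i x) q p ρ
    refine (Finset.sum_le_sum h1).trans ?_
    rw [← Finset.sum_mul, ← ENNReal.ofReal_sum_of_nonneg fun r _ => by positivity]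
    refine ofReal_mul_le_of_le ?_ _
    have h2 := sum_Ioc_sqrt_le hN
    calc _ = 2 * K * (K + 1) * (4 * K * A * 2 ^ (min p q)) *
          ∑ r ∈ Finset.Ioc m N, ((2 : ℝ) ^ r)⁻¹ * Real.sqrt (1 + r) := by
          rw [Finset.mul_sum]
          refine Finset.sum_congr rfl fun r _ => ?_
          ring
      _ ≤ 2 * K * (K + 1) * (4 * K * A * 2 ^ (min p q)) *
          (3 * ((2 ^ m)⁻¹ * Real.sqrt (1 + m))) := by gcongr
      _ = _ := by rw [decay]; ring
  rw [hsplit, eLpNorm_neg]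
  refine (eLpNorm_add_le (c1.add c2).aestronglyMeasurable
    (Finset.aestronglyMeasurable_sum _ fun r _ => (c3 r).aestronglyMeasurable) one_le_two).trans ?_
  refine (add_le_add (eLpNorm_add_le c1.aestronglyMeasurable c2.aestronglyMeasurable one_le_two)
    le_rfl).trans ?_
  refine (add_le_add (add_le_add e1 e2) e3).trans ?_
  have hX : 0 ≤ A * Real.sqrt (1 + m) * decay p q := by
    have := decay_nonneg p q
    positivity
  rw [← add_mul, ← add_mul, ← ENNReal.ofReal_add (by positivity) (by positivity),
    ← ENNReal.ofReal_add (by positivity) (by positivity)]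
  refine ofReal_mul_le_of_le ?_ _
  rw [← add_mul, ← add_mul]
  refine mul_le_mul_of_nonneg_right ?_ hX
  nlinarith [mul_nonneg hK0 hK0, mul_nonneg (mul_nonneg hK0 hK0) hK0]

theorem multiplier_block_eq_sum {q N : ℕ} (h : q + 1 ≤ N) (u : 𝓢'(Plane, ℂ)) (x : Plane) :
    multiplier (L.blockSymbol q) u x = ∑ p ∈ Finset.range (N + 1),
      convMultiplier (L.blockSymbol q) (multiplier (L.blockSymbol p) u) x := by
  rw [← convMultiplier_sum _ fun p _ => hasTemperateGrowth_multiplier _ _,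
    ← schwartzMul_blockSymbol_lowSymbol L h, multiplier_schwartzMul_eq,
    schwartzMul_blockSymbol_lowSymbol L h]
  congr 1
  ext y
  exact multiplier_lowSymbol_eq_sum L N u y

theorem sum_convMultiplier_low_eq (q N : ℕ) (v : Fin 2 → 𝓢'(Plane, ℂ)) (ρ : 𝓢'(Plane, ℂ))
    (x : Plane) :
    ∑ i, convMultiplier (L.blockSymbol q) (multiplier (L.lowSymbol N) (v i) *
      multiplier (L.lowSymbol N) (∂_{basisVec i} ρ)) x =
      ∑ p ∈ Finset.range (N + 1),
        advBlock L q p ρ (fun i => multiplier (L.lowSymbol N) (v i)) x := by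
  unfold advBlock
  rw [Finset.sum_comm]
  refine Finset.sum_congr rfl fun i _ => ?_
  rw [← convMultiplier_sum _ fun p _ => (hasTemperateGrowth_multiplier _ _).mul
    (hasTemperateGrowth_multiplier _ _)]
  congr 1
  ext y
  simp only [Pi.mul_apply]
  rw [multiplier_lowSymbol_eq_sum L N (∂_{basisVec i} ρ), Finset.mul_sum]

/-! ### The remainder of the localized equation. -/

/-- The remainder after the localization of the advection term. -/
noncomputable def advRemainder (L : DyadicCouple) (q : ℕ) (v : Fin 2 → 𝓢'(Plane, ℂ))
    (ρ P : 𝓢'(Plane, ℂ)) (x : Plane) : ℂ :=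
  ∑ i, (transportField L q v i x : ℂ) * multiplier (L.blockSymbol q) (∂_{basisVec i} ρ) x -
    multiplier (L.blockSymbol q) P x

/-- The product is known only as a weak limit. Testing it on translates of the kernel of the block
gives pointwise convergence of the approximate remainders, and Fatou's lemma carries over their
uniform L² bound. -/
theorem GradBound.eLpNorm_advRemainder_le (hK : KernelBound L K) (hv : GradBound L v A)
    {ρ P : 𝓢'(Plane, ℂ)} (hP : L.IsAdvection v ρ P) (q : ℕ) :
    eLpNorm (advRemainder L q v ρ P) 2 volume ≤ ∑' p : ℕ,
      ENNReal.ofReal (100 * (K + 1) ^ 3 * (A * Real.sqrt (1 + (max p q : ℕ)) * decay p q)) *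
        eLpNorm (multiplier (L.blockSymbol p) ρ) 2 volume := by
  set b : Fin 2 → Plane → ℂ := fun i x => (transportField L q v i x : ℂ)
  have hb : ∀ i, Continuous (b i) := fun i =>
    Complex.continuous_ofReal.comp (continuous_transportField L q v i)
  -- The shift makes the cut-off level `N + q + 1` exceed `q`, so that the cut-off acts as the
  -- identity on the block, and dominate every `max p q` in the sum.
  set R : ℕ → Plane → ℂ := fun N x => ∑ p ∈ Finset.range (N + q + 2),
    (transportBlock L q p ρ b x -
      advBlock L q p ρ (fun i => multiplier (L.lowSymbol (N + q + 1)) (v i)) x) with hR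
  have hc : ∀ N p, Continuous fun x => transportBlock L q p ρ b x -
      advBlock L q p ρ (fun i => multiplier (L.lowSymbol (N + q + 1)) (v i)) x := fun N p =>
    (continuous_transportBlock hb _ _ _).sub
      (continuous_advBlock (fun i => hasTemperateGrowth_multiplier _ _) _ _ _)
  have hlim : ∀ x, Tendsto (fun N => R N x) atTop (𝓝 (advRemainder L q v ρ P x)) := by
    intro x
    have h1 : ∀ N, R N x =
        ∑ i, b i x * multiplier (L.blockSymbol q) (∂_{basisVec i} ρ) x -
        ∫ y, (∑ i, L.lowFreq ((N + q + 1 : ℕ) : ℤ) (v i) y *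
          L.lowFreq ((N + q + 1 : ℕ) : ℤ) (∂_{basisVec i} ρ) y) *
            (SchwartzMap.compSubConstCLM ℂ x (𝓕 (L.blockSymbol q))) y := by
      intro N
      simp only [hR]
      rw [Finset.sum_sub_distrib, show N + q + 2 = (N + q + 1) + 1 from rfl,
        ← sum_convMultiplier_low_eq]
      congr 1
      · unfold transportBlock
        rw [Finset.sum_comm]
        refine Finset.sum_congr rfl fun i _ => ?_
        rw [multiplier_block_eq_sum (L := L) (show q + 1 ≤ N + q + 1 by omega), Finset.mul_sum]
      · rw [← convMultiplier_sum _ fun i _ => (hasTemperateGrowth_multiplier _ _).mul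
          (hasTemperateGrowth_multiplier _ _)]
        unfold convMultiplier
        congr 1
        ext y
        simp only [DyadicCouple.lowFreq_eq, Pi.mul_apply, SchwartzMap.compSubConstCLM_apply]
    simp only [h1]
    refine Tendsto.sub tendsto_const_nhds ?_
    exact (hP _).comp (tendsto_add_atTop_nat (q + 1))
  refine (Lp.eLpNorm_lim_le_liminf_eLpNorm (f := R) (fun N =>
    (continuous_finsetSum _ fun p _ => hc N p).aestronglyMeasurable) _
    (Eventually.of_forall hlim)).trans ?_
  refine (liminf_le_of_frequently_le' (Eventually.frequently (Eventually.of_forall fun N => ?_)))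
  have h2 : R N = ∑ p ∈ Finset.range (N + q + 2), fun x => (transportBlock L q p ρ b x -
      advBlock L q p ρ (fun i => multiplier (L.lowSymbol (N + q + 1)) (v i)) x) := by
    ext x
    simp [hR]
  rw [h2]
  refine (eLpNorm_sum_le (fun p _ => (hc N p).aestronglyMeasurable) one_le_two).trans ?_
  refine (Finset.sum_le_sum fun p hp => hv.eLpNorm_block_le hK (N := N + q + 1) ?_ ρ).trans
    (ENNReal.sum_le_tsum _)
  rw [Finset.mem_range] at hp
  omega

end GradBound

end LosingTransport

namespace LosingTransport

/-! ### Joint measurability -/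

/-- A function that is measurable in one variable and continuous in the other one has a jointly
measurable version. -/
theorem exists_measurable_uncurry {μ : Measure ℝ} {G : ℝ → Plane → ℂ}
    (hc : ∀ᵐ τ ∂μ, Continuous (G τ)) (hm : ∀ x, AEStronglyMeasurable (fun τ => G τ x) μ) :
    ∃ H : Plane → ℝ → ℂ, Measurable (Function.uncurry H) ∧ ∀ᵐ τ ∂μ, ∀ x, H x τ = G τ x := by
  classical
  set d := TopologicalSpace.denseSeq Plane
  have hgood : ∀ᵐ τ ∂μ, Continuous (G τ) ∧ ∀ k, G τ (d k) = (hm (d k)).mk _ τ :=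
    hc.and (ae_all_iff.2 fun k => (hm (d k)).ae_eq_mk)
  set S := {τ | ¬ (Continuous (G τ) ∧ ∀ k, G τ (d k) = (hm (d k)).mk _ τ)}
  set N := toMeasurable μ S
  -- Off a measurable null set the function is continuous and agrees with measurable versions at a
  -- dense sequence of points. Set to zero on the null set, it is measurable at every point by
  -- passage to the limit.
  have hN : μ N = 0 := by rw [measure_toMeasurable]; exact hgood
  have hNm : MeasurableSet N := measurableSet_toMeasurable _ _
  have hout : ∀ τ, τ ∉ N → Continuous (G τ) ∧ ∀ k, G τ (d k) = (hm (d k)).mk _ τ := by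
    intro τ hτ
    by_contra h
    exact hτ (subset_toMeasurable μ S h)
  set H : Plane → ℝ → ℂ := fun x τ => if τ ∈ N then 0 else G τ x with hH
  have hcont : ∀ τ, Continuous fun x => H x τ := by
    intro τ
    by_cases h : τ ∈ N
    · simp only [hH, h, if_true]
      exact continuous_const
    · simp only [hH, h, if_false]
      exact (hout τ h).1
  have hd : ∀ k, Measurable (H (d k)) := by
    intro k
    have : H (d k) = fun τ => if τ ∈ N then 0 else (hm (d k)).mk _ τ := by
      ext τ
      by_cases h : τ ∈ N
      · simp [hH, h]
      · simp [hH, h, (hout τ h).2 k]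
    rw [this]
    exact Measurable.ite hNm measurable_const (hm (d k)).stronglyMeasurable_mk.measurable
  have hmeas : ∀ x, Measurable (H x) := by
    intro x
    have hx : x ∈ closure (range d) := (TopologicalSpace.denseRange_denseSeq Plane) x
    obtain ⟨y, hy, hlim⟩ := mem_closure_iff_seq_limit.1 hx
    choose k hk using hy
    refine measurable_of_tendsto_metrizable (f := fun n => H (d (k n))) (fun n => hd _) ?_
    rw [tendsto_pi_nhds]
    intro τ
    refine ((hcont τ).tendsto x).comp ?_
    simpa only [hk] using hlim
  refine ⟨H, measurable_uncurry_of_continuous_of_measurable hcont hmeas, ?_⟩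
  have : ∀ᵐ τ ∂μ, τ ∉ N := measure_eq_zero_iff_ae_notMem.1 hN
  filter_upwards [this] with τ hτ x
  simp [hH, hτ]

/-! ### The product rule for primitives -/

/-- An absolutely continuous function is bounded, and the exponential is Lipschitz on a half-line
bounded above. -/
theorem absolutelyContinuousOnInterval_exp {f : ℝ → ℝ} {a b : ℝ}
    (hf : AbsolutelyContinuousOnInterval f a b) :
    AbsolutelyContinuousOnInterval (fun x => Real.exp (f x)) a b := by
  obtain ⟨C, hC⟩ := hf.exists_bound
  have hlip : ∀ x ∈ uIcc a b, ∀ y ∈ uIcc a b,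
      dist (Real.exp (f x)) (Real.exp (f y)) ≤ Real.exp C * dist (f x) (f y) := by
    intro x hx y hy
    rw [dist_eq_norm, dist_eq_norm]
    refine (convex_Iic C).norm_image_sub_le_of_norm_deriv_le
      (fun z _ => Real.differentiableAt_exp) (fun z hz => ?_)
      ((Real.le_norm_self _).trans (hC y hy)) ((Real.le_norm_self _).trans (hC x hx))
    rw [Real.deriv_exp, Real.norm_of_nonneg (Real.exp_pos _).le]
    exact Real.exp_le_exp.2 hz
  have h0 := Filter.Tendsto.const_mul (Real.exp C) hf
  rw [mul_zero] at h0
  refine squeeze_zero' (Eventually.of_forall fun E => Finset.sum_nonneg fun _ _ => dist_nonneg) ?_ h0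
  have : ∀ᶠ E in AbsolutelyContinuousOnInterval.totalLengthFilter ⊓
      𝓟 (AbsolutelyContinuousOnInterval.disjWithin a b),
      E ∈ AbsolutelyContinuousOnInterval.disjWithin a b := eventually_inf_principal.mpr (by simp)
  filter_upwards [this] with E hE
  rw [Finset.mul_sum]
  exact Finset.sum_le_sum fun i hi => hlip _ (hE.1 i hi).1 _ (hE.1 i hi).2

/-- The coefficients are merely integrable in time, so the product rule is the fundamental theorem
for absolutely continuous functions, applied to the real and imaginary parts. -/
theorem exp_mul_normSq_sub {t : ℝ} (ht : 0 ≤ t) {lam : ℝ → ℝ} {U G : ℝ → ℂ}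
    (hlam : IntervalIntegrable lam volume 0 t) (hG : IntervalIntegrable G volume 0 t)
    (hU : ∀ τ ∈ Icc 0 t, U τ = U 0 + ∫ σ in (0 : ℝ)..τ, G σ) :
    Real.exp (-∫ σ in (0 : ℝ)..t, lam σ) * ‖U t‖ ^ 2 - ‖U 0‖ ^ 2 =
      ∫ τ in (0 : ℝ)..t, Real.exp (-∫ σ in (0 : ℝ)..τ, lam σ) *
        (2 * ((starRingEnd ℂ) (U τ) * G τ).re - lam τ * ‖U τ‖ ^ 2) := by
  have hre : IntervalIntegrable (fun τ => (G τ).re) volume 0 t :=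
    ⟨hG.1.re, hG.2.re⟩
  have him : IntervalIntegrable (fun τ => (G τ).im) volume 0 t :=
    ⟨hG.1.im, hG.2.im⟩
  have h0t : (0 : ℝ) ∈ uIcc 0 t := left_mem_uIcc
  set R : ℝ → ℝ := fun τ => (U 0).re + ∫ σ in (0 : ℝ)..τ, (G σ).re
  set I : ℝ → ℝ := fun τ => (U 0).im + ∫ σ in (0 : ℝ)..τ, (G σ).im
  set Λ : ℝ → ℝ := fun τ => ∫ σ in (0 : ℝ)..τ, lam σ
  have hconst : ∀ c : ℝ, AbsolutelyContinuousOnInterval (fun _ => c) 0 t := fun c =>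
    ((LipschitzWith.const c).lipschitzOnWith (s := uIcc 0 t)).absolutelyContinuousOnInterval
  have aR : AbsolutelyContinuousOnInterval R 0 t :=
    (hconst _).add (hre.absolutelyContinuousOnInterval_intervalIntegral h0t)
  have aI : AbsolutelyContinuousOnInterval I 0 t :=
    (hconst _).add (him.absolutelyContinuousOnInterval_intervalIntegral h0t)
  have aΛ : AbsolutelyContinuousOnInterval (fun τ => Real.exp (-Λ τ)) 0 t :=
    absolutelyContinuousOnInterval_exp
      (hlam.absolutelyContinuousOnInterval_intervalIntegral h0t).neg
  have hUR : ∀ τ ∈ Icc 0 t, (U τ).re = R τ ∧ (U τ).im = I τ := by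
    intro τ hτ
    have hGτ : IntervalIntegrable G volume 0 τ :=
      hG.mono_set (uIcc_subset_uIcc left_mem_uIcc (by rwa [uIcc_of_le ht]))
    rw [hU τ hτ, Complex.add_re, Complex.add_im]
    constructor
    · congr 1
      exact (Complex.reCLM.intervalIntegral_comp_comm hGτ).symm
    · congr 1
      exact (Complex.imCLM.intervalIntegral_comp_comm hGτ).symm
  have hnorm : ∀ z : ℂ, ‖z‖ ^ 2 = z.re * z.re + z.im * z.im := fun z => by
    rw [← Complex.normSq_eq_norm_sq, Complex.normSq_apply]
  have aF := aΛ.mul ((aR.mul aR).add (aI.mul aI))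
  have hint := aF.integral_deriv_eq_sub
  have hend : ((fun τ => Real.exp (-Λ τ)) * (R * R + I * I)) t -
      ((fun τ => Real.exp (-Λ τ)) * (R * R + I * I)) 0 =
      Real.exp (-Λ t) * ‖U t‖ ^ 2 - ‖U 0‖ ^ 2 := by
    simp only [Pi.mul_apply, Pi.add_apply, hnorm, (hUR t ⟨ht, le_rfl⟩).1, (hUR t ⟨ht, le_rfl⟩).2,
      (hUR 0 ⟨le_rfl, ht⟩).1, (hUR 0 ⟨le_rfl, ht⟩).2]
    simp [Λ]
  rw [← hend, ← hint]
  refine intervalIntegral.integral_congr_ae ?_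
  filter_upwards [hre.ae_hasDerivAt_integral, him.ae_hasDerivAt_integral,
    hlam.ae_hasDerivAt_integral] with τ d1 d2 d3 hτ
  have hτ' : τ ∈ uIcc 0 t := uIoc_subset_uIcc hτ
  have hτ'' : τ ∈ Icc 0 t := by rwa [uIcc_of_le ht] at hτ'
  have e1 : HasDerivAt R (G τ).re τ := (d1 hτ' 0 h0t).const_add _
  have e2 : HasDerivAt I (G τ).im τ := (d2 hτ' 0 h0t).const_add _
  have e3 : HasDerivAt (fun τ => Real.exp (-Λ τ)) (Real.exp (-Λ τ) * (-lam τ)) τ :=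
    (d3 hτ' 0 h0t).neg.exp
  have e4 := e3.mul ((e1.mul e1).add (e2.mul e2))
  rw [e4.deriv, hnorm, (hUR τ hτ'').1, (hUR τ hτ'').2]
  simp only [Pi.add_apply, Pi.mul_apply, Complex.mul_re, Complex.conj_re, Complex.conj_im,
    (hUR τ hτ'').1, (hUR τ hτ'').2]
  ring

/-! ### A slowly varying cutoff -/

/-- Compose a bump with log(1+|x|²)/R. The gradient is O(1/(R(1+|x|))), so its product with a
linearly growing field tends to zero uniformly as R grows. -/
theorem exists_cutoff : ∃ C : ℝ, 0 ≤ C ∧ ∀ R : ℝ, 0 < R → ∃ ψ : Plane → ℝ,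
    ContDiff ℝ 1 ψ ∧ HasCompactSupport ψ ∧ (∀ x, 0 ≤ ψ x) ∧ (∀ x, ψ x ≤ 1) ∧
    (∀ x, Real.log (1 + ‖x‖ ^ 2) ≤ R → ψ x = 1) ∧
    ∀ i x, |fderiv ℝ ψ x (basisVec i)| * (1 + ‖x‖) ≤ C / R := by
  let θ : ContDiffBump (0 : ℝ) := ⟨1, 2, one_pos, one_lt_two⟩
  have hθ1 : ContDiff ℝ 1 θ := θ.contDiff
  obtain ⟨C, hC⟩ := (θ.hasCompactSupport.fderiv (𝕜 := ℝ)).exists_bound_of_continuous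
    (hθ1.continuous_fderiv one_ne_zero)
  have hC0 : 0 ≤ C := (norm_nonneg _).trans (hC 0)
  refine ⟨3 * C, by positivity, fun R hR => ?_⟩
  set l : Plane → ℝ := fun x => Real.log (1 + ‖x‖ ^ 2) / R
  have hl0 : ∀ x, 0 ≤ l x := fun x => div_nonneg
    (Real.log_nonneg (le_add_of_nonneg_right (by positivity))) hR.le
  have hl : ContDiff ℝ 1 l := by
    refine ContDiff.div_const (ContDiff.log (contDiff_const.add (contDiff_norm_sq ℝ)) fun x => ?_) R
    positivity
  refine ⟨fun x => θ (l x), hθ1.comp hl, ?_, fun x => θ.nonneg, fun x => θ.le_one,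
    fun x hx => ?_, fun i x => ?_⟩
  · refine HasCompactSupport.of_support_subset_isCompact
      (isCompact_closedBall (0 : Plane) (Real.sqrt (Real.exp (2 * R)))) fun x hx => ?_
    have h1 : l x ∈ Metric.ball (0 : ℝ) 2 := by
      rw [← θ.support_eq]
      exact hx
    rw [Metric.mem_ball, dist_zero_right, Real.norm_of_nonneg (hl0 x), div_lt_iff₀ hR,
      Real.log_lt_iff_lt_exp (by positivity)] at h1
    rw [mem_closedBall_zero_iff]
    refine Real.le_sqrt_of_sq_le ?_
    linarith
  · refine θ.one_of_mem_closedBall ?_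
    rw [mem_closedBall_zero_iff, Real.norm_of_nonneg (hl0 x)]
    exact (div_le_one hR).2 hx
  · have d1 : HasFDerivAt l ((1 / R) • ((1 + ‖x‖ ^ 2)⁻¹ • (2 • innerSL ℝ x))) x := by
      have := ((hasStrictFDerivAt_norm_sq x).hasFDerivAt.const_add 1).log (by positivity)
      have h2 := this.const_mul (1 / R)
      refine h2.congr_of_eventuallyEq (Eventually.of_forall fun y => ?_)
      simp only [l]
      ring
    have d2 : HasFDerivAt (fun x => θ (l x)) ((fderiv ℝ θ (l x)).comp
      ((1 / R) • ((1 + ‖x‖ ^ 2)⁻¹ • (2 • innerSL ℝ x)))) x :=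
      (hθ1.differentiable one_ne_zero _).hasFDerivAt.comp x d1
    rw [d2.fderiv]
    have h1 : |inner ℝ x (basisVec i)| ≤ ‖x‖ := by
      refine (abs_real_inner_le_norm _ _).trans ?_
      simp
    have h2 : ‖(1 / R) * ((1 + ‖x‖ ^ 2)⁻¹ * (2 * inner ℝ x (basisVec i)))‖ ≤
        1 / R * ((1 + ‖x‖ ^ 2)⁻¹ * (2 * ‖x‖)) := by
      rw [Real.norm_eq_abs, abs_mul, abs_mul, abs_mul, abs_of_pos (by positivity : 0 < 1 / R),
        abs_of_pos (by positivity : 0 < (1 + ‖x‖ ^ 2)⁻¹), abs_two]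
      gcongr
    have h3 : |fderiv ℝ θ (l x) ((1 / R) * ((1 + ‖x‖ ^ 2)⁻¹ * (2 * inner ℝ x (basisVec i))))| ≤
        C * (1 / R * ((1 + ‖x‖ ^ 2)⁻¹ * (2 * ‖x‖))) :=
      ((fderiv ℝ θ (l x)).le_opNorm _).trans (mul_le_mul (hC _) h2 (norm_nonneg _) hC0)
    have h4 : (1 + ‖x‖ ^ 2)⁻¹ * (2 * ‖x‖) * (1 + ‖x‖) ≤ 3 := by
      rw [mul_assoc, inv_mul_le_iff₀ (by positivity)]
      nlinarith [sq_nonneg (‖x‖ - 1), sq_nonneg ‖x‖]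
    have h5 : ((fderiv ℝ θ (l x)).comp ((1 / R) • ((1 + ‖x‖ ^ 2)⁻¹ • (2 • innerSL ℝ x))))
        (basisVec i) = fderiv ℝ θ (l x)
          ((1 / R) * ((1 + ‖x‖ ^ 2)⁻¹ * (2 * inner ℝ x (basisVec i)))) := by
      simp [two_smul, two_mul]
      ring
    rw [h5]
    calc _ ≤ C * (1 / R * ((1 + ‖x‖ ^ 2)⁻¹ * (2 * ‖x‖))) * (1 + ‖x‖) := by gcongr
      _ = C / R * ((1 + ‖x‖ ^ 2)⁻¹ * (2 * ‖x‖) * (1 + ‖x‖)) := by ring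
      _ ≤ C / R * 3 := by gcongr
      _ = 3 * C / R := by ring

end LosingTransport

namespace LosingTransport

/-! ### The localized energy balance at a fixed time -/

theorem lintegral_enorm_mul_le {F G : Plane → ℂ} (hF : Continuous F) (hG : Continuous G) :
    ∫⁻ x, ‖F x‖ₑ * ‖G x‖ₑ ≤ eLpNorm F 2 volume * eLpNorm G 2 volume := by
  have h := ENNReal.lintegral_mul_le_Lp_mul_Lq volume (p := 2) (q := 2)
    ⟨by norm_num, by norm_num, by norm_num⟩ hF.enorm.aemeasurable hG.enorm.aemeasurable
  rw [eLpNorm_eq_lintegral_rpow_enorm_toReal two_ne_zero ENNReal.ofNat_ne_top,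
    eLpNorm_eq_lintegral_rpow_enorm_toReal two_ne_zero ENNReal.ofNat_ne_top]
  simpa using h

theorem integral_norm_mul_norm_le {F G : Plane → ℂ} (hF : Continuous F) (hG : Continuous G)
    {a b : ℝ} (ha : 0 ≤ a) (hb : 0 ≤ b) (hFa : eLpNorm F 2 volume ≤ ENNReal.ofReal a)
    (hGb : eLpNorm G 2 volume ≤ ENNReal.ofReal b) :
    Integrable (fun x => ‖F x‖ * ‖G x‖) ∧ ∫ x, ‖F x‖ * ‖G x‖ ≤ a * b := by
  have h1 : ∫⁻ x, ‖‖F x‖ * ‖G x‖‖ₑ ≤ ENNReal.ofReal (a * b) := by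
    rw [ENNReal.ofReal_mul ha]
    simp only [enorm_mul, enorm_norm]
    exact (lintegral_enorm_mul_le hF hG).trans (mul_le_mul' hFa hGb)
  have hint : Integrable (fun x => ‖F x‖ * ‖G x‖) :=
    ⟨(hF.norm.mul hG.norm).aestronglyMeasurable, h1.trans_lt ENNReal.ofReal_lt_top⟩
  refine ⟨hint, ?_⟩
  rw [integral_eq_lintegral_of_nonneg_ae (Eventually.of_forall fun x => by positivity)
    hint.aestronglyMeasurable]
  refine ENNReal.toReal_le_of_le_ofReal (by positivity) (le_trans (le_of_eq ?_) h1)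
  refine lintegral_congr fun x => ?_
  rw [← ofReal_norm, Real.norm_of_nonneg (by positivity)]

theorem eLpNorm_two_sq_eq_ofReal {F : Plane → ℂ}
    (hint : Integrable fun x => ‖F x‖ ^ 2) :
    eLpNorm F 2 volume ^ 2 = ENNReal.ofReal (∫ x, ‖F x‖ ^ 2) := by
  rw [eLpNorm_two_sq, ofReal_integral_eq_lintegral_ofReal hint
    (Eventually.of_forall fun x => by positivity)]
  refine lintegral_congr fun x => ?_
  rw [ENNReal.ofReal_pow (norm_nonneg _), ofReal_norm]

/-- Integration by parts against the gradient of |u|². As the field has zero divergence, only the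
gradient of the cutoff survives. -/
theorem integral_cutoff_advection {u : Plane → ℂ} {b : Fin 2 → Plane → ℝ} {ψ : Plane → ℝ}
    (hu : ContDiff ℝ 1 u) (hb : ∀ i, ContDiff ℝ 1 (b i)) (hψ : ContDiff ℝ 1 ψ)
    (hψc : HasCompactSupport ψ) (hdiv : ∀ x, ∑ i, fderiv ℝ (b i) x (basisVec i) = 0) :
    ∫ x, ψ x * ∑ i, b i x * (2 * ((starRingEnd ℂ) (u x) * partialDeriv i u x).re) =
      -∫ x, ‖u x‖ ^ 2 * ∑ i, b i x * fderiv ℝ ψ x (basisVec i) := by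
  have hF : ContDiff ℝ 1 fun x => ‖u x‖ ^ 2 := hu.norm_sq ℝ
  have hder : ∀ i x, fderiv ℝ (fun x => ‖u x‖ ^ 2) x (basisVec i) =
      2 * ((starRingEnd ℂ) (u x) * partialDeriv i u x).re := by
    intro i x
    rw [((hu.differentiable one_ne_zero x).hasFDerivAt.norm_sq).fderiv]
    simp [Complex.inner, mul_comm, partialDeriv]
    ring
  have hw : ∀ i, ContDiff ℝ 1 fun x => ψ x * b i x := fun i => hψ.mul (hb i)
  have hwc : ∀ i, HasCompactSupport fun x => ψ x * b i x := fun i => hψc.mul_right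
  have hwd : ∀ i x, fderiv ℝ (fun x => ψ x * b i x) x (basisVec i) =
      ψ x * fderiv ℝ (b i) x (basisVec i) + b i x * fderiv ℝ ψ x (basisVec i) := by
    intro i x
    rw [fderiv_fun_mul (hψ.differentiable one_ne_zero x) ((hb i).differentiable one_ne_zero x)]
    rfl
  have c1 : ∀ i, Continuous fun x => fderiv ℝ (fun x => ψ x * b i x) x (basisVec i) := fun i =>
    ((hw i).continuous_fderiv one_ne_zero).clm_apply continuous_const
  have s1 : ∀ i, HasCompactSupport fun x => fderiv ℝ (fun x => ψ x * b i x) x (basisVec i) :=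
    fun i => (hwc i).fderiv_apply (𝕜 := ℝ) _
  have c2 : ∀ i, Continuous fun x => fderiv ℝ (fun x => ‖u x‖ ^ 2) x (basisVec i) := fun i =>
    (hF.continuous_fderiv one_ne_zero).clm_apply continuous_const
  have i1 : ∀ i, Integrable fun x => fderiv ℝ (fun x => ψ x * b i x) x (basisVec i) * ‖u x‖ ^ 2 :=
    fun i => ((c1 i).mul hF.continuous).integrable_of_hasCompactSupport (s1 i).mul_right
  have i2 : ∀ i, Integrable fun x =>
      ψ x * b i x * fderiv ℝ (fun x => ‖u x‖ ^ 2) x (basisVec i) := fun i =>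
    ((hw i).continuous.mul (c2 i)).integrable_of_hasCompactSupport (hwc i).mul_right
  have i3 : ∀ i, Integrable fun x => ψ x * b i x * ‖u x‖ ^ 2 := fun i =>
    ((hw i).continuous.mul hF.continuous).integrable_of_hasCompactSupport (hwc i).mul_right
  have hparts : ∀ i, ∫ x, ψ x * b i x * fderiv ℝ (fun x => ‖u x‖ ^ 2) x (basisVec i) =
      -∫ x, fderiv ℝ (fun x => ψ x * b i x) x (basisVec i) * ‖u x‖ ^ 2 := fun i =>
    integral_mul_fderiv_eq_neg_fderiv_mul_of_integrable (i1 i) (i2 i) (i3 i)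
      (fun x _ => (hw i).differentiable one_ne_zero x)
      (fun x _ => hF.differentiable one_ne_zero x)
  calc _ = ∑ i, ∫ x, ψ x * b i x * fderiv ℝ (fun x => ‖u x‖ ^ 2) x (basisVec i) := by
        rw [← integral_finsetSum _ fun i _ => i2 i]
        congr 1
        ext x
        rw [Finset.mul_sum]
        refine Finset.sum_congr rfl fun i _ => ?_
        rw [hder, mul_assoc]
    _ = -∫ x, ∑ i, fderiv ℝ (fun x => ψ x * b i x) x (basisVec i) * ‖u x‖ ^ 2 := by
        rw [integral_finsetSum _ fun i _ => i1 i, ← Finset.sum_neg_distrib]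
        exact Finset.sum_congr rfl fun i _ => hparts i
    _ = _ := by
        congr 2
        ext x
        rw [← Finset.sum_mul, mul_comm]
        congr 1
        simp only [hwd]
        rw [Finset.sum_add_distrib, ← Finset.mul_sum, hdiv, mul_zero, zero_add]

/-- A cutoff that varies by `c` over dyadic annuli. -/
structure IsCutoff (ψ : Plane → ℝ) (c : ℝ) : Prop where
  contDiff : ContDiff ℝ 1 ψ
  compact : HasCompactSupport ψ
  nonneg : ∀ x, 0 ≤ ψ x
  le_one : ∀ x, ψ x ≤ 1
  fderiv_le : ∀ i x, |fderiv ℝ ψ x (basisVec i)| * (1 + ‖x‖) ≤ c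

section FixedTime

variable {u g : Plane → ℂ} {b : Fin 2 → Plane → ℝ} {ψ : Plane → ℝ} {c B M h : ℝ}

theorem continuous_partialDeriv (hu : ContDiff ℝ 1 u) (i : Fin 2) :
    Continuous (partialDeriv i u) :=
  (hu.continuous_fderiv one_ne_zero).clm_apply continuous_const

/-- Here ζ is the L² norm of √ψ·u. It is kept in the source term, instead of the norm of u, so that
the source can be absorbed by a damping proportional to ζ². -/
theorem IsCutoff.integral_energy_le (hψ : IsCutoff ψ c) (hu : ContDiff ℝ 1 u) (hg : Continuous g)
    (hb : ∀ i, ContDiff ℝ 1 (b i)) (hdiv : ∀ x, ∑ i, fderiv ℝ (b i) x (basisVec i) = 0)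
    (hbB : ∀ i x, |b i x| ≤ B * (1 + ‖x‖)) (hM : 0 ≤ M)
    (huM : eLpNorm u 2 volume ≤ ENNReal.ofReal M) (hh : 0 ≤ h)
    (hr : eLpNorm (fun x => g x + ∑ i, (b i x : ℂ) * partialDeriv i u x) 2 volume ≤
      ENNReal.ofReal h) :
    ∃ ζ : ℝ, 0 ≤ ζ ∧ ENNReal.ofReal ζ ≤ eLpNorm u 2 volume ∧ ζ ^ 2 = ∫ x, ψ x * ‖u x‖ ^ 2 ∧
      ∫ x, ψ x * (2 * ((starRingEnd ℂ) (u x) * g x).re) ≤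
        2 * ζ * h + 2 * c * B * M ^ 2 := by
  have hψ1 := hψ.contDiff.continuous
  have hB : 0 ≤ B := by
    have := (abs_nonneg _).trans (hbB 0 0)
    simpa using this
  set r : Plane → ℂ := fun x => g x + ∑ i, (b i x : ℂ) * partialDeriv i u x with hr_def
  have hrc : Continuous r := hg.add (continuous_finsetSum _ fun i _ =>
    (Complex.continuous_ofReal.comp (hb i).continuous).mul (continuous_partialDeriv hu i))
  have hc0 : 0 ≤ c := le_trans (by positivity) (hψ.fderiv_le 0 0)
  set w : Plane → ℂ := fun x => (Real.sqrt (ψ x) : ℂ) * u x with hw_def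
  have hwc : Continuous w := (Complex.continuous_ofReal.comp
    (Real.continuous_sqrt.comp hψ1)).mul hu.continuous
  have hwn : ∀ x, ‖w x‖ = Real.sqrt (ψ x) * ‖u x‖ := fun x => by
    rw [hw_def]
    simp only [norm_mul, Complex.norm_real, Real.norm_of_nonneg (Real.sqrt_nonneg _)]
  have hwsq : ∀ x, ‖w x‖ ^ 2 = ψ x * ‖u x‖ ^ 2 := fun x => by
    rw [hwn, mul_pow, Real.sq_sqrt (hψ.nonneg x)]
  have hwint : Integrable fun x => ψ x * ‖u x‖ ^ 2 :=
    (hψ1.mul (hu.continuous.norm.pow 2)).integrable_of_hasCompactSupport hψ.compact.mul_right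
  have hwu : eLpNorm w 2 volume ≤ eLpNorm u 2 volume := by
    refine eLpNorm_mono fun x => ?_
    rw [hwn]
    exact mul_le_of_le_one_left (norm_nonneg _) (Real.sqrt_le_one.2 (hψ.le_one x))
  have hI0 : 0 ≤ ∫ x, ψ x * ‖u x‖ ^ 2 :=
    integral_nonneg fun x => mul_nonneg (hψ.nonneg x) (sq_nonneg _)
  set ζ := Real.sqrt (∫ x, ψ x * ‖u x‖ ^ 2)
  have hζsq : ζ ^ 2 = ∫ x, ψ x * ‖u x‖ ^ 2 := Real.sq_sqrt hI0
  have hζ0 : 0 ≤ ζ := Real.sqrt_nonneg _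
  have hwζ : eLpNorm w 2 volume = ENNReal.ofReal ζ := by
    have h1 : eLpNorm w 2 volume ^ 2 = ENNReal.ofReal ζ ^ 2 := by
      rw [eLpNorm_two_sq_eq_ofReal (by simpa only [hwsq] using hwint),
        ← ENNReal.ofReal_pow hζ0, hζsq]
      simp only [hwsq]
    exact (ENNReal.pow_right_strictMono two_ne_zero).injective h1
  refine ⟨ζ, hζ0, hwζ ▸ hwu, hζsq, ?_⟩
  have i1 : Integrable fun x => ψ x * (2 * ((starRingEnd ℂ) (u x) * r x).re) := by
    refine Continuous.integrable_of_hasCompactSupport ?_ hψ.compact.mul_right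
    exact hψ1.mul (continuous_const.mul (Complex.continuous_re.comp
      ((Complex.continuous_conj.comp hu.continuous).mul hrc)))
  have i2 : Integrable fun x =>
      ψ x * ∑ i, b i x * (2 * ((starRingEnd ℂ) (u x) * partialDeriv i u x).re) := by
    refine Continuous.integrable_of_hasCompactSupport ?_ hψ.compact.mul_right
    exact hψ1.mul (continuous_finsetSum _ fun i _ => (hb i).continuous.mul
      (continuous_const.mul (Complex.continuous_re.comp
      ((Complex.continuous_conj.comp hu.continuous).mul (continuous_partialDeriv hu i)))))
  have hsplit : ∀ x, ψ x * (2 * ((starRingEnd ℂ) (u x) * g x).re) =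
      ψ x * (2 * ((starRingEnd ℂ) (u x) * r x).re) -
      ψ x * ∑ i, b i x * (2 * ((starRingEnd ℂ) (u x) * partialDeriv i u x).re) := by
    intro x
    simp only [hr_def, Fin.sum_univ_two, mul_add, Complex.add_re, Complex.mul_re, Complex.mul_im,
      Complex.ofReal_re, Complex.ofReal_im, Complex.conj_re, Complex.conj_im]
    ring
  simp only [hsplit]
  rw [integral_sub i1 i2, integral_cutoff_advection hu hb hψ.contDiff hψ.compact hdiv, sub_neg_eq_add]
  refine add_le_add ?_ ?_
  · obtain ⟨j1, j2⟩ := integral_norm_mul_norm_le hwc hrc hζ0 hh hwζ.le hr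
    calc _ ≤ ∫ x, 2 * (‖w x‖ * ‖r x‖) := by
          refine integral_mono i1 (j1.const_mul 2) fun x => ?_
          have h1 : ((starRingEnd ℂ) (u x) * r x).re ≤ ‖u x‖ * ‖r x‖ := by
            refine (Complex.re_le_norm _).trans (le_of_eq ?_)
            rw [norm_mul, RCLike.norm_conj]
          -- Since ψ takes values in [0,1], one factor √ψ can be dropped and the other is given to
          -- u.
          have h2 : ψ x ≤ Real.sqrt (ψ x) := Real.le_sqrt_self_iff.2 (hψ.le_one x)
          calc ψ x * (2 * ((starRingEnd ℂ) (u x) * r x).re)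
              ≤ ψ x * (2 * (‖u x‖ * ‖r x‖)) := by
                have := hψ.nonneg x
                gcongr
            _ ≤ Real.sqrt (ψ x) * (2 * (‖u x‖ * ‖r x‖)) := by gcongr
            _ = 2 * (‖w x‖ * ‖r x‖) := by rw [hwn]; ring
      _ ≤ _ := by
          rw [integral_const_mul]
          linarith
  · obtain ⟨j1, j2⟩ := integral_norm_mul_norm_le hu.continuous hu.continuous hM hM huM huM
    calc _ ≤ ∫ x, 2 * c * B * (‖u x‖ * ‖u x‖) := by
          have hψd : ∀ i, Continuous fun x => fderiv ℝ ψ x (basisVec i) := fun i =>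
            (hψ.contDiff.continuous_fderiv one_ne_zero).clm_apply continuous_const
          have hint : Integrable fun x => ‖u x‖ ^ 2 * ∑ i, b i x * fderiv ℝ ψ x (basisVec i) := by
            simp only [Finset.mul_sum]
            refine integrable_finsetSum _ fun i _ => ?_
            refine Continuous.integrable_of_hasCompactSupport ?_
              (HasCompactSupport.mul_left (HasCompactSupport.mul_left
                (hψ.compact.fderiv_apply (𝕜 := ℝ) (basisVec i))))
            exact (hu.continuous.norm.pow 2).mul ((hb i).continuous.mul (hψd i))
          refine integral_mono hint (j1.const_mul _) fun x => ?_
          have h1 : ∀ i, b i x * fderiv ℝ ψ x (basisVec i) ≤ B * c := by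
            intro i
            calc b i x * fderiv ℝ ψ x (basisVec i) ≤ |b i x| * |fderiv ℝ ψ x (basisVec i)| := by
                  rw [← abs_mul]
                  exact le_abs_self _
              _ ≤ B * (1 + ‖x‖) * |fderiv ℝ ψ x (basisVec i)| := by
                  gcongr
                  exact hbB i x
              _ = B * (|fderiv ℝ ψ x (basisVec i)| * (1 + ‖x‖)) := by ring
              _ ≤ B * c := by
                  gcongr
                  exact hψ.fderiv_le i x
          have h2 : ∑ i, b i x * fderiv ℝ ψ x (basisVec i) ≤ 2 * (B * c) := by
            rw [Fin.sum_univ_two]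
            linarith [h1 0, h1 1]
          calc ‖u x‖ ^ 2 * ∑ i, b i x * fderiv ℝ ψ x (basisVec i) ≤ ‖u x‖ ^ 2 * (2 * (B * c)) := by
                gcongr
            _ = _ := by ring
      _ ≤ _ := by
          rw [integral_const_mul, sq]
          gcongr

/-- A crude bound, depending on the cutoff through `D`. It serves only the integrability required by
Fubini. -/
theorem IsCutoff.integral_abs_energy_le (hψ : IsCutoff ψ c) (hu : ContDiff ℝ 1 u)
    (hg : Continuous g) (hb : ∀ i, ContDiff ℝ 1 (b i)) (hbB : ∀ i x, |b i x| ≤ B * (1 + ‖x‖))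
    (hM : 0 ≤ M) (huM : eLpNorm u 2 volume ≤ ENNReal.ofReal M)
    (huM' : ∀ i, eLpNorm (partialDeriv i u) 2 volume ≤ ENNReal.ofReal M) (hh : 0 ≤ h)
    (hr : eLpNorm (fun x => g x + ∑ i, (b i x : ℂ) * partialDeriv i u x) 2 volume ≤
      ENNReal.ofReal h) {D : ℝ} (hD : ∀ x, ψ x * (1 + ‖x‖) ≤ D) :
    ∫ x, ψ x * (‖u x‖ * ‖g x‖) ≤ M * h + 2 * D * B * M ^ 2 := by
  have hB : 0 ≤ B := by
    have := (abs_nonneg _).trans (hbB 0 0)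
    simpa using this
  have hD0 : 0 ≤ D := le_trans (by have := hψ.nonneg 0; positivity) (hD 0)
  set r : Plane → ℂ := fun x => g x + ∑ i, (b i x : ℂ) * partialDeriv i u x with hr_def
  have hrc : Continuous r := hg.add (continuous_finsetSum _ fun i _ =>
    (Complex.continuous_ofReal.comp (hb i).continuous).mul (continuous_partialDeriv hu i))
  obtain ⟨j1, j2⟩ := integral_norm_mul_norm_le hu.continuous hrc hM hh huM hr
  have k := fun i => integral_norm_mul_norm_le hu.continuous (continuous_partialDeriv hu i) hM hM
    huM (huM' i)
  have hint : Integrable fun x => ψ x * (‖u x‖ * ‖g x‖) :=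
    (hψ.contDiff.continuous.mul (hu.continuous.norm.mul hg.norm)).integrable_of_hasCompactSupport
      hψ.compact.mul_right
  calc _ ≤ ∫ x, (‖u x‖ * ‖r x‖ + (D * B * (‖u x‖ * ‖partialDeriv 0 u x‖) +
        D * B * (‖u x‖ * ‖partialDeriv 1 u x‖))) := by
        refine integral_mono hint (j1.add (((k 0).1.const_mul _).add ((k 1).1.const_mul _)))
          fun x => ?_
        have h1 : g x = r x - (b 0 x * partialDeriv 0 u x + b 1 x * partialDeriv 1 u x) := by
          simp only [hr_def, Fin.sum_univ_two]
          ring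
        have h2 : ‖g x‖ ≤ ‖r x‖ + (|b 0 x| * ‖partialDeriv 0 u x‖ +
            |b 1 x| * ‖partialDeriv 1 u x‖) := by
          rw [h1]
          refine (norm_sub_le _ _).trans (add_le_add le_rfl ((norm_add_le _ _).trans ?_))
          rw [norm_mul, norm_mul, Complex.norm_real, Complex.norm_real, Real.norm_eq_abs,
            Real.norm_eq_abs]
        have h3 : ∀ i, ψ x * |b i x| ≤ D * B := by
          intro i
          calc ψ x * |b i x| ≤ ψ x * (B * (1 + ‖x‖)) :=
                mul_le_mul_of_nonneg_left (hbB i x) (hψ.nonneg x)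
            _ = ψ x * (1 + ‖x‖) * B := by ring
            _ ≤ D * B := mul_le_mul_of_nonneg_right (hD x) hB
        have h4 := hψ.nonneg x
        calc ψ x * (‖u x‖ * ‖g x‖) ≤ ψ x * (‖u x‖ * (‖r x‖ + (|b 0 x| * ‖partialDeriv 0 u x‖ +
              |b 1 x| * ‖partialDeriv 1 u x‖))) := by gcongr
          _ = ψ x * (‖u x‖ * ‖r x‖) + (ψ x * |b 0 x| * (‖u x‖ * ‖partialDeriv 0 u x‖) +
              ψ x * |b 1 x| * (‖u x‖ * ‖partialDeriv 1 u x‖)) := by ring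
          _ ≤ _ := by
              refine add_le_add (mul_le_of_le_one_left (by positivity) (hψ.le_one x))
                (add_le_add (mul_le_mul_of_nonneg_right (h3 0) (by positivity))
                  (mul_le_mul_of_nonneg_right (h3 1) (by positivity)))
    _ ≤ M * h + (D * B * (M * M) + D * B * (M * M)) := by
        have l : ∀ i, Integrable fun x => D * B * (‖u x‖ * ‖partialDeriv i u x‖) := fun i =>
          (k i).1.const_mul _
        have l' : Integrable fun x => D * B * (‖u x‖ * ‖partialDeriv 0 u x‖) +
          D * B * (‖u x‖ * ‖partialDeriv 1 u x‖) := (l 0).add (l 1)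
        rw [integral_add j1 l', integral_add (l 0) (l 1), integral_const_mul, integral_const_mul]
        refine add_le_add j2 (add_le_add ?_ ?_)
        · exact mul_le_mul_of_nonneg_left (k 0).2 (by positivity)
        · exact mul_le_mul_of_nonneg_left (k 1).2 (by positivity)
    _ = _ := by ring

end FixedTime

theorem exists_isCutoff : ∃ C : ℝ, 0 ≤ C ∧ ∀ R : ℝ, 0 < R → ∃ ψ : Plane → ℝ,
    IsCutoff ψ (C / R) ∧ ∀ x, Real.log (1 + ‖x‖ ^ 2) ≤ R → ψ x = 1 := by
  obtain ⟨C, hC, h⟩ := exists_cutoff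
  refine ⟨C, hC, fun R hR => ?_⟩
  obtain ⟨ψ, h1, h2, h3, h4, h5, h6⟩ := h R hR
  exact ⟨ψ, ⟨h1, h2, h3, h4, h6⟩, h5⟩

/-! ### The energy inequality -/

/-- The hypotheses of the energy inequality: `u` is driven by `g`, and `g + b · ∇u` is bounded in
`L²` by `h`. -/
structure EnergySetting (t : ℝ) (u g : ℝ → Plane → ℂ) (b : ℝ → Fin 2 → Plane → ℝ)
    (h B : ℝ → ℝ) (M : ℝ) : Prop where
  nonneg : 0 ≤ t
  integrable : ∀ x, IntegrableOn (fun τ => g τ x) (Ioc 0 t)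
  eq : ∀ τ ∈ Icc 0 t, ∀ x, u τ x = u 0 x + ∫ σ in (0 : ℝ)..τ, g σ x
  contDiff : ∀ τ ∈ Icc 0 t, ContDiff ℝ 1 (u τ)
  bound_nonneg : 0 ≤ M
  bound : ∀ τ ∈ Icc 0 t, eLpNorm (u τ) 2 volume ≤ ENNReal.ofReal M
  bound_partialDeriv : ∀ τ ∈ Icc 0 t, ∀ i,
    eLpNorm (partialDeriv i (u τ)) 2 volume ≤ ENNReal.ofReal M
  continuous : ∀ τ, Continuous (g τ)
  contDiff_field : ∀ τ i, ContDiff ℝ 1 (b τ i)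
  div : ∀ᵐ τ ∂(volume.restrict (Ioc 0 t)), ∀ x, ∑ i, fderiv ℝ (b τ i) x (basisVec i) = 0
  field_le : ∀ᵐ τ ∂(volume.restrict (Ioc 0 t)), ∀ i x, |b τ i x| ≤ B τ * (1 + ‖x‖)
  integrable_field : IntegrableOn B (Ioc 0 t)
  rhs_nonneg : ∀ᵐ τ ∂(volume.restrict (Ioc 0 t)), 0 ≤ h τ
  rhs_le : ∀ᵐ τ ∂(volume.restrict (Ioc 0 t)),
    eLpNorm (fun x => g τ x + ∑ i, (b τ i x : ℂ) * partialDeriv i (u τ) x) 2 volume ≤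
      ENNReal.ofReal (h τ)
  integrable_rhs : IntegrableOn h (Ioc 0 t)

section Energy

variable {t M : ℝ} {u g : ℝ → Plane → ℂ} {b : ℝ → Fin 2 → Plane → ℝ} {h B lam Ξ : ℝ → ℝ}

/-- At each point `x` the product rule in time is an identity. Integrate it against the cutoff,
exchange the integrals, and use the inequality at fixed time. The comparison with Ξ holds for every
ζ below the norm of u, hence for the localized norm. -/
theorem EnergySetting.cutoff_le (E : EnergySetting t u g b h B M)
    (hlam : IntegrableOn lam (Ioc 0 t)) (hlam0 : ∀ᵐ τ ∂(volume.restrict (Ioc 0 t)), 0 ≤ lam τ)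
    (hΞ : IntegrableOn Ξ (Ioc 0 t))
    (hle : ∀ᵐ τ ∂(volume.restrict (Ioc 0 t)), ∀ ζ, 0 ≤ ζ →
      ENNReal.ofReal ζ ≤ eLpNorm (u τ) 2 volume →
      Real.exp (-∫ σ in (0 : ℝ)..τ, lam σ) * (2 * ζ * h τ - lam τ * ζ ^ 2) ≤ Ξ τ)
    {ψ : Plane → ℝ} {c : ℝ} (hψ : IsCutoff ψ c) :
    Real.exp (-∫ σ in (0 : ℝ)..t, lam σ) * ∫ x, ψ x * ‖u t x‖ ^ 2 ≤
      (∫ x, ψ x * ‖u 0 x‖ ^ 2) + (∫ τ in (0 : ℝ)..t, Ξ τ) +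
        2 * c * M ^ 2 * ∫ τ in (0 : ℝ)..t, B τ := by
  have ht := E.nonneg
  set μ : Measure ℝ := volume.restrict (Ioc 0 t) with hμ
  set α : ℝ → ℝ := fun τ => Real.exp (-∫ σ in (0 : ℝ)..τ, lam σ) with hα
  have hmem : ∀ᵐ τ ∂μ, τ ∈ Ioc 0 t := ae_restrict_mem measurableSet_Ioc
  have hlamI : IntervalIntegrable lam volume 0 t :=
    (intervalIntegrable_iff_integrableOn_Ioc_of_le ht).2 hlam
  have hgI : ∀ x, IntervalIntegrable (fun τ => g τ x) volume 0 t := fun x =>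
    (intervalIntegrable_iff_integrableOn_Ioc_of_le ht).2 (E.integrable x)
  -- measurable versions
  have hum : ∀ x, AEStronglyMeasurable (fun τ => u τ x) μ := by
    intro x
    have h1 : ContinuousOn (fun τ => u 0 x + ∫ σ in (0 : ℝ)..τ, g σ x) (Ioc 0 t) := by
      have := intervalIntegral.continuousOn_primitive_interval (μ := volume) (a := 0) (b := t)
        (f := fun σ => g σ x) (by rw [uIcc_of_le ht, integrableOn_Icc_iff_integrableOn_Ioc]; exact E.integrable x)
      rw [uIcc_of_le ht] at this
      exact continuousOn_const.add (this.mono Ioc_subset_Icc_self)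
    refine (h1.aestronglyMeasurable measurableSet_Ioc).congr ?_
    filter_upwards [hmem] with τ hτ
    exact (E.eq τ (Ioc_subset_Icc_self hτ) x).symm
  obtain ⟨uu, huu, huuu⟩ := exists_measurable_uncurry (μ := μ) (G := u)
    (hmem.mono fun τ hτ => (E.contDiff τ (Ioc_subset_Icc_self hτ)).continuous) hum
  obtain ⟨gg, hgg, hggg⟩ := exists_measurable_uncurry (μ := μ) (G := g)
    (Eventually.of_forall E.continuous) fun x => (E.integrable x).aestronglyMeasurable
  have hαm : AEStronglyMeasurable α μ := by
    have := intervalIntegral.continuousOn_primitive_interval (μ := volume) (a := 0) (b := t)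
      (f := lam) (by rw [uIcc_of_le ht, integrableOn_Icc_iff_integrableOn_Ioc]; exact hlam)
    rw [uIcc_of_le ht] at this
    exact ((Real.continuous_exp.comp_continuousOn this.neg).mono
      Ioc_subset_Icc_self).aestronglyMeasurable measurableSet_Ioc
  have hα1 : ∀ᵐ τ ∂μ, α τ ≤ 1 := by
    filter_upwards [hmem] with τ hτ
    rw [hα]
    simp only
    rw [Real.exp_le_one_iff, neg_nonpos, intervalIntegral.integral_of_le hτ.1.le]
    refine setIntegral_nonneg_of_ae_restrict ?_
    exact ae_restrict_of_ae_restrict_of_subset (Ioc_subset_Ioc_right hτ.2) hlam0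
  have hα0 : ∀ τ, 0 ≤ α τ := fun τ => (Real.exp_pos _).le
  -- The jointly measurable versions are used here, since Fubini requires measurability on the
  -- product.
  set H : Plane × ℝ → ℝ := fun p => ψ p.1 * (α p.2 *
    (2 * ((starRingEnd ℂ) (uu p.1 p.2) * gg p.1 p.2).re - lam p.2 * ‖uu p.1 p.2‖ ^ 2)) with hH
  have hHm : AEStronglyMeasurable H (volume.prod μ) := by
    have m1 : Measurable fun p : Plane × ℝ => uu p.1 p.2 := huu
    have m2 : Measurable fun p : Plane × ℝ => gg p.1 p.2 := hgg
    have m3 : AEStronglyMeasurable (fun p : Plane × ℝ => lam p.2) (volume.prod μ) :=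
      hlam.aestronglyMeasurable.comp_snd
    have m4 : AEStronglyMeasurable (fun p : Plane × ℝ => α p.2) (volume.prod μ) := hαm.comp_snd
    have m5 : Measurable fun p : Plane × ℝ => ψ p.1 :=
      hψ.contDiff.continuous.measurable.comp measurable_fst
    have m6 : Measurable fun p : Plane × ℝ => 2 * ((starRingEnd ℂ) (uu p.1 p.2) * gg p.1 p.2).re :=
      (Complex.measurable_re.comp ((Complex.continuous_conj.measurable.comp m1).mul m2)).const_mul 2
    exact m5.aestronglyMeasurable.mul (m4.mul (m6.aestronglyMeasurable.sub
      (m3.mul (m1.norm.pow_const 2).aestronglyMeasurable)))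
  obtain ⟨D, hD⟩ : ∃ D, ∀ x, ψ x * (1 + ‖x‖) ≤ D := by
    obtain ⟨D, hD⟩ := (hψ.compact.mul_right (f' := fun x : Plane => 1 + ‖x‖)).exists_bound_of_continuous
      (hψ.contDiff.continuous.mul (continuous_const.add continuous_norm))
    exact ⟨D, fun x => (Real.le_norm_self _).trans (hD x)⟩
  have hψ1 := hψ.contDiff.continuous
  have hsq : ∀ τ ∈ Icc 0 t, Integrable fun x => ψ x * ‖u τ x‖ ^ 2 := fun τ hτ =>
    (hψ1.mul ((E.contDiff τ hτ).continuous.norm.pow 2)).integrable_of_hasCompactSupport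
      hψ.compact.mul_right
  have hx : ∀ x, ∫ τ, H (x, τ) ∂μ = α t * (ψ x * ‖u t x‖ ^ 2) - ψ x * ‖u 0 x‖ ^ 2 := by
    intro x
    have h1 := exp_mul_normSq_sub ht hlamI (hgI x) fun τ hτ => E.eq τ hτ x
    have h2 : ∫ τ, H (x, τ) ∂μ = ψ x * ∫ τ in (0 : ℝ)..t, Real.exp (-∫ σ in (0 : ℝ)..τ, lam σ) *
        (2 * ((starRingEnd ℂ) (u τ x) * g τ x).re - lam τ * ‖u τ x‖ ^ 2) := by
      rw [intervalIntegral.integral_of_le ht, ← integral_const_mul]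
      refine integral_congr_ae ?_
      filter_upwards [huuu, hggg] with τ e1 e2
      simp only [hH, e1, e2, hα]
    rw [h2, ← h1]
    ring
  have hτ : ∀ᵐ τ ∂μ, Integrable (fun x => H (x, τ)) ∧
      ∫ x, H (x, τ) ≤ Ξ τ + 2 * c * M ^ 2 * B τ ∧
      ∫ x, ‖H (x, τ)‖ ≤ 2 * (M * h τ + 2 * D * B τ * M ^ 2) + lam τ * M ^ 2 := by
    filter_upwards [hmem, huuu, hggg, hα1, hlam0, hle, E.div, E.field_le, E.rhs_nonneg, E.rhs_le]
      with τ hm e1 e2 hα1 hl0 hle hdiv hB hh0 hh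
    have hm' := Ioc_subset_Icc_self hm
    have huc := (E.contDiff τ hm').continuous
    have hB0 : 0 ≤ B τ := by
      have := (abs_nonneg _).trans (hB 0 0)
      simpa using this
    have hc0 : 0 ≤ c := le_trans (by positivity) (hψ.fderiv_le 0 0)
    have k1 : Integrable fun x => ψ x * (2 * ((starRingEnd ℂ) (u τ x) * g τ x).re) := by
      refine Continuous.integrable_of_hasCompactSupport ?_ hψ.compact.mul_right
      exact hψ1.mul (continuous_const.mul (Complex.continuous_re.comp
        ((Complex.continuous_conj.comp huc).mul (E.continuous τ))))
    have k1' : Integrable fun x => ψ x * (‖u τ x‖ * ‖g τ x‖) :=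
      (hψ1.mul (huc.norm.mul (E.continuous τ).norm)).integrable_of_hasCompactSupport
        hψ.compact.mul_right
    have k2 := hsq τ hm'
    have hform : (fun x => H (x, τ)) = fun x =>
        α τ * (ψ x * (2 * ((starRingEnd ℂ) (u τ x) * g τ x).re)) -
          α τ * lam τ * (ψ x * ‖u τ x‖ ^ 2) := by
      ext x
      simp only [hH, e1, e2]
      ring
    have k3 : Integrable fun x => H (x, τ) := by
      rw [hform]
      exact (k1.const_mul _).sub (k2.const_mul _)
    obtain ⟨ζ, hζ0, hζu, hζsq, hζ⟩ := hψ.integral_energy_le (E.contDiff τ hm') (E.continuous τ)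
      (E.contDiff_field τ) hdiv hB E.bound_nonneg (E.bound τ hm') hh0 hh
    have habs := hψ.integral_abs_energy_le (E.contDiff τ hm') (E.continuous τ)
      (E.contDiff_field τ) hB E.bound_nonneg (E.bound τ hm') (E.bound_partialDeriv τ hm') hh0 hh hD
    have hζM : ζ ^ 2 ≤ M ^ 2 := by
      have := (ENNReal.ofReal_le_ofReal_iff E.bound_nonneg).1 (hζu.trans (E.bound τ hm'))
      gcongr
    refine ⟨k3, ?_, ?_⟩
    · have h1 := hle ζ hζ0 hζu
      rw [hform, integral_sub (k1.const_mul _) (k2.const_mul _), integral_const_mul,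
        integral_const_mul, ← hζsq]
      calc _ ≤ α τ * (2 * ζ * h τ + 2 * c * B τ * M ^ 2) - α τ * lam τ * ζ ^ 2 := by
            gcongr
        _ = α τ * (2 * ζ * h τ - lam τ * ζ ^ 2) + α τ * (2 * c * B τ * M ^ 2) := by ring
        _ ≤ Ξ τ + 1 * (2 * c * B τ * M ^ 2) := by
            gcongr
        _ = _ := by ring
    · calc _ ≤ ∫ x, (2 * (ψ x * (‖u τ x‖ * ‖g τ x‖)) + lam τ * (ψ x * ‖u τ x‖ ^ 2)) := by
            refine integral_mono k3.norm ((k1'.const_mul _).add (k2.const_mul _)) fun x => ?_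
            have h0 := hψ.nonneg x
            have h1 : |((starRingEnd ℂ) (u τ x) * g τ x).re| ≤ ‖u τ x‖ * ‖g τ x‖ := by
              refine (Complex.abs_re_le_norm _).trans (le_of_eq ?_)
              rw [norm_mul, RCLike.norm_conj]
            have h2 : |2 * ((starRingEnd ℂ) (u τ x) * g τ x).re - lam τ * ‖u τ x‖ ^ 2| ≤
                2 * (‖u τ x‖ * ‖g τ x‖) + lam τ * ‖u τ x‖ ^ 2 := by
              refine (abs_sub _ _).trans ?_
              rw [abs_mul, abs_two, abs_of_nonneg (by positivity : 0 ≤ lam τ * ‖u τ x‖ ^ 2)]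
              gcongr
            simp only [hH, e1, e2]
            rw [Real.norm_eq_abs, abs_mul, abs_mul, abs_of_nonneg h0, abs_of_nonneg (hα0 τ)]
            calc _ ≤ ψ x * (1 * (2 * (‖u τ x‖ * ‖g τ x‖) + lam τ * ‖u τ x‖ ^ 2)) := by
                  gcongr
              _ = _ := by ring
        _ = 2 * (∫ x, ψ x * (‖u τ x‖ * ‖g τ x‖)) + lam τ * ∫ x, ψ x * ‖u τ x‖ ^ 2 := by
            rw [integral_add (k1'.const_mul _) (k2.const_mul _), integral_const_mul,
              integral_const_mul]
        _ ≤ _ := by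
            rw [← hζsq]
            gcongr
  have hint : Integrable H (volume.prod μ) := by
    rw [integrable_prod_iff' hHm]
    refine ⟨hτ.mono fun τ h => h.1, ?_⟩
    refine Integrable.mono' (g := fun τ => 2 * (M * h τ + 2 * D * B τ * M ^ 2) + lam τ * M ^ 2)
      ?_ hHm.norm.prod_swap.integral_prod_right' (hτ.mono fun τ h => ?_)
    · exact ((((E.integrable_rhs.const_mul M).add
        ((E.integrable_field.const_mul (2 * D)).mul_const _)).const_mul 2).add (hlam.mul_const _))
    · rw [Real.norm_of_nonneg (integral_nonneg fun x => norm_nonneg _)]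
      exact h.2.2
  have hswap := integral_integral_swap (f := fun x τ => H (x, τ)) hint
  simp only [hx] at hswap
  rw [integral_sub ((hsq t ⟨ht, le_rfl⟩).const_mul _) (hsq 0 ⟨le_rfl, ht⟩), integral_const_mul]
    at hswap
  have hmono : ∫ τ, (∫ x, H (x, τ)) ∂μ ≤ ∫ τ, (Ξ τ + 2 * c * M ^ 2 * B τ) ∂μ :=
    integral_mono_ae hint.integral_prod_right (hΞ.add (E.integrable_field.const_mul _))
      (hτ.mono fun τ h => h.2.1)
  rw [integral_add hΞ (E.integrable_field.const_mul _), integral_const_mul, ← hswap] at hmono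
  have e1 : ∫ τ in (0 : ℝ)..t, Ξ τ = ∫ τ, Ξ τ ∂μ := intervalIntegral.integral_of_le ht
  have e2 : ∫ τ in (0 : ℝ)..t, B τ = ∫ τ, B τ ∂μ := intervalIntegral.integral_of_le ht
  rw [e1, e2]
  change α t * _ ≤ _
  linarith

/-- Let the cutoffs increase to one: the localized norms converge by dominated convergence, and the
error is proportional to C/(n+1). -/
theorem EnergySetting.le (E : EnergySetting t u g b h B M)
    (hlam : IntegrableOn lam (Ioc 0 t)) (hlam0 : ∀ᵐ τ ∂(volume.restrict (Ioc 0 t)), 0 ≤ lam τ)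
    (hΞ : IntegrableOn Ξ (Ioc 0 t))
    (hle : ∀ᵐ τ ∂(volume.restrict (Ioc 0 t)), ∀ ζ, 0 ≤ ζ →
      ENNReal.ofReal ζ ≤ eLpNorm (u τ) 2 volume →
      Real.exp (-∫ σ in (0 : ℝ)..τ, lam σ) * (2 * ζ * h τ - lam τ * ζ ^ 2) ≤ Ξ τ) :
    Real.exp (-∫ σ in (0 : ℝ)..t, lam σ) * (eLpNorm (u t) 2 volume).toReal ^ 2 ≤
      (eLpNorm (u 0) 2 volume).toReal ^ 2 + ∫ τ in (0 : ℝ)..t, Ξ τ := by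
  have ht := E.nonneg
  obtain ⟨C, hC, hcut⟩ := exists_isCutoff
  have hR : ∀ n : ℕ, (0 : ℝ) < n + 1 := fun n => by positivity
  choose ψ hψ hψ1 using fun n : ℕ => hcut (n + 1) (hR n)
  have hsq : ∀ τ ∈ Icc 0 t, Integrable (fun x => ‖u τ x‖ ^ 2) ∧
      (eLpNorm (u τ) 2 volume).toReal ^ 2 = ∫ x, ‖u τ x‖ ^ 2 := by
    intro τ hτ
    have huc := (E.contDiff τ hτ).continuous
    have h1 : Integrable fun x => ‖u τ x‖ ^ 2 := by
      have := (integral_norm_mul_norm_le huc huc E.bound_nonneg E.bound_nonneg (E.bound τ hτ)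
        (E.bound τ hτ)).1
      simpa only [sq] using this
    refine ⟨h1, ?_⟩
    rw [← ENNReal.toReal_pow, eLpNorm_two_sq_eq_ofReal h1, ENNReal.toReal_ofReal]
    exact integral_nonneg fun x => sq_nonneg _
  have hlim : ∀ τ ∈ Icc 0 t, Tendsto (fun n => ∫ x, ψ n x * ‖u τ x‖ ^ 2) atTop
      (𝓝 (∫ x, ‖u τ x‖ ^ 2)) := by
    intro τ hτ
    have huc := (E.contDiff τ hτ).continuous
    refine tendsto_integral_of_dominated_convergence (fun x => ‖u τ x‖ ^ 2)
      (fun n => ((hψ n).contDiff.continuous.mul (huc.norm.pow 2)).aestronglyMeasurable)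
      (hsq τ hτ).1 (fun n => Eventually.of_forall fun x => ?_) (Eventually.of_forall fun x => ?_)
    · rw [Real.norm_of_nonneg (mul_nonneg ((hψ n).nonneg x) (sq_nonneg _))]
      exact mul_le_of_le_one_left (sq_nonneg _) ((hψ n).le_one x)
    · refine tendsto_const_nhds.congr' ?_
      filter_upwards [eventually_ge_atTop ⌈Real.log (1 + ‖x‖ ^ 2)⌉₊] with n hn
      rw [hψ1 n x, one_mul]
      have h1 := Nat.le_ceil (Real.log (1 + ‖x‖ ^ 2))
      have h2 : ((⌈Real.log (1 + ‖x‖ ^ 2)⌉₊ : ℕ) : ℝ) ≤ n := by exact_mod_cast hn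
      linarith
  rw [(hsq t ⟨ht, le_rfl⟩).2, (hsq 0 ⟨le_rfl, ht⟩).2]
  have herr : Tendsto (fun n : ℕ => 2 * (C / ((n : ℝ) + 1)) * M ^ 2 * ∫ τ in (0 : ℝ)..t, B τ)
      atTop (𝓝 0) := by
    have h1 : Tendsto (fun n : ℕ => C / ((n : ℝ) + 1)) atTop (𝓝 0) := by
      simpa [div_eq_mul_inv] using (tendsto_one_div_add_atTop_nhds_zero_nat (𝕜 := ℝ)).const_mul C
    have := ((h1.const_mul 2).mul_const (M ^ 2)).mul_const (∫ τ in (0 : ℝ)..t, B τ)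
    simpa using this
  have hR' := ((hlim 0 ⟨le_rfl, ht⟩).add_const (∫ τ in (0 : ℝ)..t, Ξ τ)).add herr
  rw [add_zero] at hR'
  exact le_of_tendsto_of_tendsto' ((hlim t ⟨ht, le_rfl⟩).const_mul _) hR' fun n =>
    E.cutoff_le hlam hlam0 hΞ hle (hψ n)

end Energy

end LosingTransport

namespace LosingTransport

/-! ### Weights -/

theorem decay_eq (p q : ℕ) : decay p q = (2 : ℝ) ^ (-(((p : ℤ) - q).natAbs : ℝ)) := by
  rw [decay, Real.rpow_neg zero_le_two, Real.rpow_natCast]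
  rcases le_total p q with h | h
  · obtain ⟨k, rfl⟩ := Nat.exists_eq_add_of_le h
    rw [min_eq_left h, max_eq_right h, pow_add, show ((p : ℤ) - (p + k : ℕ)).natAbs = k by omega]
    field_simp
  · obtain ⟨k, rfl⟩ := Nat.exists_eq_add_of_le h
    rw [min_eq_right h, max_eq_left h, pow_add, show (((q + k : ℕ) : ℤ) - q).natAbs = k by omega]
    field_simp

/-- The exponent of the truncated weights: `ns`, but at most `M + nσ`. -/
noncomputable def weightExp (s σ M : ℝ) (n : ℕ) : ℝ := min (n * s) (M + n * σ)

/-- The weights with a loss of `y` derivatives. -/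
noncomputable def lossWeight (s σ M y : ℝ) (n : ℕ) : ℝ := (2 : ℝ) ^ (weightExp s σ M n - (n + 1) * y)

theorem lossWeight_pos (s σ M y : ℝ) (n : ℕ) : 0 < lossWeight s σ M y n :=
  Real.rpow_pos_of_pos two_pos _

/-- The coefficients of the interaction of the blocks. -/
noncomputable def interaction (κ : ℝ) (k : ℤ) : ℝ := (1 + k.natAbs) * (2 : ℝ) ^ (-κ * k.natAbs)

theorem interaction_nonneg (κ : ℝ) (k : ℤ) : 0 ≤ interaction κ k := by
  unfold interaction; positivity

theorem summable_interaction {κ : ℝ} (hκ : 0 < κ) : Summable (interaction κ) := by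
  have h1 : Summable fun n : ℕ => (1 + (n : ℝ)) * (2 : ℝ) ^ (-κ * n) := by
    have hr : ‖(2 : ℝ) ^ (-κ)‖ < 1 := by
      rw [Real.norm_of_nonneg (by positivity)]
      exact Real.rpow_lt_one_of_one_lt_of_neg one_lt_two (by linarith)
    have h2 := summable_geometric_of_norm_lt_one hr
    have h3 := summable_pow_mul_geometric_of_norm_lt_one 1 hr
    refine (h2.add h3).congr fun n => ?_
    rw [Real.rpow_mul zero_le_two, Real.rpow_natCast]
    ring
  refine Summable.of_nat_of_neg ?_ ?_
  · simpa [interaction] using h1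
  · simpa [interaction] using h1

theorem tsum_interaction_le {κ : ℝ} (hκ : 0 < κ) (n : ℕ) :
    ∑' p : ℕ, ENNReal.ofReal (interaction κ ((p : ℤ) - n)) ≤
      ENNReal.ofReal (∑' k, interaction κ k) := by
  rw [ENNReal.ofReal_tsum_of_nonneg (interaction_nonneg κ) (summable_interaction hκ)]
  refine ENNReal.tsum_comp_le_tsum_of_injective (f := fun p : ℕ => (p : ℤ) - n) (fun a b h => ?_)
    fun k => ENNReal.ofReal (interaction κ k)
  simpa using h

/-- For `p ≤ n` the exponent of the weight rises by at most s ≤ 1−κ per index; for `p ≥ n` it falls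
by at most y−σ ≤ 1−κ per index. The decay 2^{-|p-n|} thus leaves 2^{-κ|p-n|}, and the larger square
root costs a factor 1+|p−n|. -/
theorem lossWeight_mul_le {s σ M y κ : ℝ} (hσs : σ ≤ s) (hs : s ≤ 1 - κ) (hy : 0 ≤ y)
    (hσ : -1 + κ ≤ σ - y) (n p : ℕ) :
    lossWeight s σ M y n * (Real.sqrt (1 + (max p n : ℕ)) * decay p n) ≤
      Real.sqrt (1 + n) * interaction κ ((p : ℤ) - n) * lossWeight s σ M y p := by
  rw [decay_eq, interaction, lossWeight, lossWeight]
  set d := ((p : ℤ) - n).natAbs with hd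
  have hsqrt : Real.sqrt (1 + (max p n : ℕ)) ≤ Real.sqrt (1 + n) * (1 + d) := by
    rw [Real.sqrt_le_iff]
    refine ⟨by positivity, ?_⟩
    rw [mul_pow, Real.sq_sqrt (by positivity)]
    have h1 : ((max p n : ℕ) : ℝ) ≤ n + d := by
      have : max p n ≤ n + d := by omega
      exact_mod_cast this
    have h2 : (0 : ℝ) ≤ n := Nat.cast_nonneg n
    have h3 : (0 : ℝ) ≤ d := Nat.cast_nonneg d
    nlinarith [mul_nonneg h2 h3, mul_nonneg h3 h3, mul_nonneg (mul_nonneg h2 h3) h3]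
  have hexp : weightExp s σ M n - (n + 1) * y + -(d : ℝ) ≤
      -κ * d + (weightExp s σ M p - (p + 1) * y) := by
    unfold weightExp
    rcases le_total p n with h | h
    · have h1 : (n : ℝ) = p + d := by
        have : n = p + d := by omega
        exact_mod_cast this
      have h3 : (0 : ℝ) ≤ d := Nat.cast_nonneg d
      have h4 : min ((n : ℝ) * s) (M + n * σ) ≤ min ((p : ℝ) * s) (M + p * σ) + d * s := by
        rw [← min_add_add_right]
        refine min_le_min (by rw [h1]; linarith) ?_
        rw [h1]
        nlinarith [mul_le_mul_of_nonneg_left hσs h3]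
      have h5 := mul_le_mul_of_nonneg_left hs h3
      have h6 := mul_nonneg h3 hy
      rw [h1] at h4 ⊢
      nlinarith
    · have h1 : (p : ℝ) = n + d := by
        have : p = n + d := by omega
        exact_mod_cast this
      have h3 : (0 : ℝ) ≤ d := Nat.cast_nonneg d
      have h4 : min ((n : ℝ) * s) (M + n * σ) + d * σ ≤ min ((p : ℝ) * s) (M + p * σ) := by
        rw [← min_add_add_right]
        refine min_le_min ?_ (by rw [h1]; linarith)
        rw [h1]
        nlinarith [mul_le_mul_of_nonneg_left hσs h3]
      have h5 := mul_le_mul_of_nonneg_left hσ h3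
      rw [h1] at h4 ⊢
      nlinarith
  have hpow := Real.rpow_le_rpow_of_exponent_le one_le_two hexp
  rw [Real.rpow_add two_pos, Real.rpow_add two_pos] at hpow
  calc _ = Real.sqrt (1 + (max p n : ℕ)) *
        ((2 : ℝ) ^ (weightExp s σ M n - (n + 1) * y) * (2 : ℝ) ^ (-(d : ℝ))) := by ring
    _ ≤ Real.sqrt (1 + n) * (1 + d) *
        ((2 : ℝ) ^ (-κ * d) * (2 : ℝ) ^ (weightExp s σ M p - (p + 1) * y)) := by gcongr
    _ = _ := by ring

/-- Each `z p` is at most Y divided by its weight. After the weights are compared, the sum over `p`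
is a convolution with a summable sequence, uniformly in `n` and in the truncation `M`. -/
theorem tsum_remainder_le {s σ M y κ : ℝ} (hκ : 0 < κ) (hσs : σ ≤ s) (hs : s ≤ 1 - κ) (hy : 0 ≤ y)
    (hσ : -1 + κ ≤ σ - y) {z : ℕ → ENNReal} {Y : ℝ}
    (hz : ∀ p, ENNReal.ofReal (lossWeight s σ M y p) * z p ≤ ENNReal.ofReal Y) {C A : ℝ}
    (hC : 0 ≤ C) (hA : 0 ≤ A) (n : ℕ) :
    ∑' p : ℕ, ENNReal.ofReal (C * (A * Real.sqrt (1 + (max p n : ℕ)) * decay p n)) * z p ≤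
      ENNReal.ofReal (C * (∑' k, interaction κ k) * A * Real.sqrt (1 + n) * Y /
        lossWeight s σ M y n) := by
  set W := lossWeight s σ M y
  have hW : ∀ p, 0 < W p := lossWeight_pos s σ M y
  have hc : 0 ≤ C * A * Real.sqrt (1 + n) / W n := by have := hW n; positivity
  have h1 : ∀ p : ℕ, ENNReal.ofReal (C * (A * Real.sqrt (1 + (max p n : ℕ)) * decay p n)) * z p ≤
      ENNReal.ofReal (C * A * Real.sqrt (1 + n) / W n) *
        (ENNReal.ofReal (interaction κ ((p : ℤ) - n)) * ENNReal.ofReal Y) := by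
    intro p
    have h2 := lossWeight_mul_le (M := M) hσs hs hy hσ n p
    have h3 : C * (A * Real.sqrt (1 + (max p n : ℕ)) * decay p n) ≤
        C * A * Real.sqrt (1 + n) / W n * (interaction κ ((p : ℤ) - n) * W p) := by
      rw [div_mul_eq_mul_div, le_div_iff₀ (hW n)]
      calc _ = C * A * (W n * (Real.sqrt (1 + (max p n : ℕ)) * decay p n)) := by ring
        _ ≤ C * A * (Real.sqrt (1 + n) * interaction κ ((p : ℤ) - n) * W p) := by gcongr
        _ = _ := by ring
    calc _ ≤ ENNReal.ofReal (C * A * Real.sqrt (1 + n) / W n *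
          (interaction κ ((p : ℤ) - n) * W p)) * z p := by gcongr
      _ = ENNReal.ofReal (C * A * Real.sqrt (1 + n) / W n) *
          (ENNReal.ofReal (interaction κ ((p : ℤ) - n)) * (ENNReal.ofReal (W p) * z p)) := by
          rw [ENNReal.ofReal_mul hc, ENNReal.ofReal_mul (interaction_nonneg _ _)]
          ring
      _ ≤ _ := by
          gcongr
          exact hz p
  refine (ENNReal.tsum_le_tsum h1).trans ?_
  rw [ENNReal.tsum_mul_left, ENNReal.tsum_mul_right]
  have h0 : 0 ≤ ∑' k, interaction κ k := tsum_nonneg (interaction_nonneg κ)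
  calc _ ≤ ENNReal.ofReal (C * A * Real.sqrt (1 + n) / W n) *
        (ENNReal.ofReal (∑' k, interaction κ k) * ENNReal.ofReal Y) := by
        gcongr
        exact tsum_interaction_le hκ n
    _ = _ := by
        rw [← ENNReal.ofReal_mul h0, ← ENNReal.ofReal_mul hc]
        congr 1
        ring

/-! ### Besov norms in terms of the symbols of the blocks -/

theorem besovNorm_eq (L : DyadicCouple) (s : ℝ) (u : 𝓢'(Plane, ℂ)) :
    L.besovNorm s u = ⨆ n : ℕ, ENNReal.ofReal ((2 : ℝ) ^ (((n : ℝ) - 1) * s)) *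
      eLpNorm (multiplier (L.blockSymbol n) u) 2 volume := by
  rw [DyadicCouple.besovNorm]
  apply le_antisymm
  · refine iSup₂_le fun q hq => ?_
    obtain ⟨n, rfl⟩ : ∃ n : ℕ, q = (n : ℤ) - 1 := ⟨(q + 1).toNat, by omega⟩
    refine le_iSup_of_le n ?_
    rw [L.block_eq]
    push_cast
    exact le_rfl
  · refine iSup_le fun n => le_iSup₂_of_le ((n : ℤ) - 1) (by omega) ?_
    rw [L.block_eq]
    push_cast
    exact le_rfl

theorem eLpNorm_block_le_besovNorm (L : DyadicCouple) (s : ℝ) (u : 𝓢'(Plane, ℂ)) (n : ℕ) :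
    eLpNorm (multiplier (L.blockSymbol n) u) 2 volume ≤
      ENNReal.ofReal ((2 : ℝ) ^ ((1 - (n : ℝ)) * s)) * L.besovNorm s u := by
  rw [besovNorm_eq]
  have h := le_iSup (fun n : ℕ => ENNReal.ofReal ((2 : ℝ) ^ (((n : ℝ) - 1) * s)) *
      eLpNorm (multiplier (L.blockSymbol n) u) 2 volume) n
  refine le_trans (le_of_eq ?_) (mul_le_mul_right h _)
  rw [← mul_assoc, ← ENNReal.ofReal_mul (by positivity), ← Real.rpow_add two_pos,
    show (1 - (n : ℝ)) * s + ((n : ℝ) - 1) * s = 0 by ring, Real.rpow_zero, ENNReal.ofReal_one,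
    one_mul]

theorem besovNorm_le_of_le (L : DyadicCouple) {s σ : ℝ} (h : s ≤ σ) (u : 𝓢'(Plane, ℂ)) :
    L.besovNorm s u ≤ ENNReal.ofReal ((2 : ℝ) ^ (σ - s)) * L.besovNorm σ u := by
  rw [besovNorm_eq L s]
  refine iSup_le fun n => ?_
  refine (mul_le_mul_right (eLpNorm_block_le_besovNorm L σ u n) _).trans ?_
  rw [← mul_assoc, ← ENNReal.ofReal_mul (by positivity), ← Real.rpow_add two_pos]
  gcongr
  · exact one_le_two
  · have : (0 : ℝ) ≤ n := Nat.cast_nonneg n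
    nlinarith

/-- Each block has a jointly measurable version, so its L² norm is measurable in time, and the
supremum is countable. -/
theorem aemeasurable_besovNorm (L : DyadicCouple) (s : ℝ) {μ : Measure ℝ}
    {f : ℝ → 𝓢'(Plane, ℂ)} (hf : ∀ θ : 𝓢(Plane, ℂ), AEStronglyMeasurable (fun t => f t θ) μ) :
    AEMeasurable (fun τ => L.besovNorm s (f τ)) μ := by
  rw [show (fun τ => L.besovNorm s (f τ)) = fun τ => ⨆ n : ℕ,
    ENNReal.ofReal ((2 : ℝ) ^ (((n : ℝ) - 1) * s)) *
      eLpNorm (multiplier (L.blockSymbol n) (f τ)) 2 volume from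
    funext fun τ => besovNorm_eq L s (f τ)]
  refine AEMeasurable.iSup fun n => AEMeasurable.const_mul ?_ _
  obtain ⟨H, hH, hHf⟩ := exists_measurable_uncurry (μ := μ)
    (G := fun τ => multiplier (L.blockSymbol n) (f τ))
    (Eventually.of_forall fun τ => (contDiff_multiplier _ _).continuous) fun x => hf _
  have hm : Measurable fun τ => ∫⁻ x, ‖H x τ‖ₑ ^ 2 :=
    (hH.enorm.pow_const 2).lintegral_prod_left'
  refine ⟨fun τ => (∫⁻ x, ‖H x τ‖ₑ ^ 2) ^ (1 / 2 : ℝ), hm.pow_const _, ?_⟩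
  filter_upwards [hHf] with τ hτ
  have h1 : (fun x => ‖H x τ‖ₑ ^ 2) =
      fun x => ‖multiplier (L.blockSymbol n) (f τ) x‖ₑ ^ 2 := by
    ext x; rw [hτ x]
  rw [h1, ← eLpNorm_two_sq, ← ENNReal.rpow_natCast, ← ENNReal.rpow_mul]
  norm_num

end LosingTransport

namespace LosingTransport

/-! ### The bound of the velocity field at a fixed time -/

theorem le_of_ae_le_of_continuous {F : Plane → ℝ} (hF : Continuous F) {a : ℝ}
    (h : ∀ᵐ x, F x ≤ a) (x : Plane) : F x ≤ a := by
  by_contra hx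
  push Not at hx
  have hopen : IsOpen {y | a < F y} := isOpen_lt continuous_const hF
  have hzero : volume {y | a < F y} = 0 := by
    have : {y | a < F y} = {y | ¬ F y ≤ a} := by ext y; simp
    rw [this]
    exact h
  have := (hopen.measure_eq_zero_iff volume).1 hzero
  exact (Set.eq_empty_iff_forall_notMem.1 this x) hx

/-- The essential bounds hold everywhere because the cut-offs are continuous functions. -/
theorem gradBound_of_iSup_le {L : DyadicCouple} {v : Fin 2 → 𝓢'(Plane, ℂ)} {A : ℝ}
    (hreal : ∀ i, IsRealDistribution (v i)) (hdiv : divergence v = 0) (hA : 0 ≤ A)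
    (h : (⨆ N : ℕ, L.gradLowNorm N v / ENNReal.ofReal (Real.sqrt (1 + N))) ≤ ENNReal.ofReal A) :
    GradBound L v A := by
  refine ⟨hA, hreal, hdiv, fun N i k x => ?_⟩
  have hN : (0 : ℝ) < Real.sqrt (1 + N) := by positivity
  have h1 := (le_iSup _ N).trans h
  rw [ENNReal.div_le_iff (by simpa using hN) ENNReal.ofReal_ne_top,
    ← ENNReal.ofReal_mul hA] at h1
  have h2 : ∀ᵐ y, ‖multiplier (L.lowSymbol N) (∂_{basisVec k} (v i)) y‖ ≤
      A * Real.sqrt (1 + N) := by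
    rw [DyadicCouple.gradLowNorm, eLpNorm_exponent_top] at h1
    have h3 := ae_le_eLpNormEssSup (μ := (volume : Measure Plane))
      (f := fun x => Real.sqrt (∑ i, ∑ j, ‖L.lowFreq N (∂_{basisVec j} (v i)) x‖ ^ 2))
    filter_upwards [h3] with y hy
    have h4 := hy.trans h1
    rw [← ofReal_norm, ENNReal.ofReal_le_ofReal_iff (by positivity),
      Real.norm_of_nonneg (Real.sqrt_nonneg _)] at h4
    refine le_trans (Real.le_sqrt_of_sq_le ?_) h4
    rw [← L.lowFreq_eq]
    refine le_trans ?_ (Finset.single_le_sum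
      (f := fun i => ∑ j, ‖L.lowFreq N (∂_{basisVec j} (v i)) y‖ ^ 2)
      (fun i _ => Finset.sum_nonneg fun j _ => sq_nonneg _) (Finset.mem_univ i))
    exact Finset.single_le_sum (f := fun j => ‖L.lowFreq N (∂_{basisVec j} (v i)) y‖ ^ 2)
      (fun j _ => sq_nonneg _) (Finset.mem_univ k)
  exact le_of_ae_le_of_continuous (contDiff_multiplier _ _).continuous.norm h2 x

/-! ### The equations of the blocks -/

/-- The transport equation, with the hypotheses on the velocity field in pointwise form. -/
structure TransportData (L : DyadicCouple) (T : ℝ) (v : ℝ → Fin 2 → 𝓢'(Plane, ℂ)) (V : ℝ → ℝ)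
    (f ρ P : ℝ → 𝓢'(Plane, ℂ)) : Prop where
  velocity : ∀ i, ∀ θ : 𝓢(Plane, ℂ), IntegrableOn (fun t => v t i θ) (Icc 0 T)
  integrable : IntegrableOn V (Icc 0 T)
  grad : ∀ᵐ τ ∂(volume.restrict (Icc 0 T)), GradBound L (v τ) (V τ)
  adv : ∀ᵐ τ ∂(volume.restrict (Icc 0 T)), L.IsAdvection (v τ) (ρ τ) (P τ)
  integrable_source : ∀ θ : 𝓢(Plane, ℂ), IntegrableOn (fun t => f t θ) (Icc 0 T)
  integrable_adv : ∀ θ : 𝓢(Plane, ℂ), IntegrableOn (fun t => P t θ) (Icc 0 T)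
  eq : ∀ θ : 𝓢(Plane, ℂ), ∀ t ∈ Icc 0 T, ρ t θ = ρ 0 θ + ∫ τ in (0 : ℝ)..t, (f τ θ - P τ θ)

section TransportData

variable {L : DyadicCouple} {K T : ℝ} {v : ℝ → Fin 2 → 𝓢'(Plane, ℂ)} {V : ℝ → ℝ}
  {f ρ P : ℝ → 𝓢'(Plane, ℂ)}

theorem contDiff_transportField (L : DyadicCouple) (q : ℕ) (v : Fin 2 → 𝓢'(Plane, ℂ))
    (i : Fin 2) : ContDiff ℝ 1 (transportField L q v i) :=
  Complex.reCLM.contDiff.comp ((contDiff_multiplier _ _).of_le (by simp))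

theorem fderiv_transportField (L : DyadicCouple) (q : ℕ) (v : Fin 2 → 𝓢'(Plane, ℂ))
    (i : Fin 2) (x : Plane) (e : Plane) : fderiv ℝ (transportField L q v i) x e =
      (fderiv ℝ (multiplier (L.lowSymbol q) (v i)) x e).re := by
  have h : HasFDerivAt (transportField L q v i)
      (Complex.reCLM.comp (fderiv ℝ (multiplier (L.lowSymbol q) (v i)) x)) x :=
    Complex.reCLM.hasFDerivAt.comp x
      ((contDiff_multiplier _ _).differentiable (by simp) x).hasFDerivAt
  rw [h.fderiv]
  rfl

theorem GradBound.sum_fderiv_transportField {A : ℝ} {w : Fin 2 → 𝓢'(Plane, ℂ)}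
    (hv : GradBound L w A) (q : ℕ) (x : Plane) :
    ∑ i, fderiv ℝ (transportField L q w i) x (basisVec i) = 0 := by
  have h := congrArg Complex.re (hv.sum_partialDeriv (L.lowSymbol q) x)
  rw [Complex.re_sum] at h
  rw [Finset.sum_congr rfl fun i _ => fderiv_transportField L q w i x (basisVec i)]
  exact h

/-- The Lipschitz bound gives linear growth. The values at the origin are kept in the constant
because they are integrable in time. -/
theorem GradBound.abs_transportField_le {A : ℝ} {w : Fin 2 → 𝓢'(Plane, ℂ)}
    (hv : GradBound L w A) (q : ℕ) (i : Fin 2) (x : Plane) :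
    |transportField L q w i x| ≤ (∑ j, ‖multiplier (L.lowSymbol q) (w j) 0‖ +
      2 * (A * Real.sqrt (1 + q))) * (1 + ‖x‖) := by
  have h1 := norm_sub_le_of_partialDeriv_le
    ((contDiff_multiplier (L.lowSymbol q) (w i)).differentiable (by simp))
    (fun k x => hv.norm_partialDeriv_low_le q i k x) 0 x
  rw [sub_zero] at h1
  have h2 : ‖multiplier (L.lowSymbol q) (w i) x‖ ≤ ‖multiplier (L.lowSymbol q) (w i) 0‖ +
      2 * (A * Real.sqrt (1 + q)) * ‖x‖ := by
    calc _ = ‖multiplier (L.lowSymbol q) (w i) 0 +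
          (multiplier (L.lowSymbol q) (w i) x - multiplier (L.lowSymbol q) (w i) 0)‖ := by
          rw [add_sub_cancel]
      _ ≤ _ := (norm_add_le _ _).trans (add_le_add le_rfl h1)
  have h3 : ‖multiplier (L.lowSymbol q) (w i) 0‖ ≤
      ∑ j, ‖multiplier (L.lowSymbol q) (w j) 0‖ :=
    Finset.single_le_sum (f := fun j => ‖multiplier (L.lowSymbol q) (w j) 0‖)
      (fun j _ => norm_nonneg _) (Finset.mem_univ i)
  have h4 : 0 ≤ ∑ j, ‖multiplier (L.lowSymbol q) (w j) 0‖ :=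
    Finset.sum_nonneg fun j _ => norm_nonneg _
  have h5 : 0 ≤ 2 * (A * Real.sqrt (1 + q)) := by have := hv.nonneg; positivity
  have h6 := norm_nonneg x
  refine (Complex.abs_re_le_norm _).trans (h2.trans ?_)
  nlinarith [mul_nonneg h4 h6]

/-- Testing the equation on translated kernels gives the equation of a block at each point. Its
forcing plus the transport term is the block of `f` plus `advRemainder`. By Bernstein one constant
bounds both the block and its gradient. -/
theorem TransportData.energySetting (D : TransportData L T v V f ρ P) (hK : KernelBound L K)
    {t : ℝ} (ht : t ∈ Icc 0 T) (n : ℕ) {h : ℝ → ℝ} {M : ℝ} (hM0 : 0 ≤ M)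
    (hM : ∀ τ ∈ Icc 0 t, eLpNorm (multiplier (L.blockSymbol n) (ρ τ)) 2 volume ≤ ENNReal.ofReal M)
    (hh0 : ∀ᵐ τ ∂(volume.restrict (Ioc 0 t)), 0 ≤ h τ)
    (hh : ∀ᵐ τ ∂(volume.restrict (Ioc 0 t)),
      eLpNorm (multiplier (L.blockSymbol n) (f τ)) 2 volume +
        eLpNorm (advRemainder L n (v τ) (ρ τ) (P τ)) 2 volume ≤ ENNReal.ofReal (h τ))
    (hint : IntegrableOn h (Ioc 0 t)) :
    EnergySetting t (fun τ => multiplier (L.blockSymbol n) (ρ τ))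
      (fun τ x => multiplier (L.blockSymbol n) (f τ) x - multiplier (L.blockSymbol n) (P τ) x)
      (fun τ => transportField L n (v τ)) h
      (fun τ => ∑ j, ‖multiplier (L.lowSymbol n) (v τ j) 0‖ + 2 * (V τ * Real.sqrt (1 + n)))
      ((1 + 2 ^ n * K) * M) := by
  have hK0 := hK.1
  have hsub : Ioc 0 t ⊆ Icc 0 T := fun τ hτ => ⟨hτ.1.le, hτ.2.trans ht.2⟩
  have hsub' : Icc 0 t ⊆ Icc 0 T := fun τ hτ => ⟨hτ.1, hτ.2.trans ht.2⟩
  have hgrad := ae_restrict_of_ae_restrict_of_subset hsub D.grad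
  have hb : ∀ τ, Continuous (multiplier (L.blockSymbol n) (f τ)) := fun τ =>
    (contDiff_multiplier _ _).continuous
  refine ⟨ht.1, fun x => ?_, fun τ hτ x => ?_, fun τ _ => ?_, by positivity, fun τ hτ => ?_,
    fun τ hτ i => ?_, fun τ => ?_, fun τ i => contDiff_transportField L n (v τ) i, ?_, ?_, ?_, hh0,
    ?_, hint⟩
  · exact ((D.integrable_source _).sub (D.integrable_adv _)).mono_set hsub
  · exact D.eq _ τ (hsub' hτ)
  · exact (contDiff_multiplier _ _).of_le (by simp)
  · refine (hM τ hτ).trans (ENNReal.ofReal_le_ofReal ?_)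
    have : 0 ≤ 2 ^ n * K * M := by positivity
    linarith
  · rw [partialDeriv_multiplier]
    refine (hK.eLpNorm_gradient_block_le _ n i).trans ?_
    refine (mul_le_mul' le_rfl (hM τ hτ)).trans ?_
    rw [← ENNReal.ofReal_mul (by positivity)]
    refine ENNReal.ofReal_le_ofReal ?_
    linarith
  · exact (hb τ).sub (contDiff_multiplier _ _).continuous
  · filter_upwards [hgrad] with τ hτ x
    exact hτ.sum_fderiv_transportField n x
  · filter_upwards [hgrad] with τ hτ i x
    exact hτ.abs_transportField_le n i x
  · refine Integrable.add ?_ (((D.integrable.mono_set hsub).mul_const _).const_mul 2)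
    exact integrable_finsetSum _ fun j _ => ((D.velocity j _).mono_set hsub).norm
  · filter_upwards [hh] with τ hτ
    refine le_trans ?_ hτ
    refine le_trans (le_of_eq ?_) (eLpNorm_add_le (f := multiplier (L.blockSymbol n) (f τ))
      (g := advRemainder L n (v τ) (ρ τ) (P τ)) (hb τ).aestronglyMeasurable ?_ one_le_two)
    · congr 1
      ext x
      simp only [advRemainder, Pi.add_apply]
      have h1 : ∀ i, partialDeriv i (multiplier (L.blockSymbol n) (ρ τ)) x =
          multiplier (L.blockSymbol n) (∂_{basisVec i} (ρ τ)) x :=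
        fun i => congrFun (partialDeriv_multiplier _ _ _) x
      simp only [h1]
      ring
    · refine Continuous.aestronglyMeasurable (Continuous.sub (continuous_finsetSum _ fun i _ => ?_)
        (contDiff_multiplier _ _).continuous)
      exact (Complex.continuous_ofReal.comp (continuous_transportField L n (v τ) i)).mul
        (contDiff_multiplier _ _).continuous

end TransportData

end LosingTransport

namespace LosingTransport

/-! ### The weighted energy estimates -/

/-- The product rule `exp_mul_normSq_sub` for a constant function of modulus one and the rate −cV.
-/
theorem integral_mul_exp_primitive {t c : ℝ} (ht : 0 ≤ t) {V : ℝ → ℝ}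
    (hV : IntervalIntegrable V volume 0 t) :
    ∫ τ in (0 : ℝ)..t, c * V τ * Real.exp (c * ∫ σ in (0 : ℝ)..τ, V σ) =
      Real.exp (c * ∫ σ in (0 : ℝ)..t, V σ) - 1 := by
  have h := exp_mul_normSq_sub (t := t) ht (lam := fun σ => -c * V σ) (U := fun _ => 1)
    (G := fun _ => 0) (hV.const_mul _) (by simp) (fun τ _ => by simp)
  simp only [neg_mul, intervalIntegral.integral_neg, neg_neg, intervalIntegral.integral_const_mul,
    norm_one, one_pow, mul_one, mul_zero, Complex.zero_re, zero_sub] at h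
  rw [h]
  refine intervalIntegral.integral_congr fun τ _ => ?_
  ring

theorem lossWeight_eq_exp (s σ M x : ℝ) (n : ℕ) :
    lossWeight s σ M (x / Real.log 2) n =
      (2 : ℝ) ^ weightExp s σ M n * Real.exp (-((n + 1) * x)) := by
  have h2 : Real.log 2 ≠ 0 := (Real.log_pos one_lt_two).ne'
  rw [lossWeight, Real.rpow_sub two_pos, Real.exp_neg, div_eq_mul_inv]
  congr 2
  rw [Real.rpow_def_of_pos two_pos]
  congr 1
  field_simp

/-- The difference of the two sides is V/(2β)·(2β√N X − CY)². The source carries √N and the damping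
N, so nothing depending on N remains; this is why the weights lose n+1 times a common amount. -/
theorem absorb_le {β C V X Y N : ℝ} (hβ : 0 < β) (hV : 0 ≤ V) (hN : 0 ≤ N) :
    2 * X * (C * V * Real.sqrt N * Y) - 2 * β * N * V * X ^ 2 ≤ C ^ 2 / (2 * β) * V * Y ^ 2 := by
  have hsq := Real.sq_sqrt hN
  set r := Real.sqrt N
  rw [← hsq]
  have h : C ^ 2 / (2 * β) * V * Y ^ 2 -
      (2 * X * (C * V * r * Y) - 2 * β * r ^ 2 * V * X ^ 2) =
      V / (2 * β) * (2 * β * r * X - C * Y) ^ 2 := by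
    field_simp
    ring
  have h2 : 0 ≤ V / (2 * β) * (2 * β * r * X - C * Y) ^ 2 := by positivity
  linarith

/-- The constant of the remainder estimate. -/
noncomputable def remainderConst (K κ : ℝ) : ℝ := 100 * (K + 1) ^ 3 * ∑' k, interaction κ k

section Gronwall

variable {L : DyadicCouple} {K T : ℝ} {v : ℝ → Fin 2 → 𝓢'(Plane, ℂ)} {V : ℝ → ℝ}
  {f ρ P : ℝ → 𝓢'(Plane, ℂ)}

theorem TransportData.primitive_nonneg (D : TransportData L T v V f ρ P) {τ : ℝ}
    (hτ : τ ∈ Icc 0 T) : 0 ≤ ∫ σ in (0 : ℝ)..τ, V σ := by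
  rw [intervalIntegral.integral_of_le hτ.1]
  have hsub : Ioc 0 τ ⊆ Icc 0 T := fun x hx => ⟨hx.1.le, hx.2.trans hτ.2⟩
  exact setIntegral_nonneg_of_ae_restrict
    (ae_restrict_of_ae_restrict_of_subset hsub (D.grad.mono fun _ h => h.nonneg))

theorem TransportData.primitive_mono (D : TransportData L T v V f ρ P) {τ t : ℝ} (hτ : 0 ≤ τ)
    (hτt : τ ≤ t) (ht : t ≤ T) : ∫ σ in (0 : ℝ)..τ, V σ ≤ ∫ σ in (0 : ℝ)..t, V σ := by
  have hV : ∀ a b, 0 ≤ a → a ≤ b → b ≤ T → IntervalIntegrable V volume a b := fun a b ha hab hb =>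
    (intervalIntegrable_iff_integrableOn_Ioc_of_le hab).2
      (D.integrable.mono_set fun x hx => ⟨ha.trans hx.1.le, hx.2.trans hb⟩)
  rw [← intervalIntegral.integral_add_adjacent_intervals (hV 0 τ le_rfl hτ (hτt.trans ht))
    (hV τ t hτ hτt ht), intervalIntegral.integral_of_le hτt]
  have hsub : Ioc τ t ⊆ Icc 0 T := fun x hx => ⟨hτ.trans hx.1.le, hx.2.trans ht⟩
  exact le_add_of_nonneg_right (setIntegral_nonneg_of_ae_restrict
    (ae_restrict_of_ae_restrict_of_subset hsub (D.grad.mono fun _ h => h.nonneg)))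

/-- The bound Φ exp(kΛ) on all the weighted blocks up to time t is fed into the remainder and
returns with the factor 1/2 in front of Φ² exp(2kΛ). This gain makes the estimate closable. The
right side depends neither on `M` nor on the finite bounds `m`. -/
theorem TransportData.weighted_le (D : TransportData L T v V f ρ P) (hK : KernelBound L K)
    {s σ κ ε β M : ℝ} (hκ : 0 < κ) (hσs : σ ≤ s) (hs : s ≤ 1 - κ) (hσ : -1 + κ ≤ σ - ε)
    (hβ : 0 < β) {t : ℝ} (ht : t ∈ Icc 0 T)
    (hβε : β * (∫ σ in (0 : ℝ)..t, V σ) ≤ ε * Real.log 2)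
    {F : ℝ → ℝ} (hF : IntegrableOn F (Icc 0 T)) (hF0 : ∀ τ, 0 ≤ F τ)
    (hfF : ∀ᵐ τ ∂(volume.restrict (Icc 0 T)), ∀ n : ℕ,
      eLpNorm (multiplier (L.blockSymbol n) (f τ)) 2 volume ≤
        ENNReal.ofReal ((2 : ℝ) ^ ((1 - (n : ℝ)) * s) * F τ))
    {N₀ : ℝ} (hN₀ : 0 ≤ N₀) (hρ₀ : ∀ n : ℕ, eLpNorm (multiplier (L.blockSymbol n) (ρ 0)) 2 volume ≤
        ENNReal.ofReal ((2 : ℝ) ^ ((1 - (n : ℝ)) * s) * N₀))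
    {m : ℕ → ℝ} (hm0 : ∀ n, 0 ≤ m n) (hm : ∀ τ ∈ Icc 0 T, ∀ n,
      eLpNorm (multiplier (L.blockSymbol n) (ρ τ)) 2 volume ≤ ENNReal.ofReal (m n))
    {k : ℝ} (hk : k = remainderConst K κ ^ 2 / (2 * β)) {Φ : ℝ} (hΦ : 0 ≤ Φ)
    (hz : ∀ τ ∈ Icc 0 t, ∀ n,
      ENNReal.ofReal (lossWeight s σ M (β * (∫ σ in (0 : ℝ)..τ, V σ) / Real.log 2) n) *
        eLpNorm (multiplier (L.blockSymbol n) (ρ τ)) 2 volume ≤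
          ENNReal.ofReal (Φ * Real.exp (k * ∫ σ in (0 : ℝ)..τ, V σ))) (n : ℕ) :
    (lossWeight s σ M (β * (∫ σ in (0 : ℝ)..t, V σ) / Real.log 2) n *
      (eLpNorm (multiplier (L.blockSymbol n) (ρ t)) 2 volume).toReal) ^ 2 ≤
      4 * N₀ ^ 2 + 4 * Φ * Real.exp (k * ∫ σ in (0 : ℝ)..t, V σ) * (∫ τ in (0 : ℝ)..t, F τ) +
        Φ ^ 2 * (Real.exp (2 * k * ∫ σ in (0 : ℝ)..t, V σ) - 1) / 2 := by
  have hlog : 0 < Real.log 2 := Real.log_pos one_lt_two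
  have hK0 := hK.1
  have hIcc : Icc 0 t ⊆ Icc 0 T := fun τ hτ => ⟨hτ.1, hτ.2.trans ht.2⟩
  have hIoc : Ioc 0 t ⊆ Icc 0 T := Ioc_subset_Icc_self.trans hIcc
  set Λ : ℝ → ℝ := fun τ => ∫ σ in (0 : ℝ)..τ, V σ with hΛ
  set C := remainderConst K κ with hC
  have hC0 : 0 ≤ C := mul_nonneg (by positivity) (tsum_nonneg (interaction_nonneg κ))
  have hk0 : 0 ≤ k := by rw [hk]; positivity
  set Ω : ℝ := (2 : ℝ) ^ weightExp s σ M n with hΩ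
  have hΩ0 : 0 < Ω := Real.rpow_pos_of_pos two_pos _
  set W : ℝ → ℝ := fun τ => lossWeight s σ M (β * Λ τ / Real.log 2) n with hW
  have hWΩ : ∀ τ, W τ = Ω * Real.exp (-((n + 1) * (β * Λ τ))) := fun τ => lossWeight_eq_exp _ _ _ _ _
  have hW0 : ∀ τ, 0 < W τ := fun τ => lossWeight_pos _ _ _ _ _
  -- The exponents of the weight and of the Besov norm add up to at most s < 1. The 2 is the price
  -- of the index shift.
  have hΩs : Ω * (2 : ℝ) ^ ((1 - (n : ℝ)) * s) ≤ 2 := by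
    rw [hΩ, ← Real.rpow_add two_pos]
    calc _ ≤ (2 : ℝ) ^ (1 : ℝ) := by
          refine Real.rpow_le_rpow_of_exponent_le one_le_two ?_
          have : weightExp s σ M n ≤ n * s := min_le_left _ _
          linarith
      _ = 2 := Real.rpow_one 2
  have hVI : IntervalIntegrable V volume 0 t :=
    (intervalIntegrable_iff_integrableOn_Ioc_of_le ht.1).2 (D.integrable.mono_set hIoc)
  have hFI : IntervalIntegrable F volume 0 t :=
    (intervalIntegrable_iff_integrableOn_Ioc_of_le ht.1).2 (hF.mono_set hIoc)
  have hΛc : ContinuousOn Λ (Icc 0 t) := by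
    have := intervalIntegral.continuousOn_primitive_interval (μ := volume) (a := 0) (b := t)
      (f := V) (by rw [uIcc_of_le ht.1]; exact D.integrable.mono_set hIcc)
    rwa [uIcc_of_le ht.1] at this
  have hΛt : ∀ τ ∈ Icc 0 t, 0 ≤ Λ τ ∧ Λ τ ≤ Λ t := fun τ hτ =>
    ⟨D.primitive_nonneg (hIcc hτ), D.primitive_mono hτ.1 hτ.2 ht.2⟩
  set Y : ℝ → ℝ := fun τ => Φ * Real.exp (k * Λ τ) with hY
  have hY0 : ∀ τ, 0 ≤ Y τ := fun τ => by positivity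
  have hYc : ContinuousOn Y (Icc 0 t) :=
    continuousOn_const.mul (Real.continuous_exp.comp_continuousOn (continuousOn_const.mul hΛc))
  have hWc : ContinuousOn W (Icc 0 t) := by
    have : W = fun τ => Ω * Real.exp (-((n + 1) * (β * Λ τ))) := funext hWΩ
    rw [this]
    exact continuousOn_const.mul (Real.continuous_exp.comp_continuousOn
      (continuousOn_const.mul (continuousOn_const.mul hΛc)).neg)
  set h : ℝ → ℝ := fun τ => (2 : ℝ) ^ ((1 - (n : ℝ)) * s) * F τ +
    C * V τ * Real.sqrt (1 + n) * Y τ / W τ with hh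
  have hhint : IntegrableOn h (Ioc 0 t) := by
    have h1 : IntegrableOn (fun τ => V τ * (Y τ / W τ)) (Icc 0 t) :=
      (D.integrable.mono_set hIcc).mul_continuousOn
        (hYc.div hWc fun τ _ => (hW0 τ).ne') isCompact_Icc
    have h2 : h = fun τ => (2 : ℝ) ^ ((1 - (n : ℝ)) * s) * F τ +
        C * Real.sqrt (1 + n) * (V τ * (Y τ / W τ)) := by
      ext τ
      simp only [hh]
      ring
    rw [h2]
    exact ((hF.mono_set hIoc).const_mul _).add ((h1.mono_set Ioc_subset_Icc_self).const_mul _)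
  have hmem : ∀ᵐ τ ∂(volume.restrict (Ioc 0 t)), τ ∈ Ioc 0 t := ae_restrict_mem measurableSet_Ioc
  have hgrad := ae_restrict_of_ae_restrict_of_subset hIoc D.grad
  have hadv := ae_restrict_of_ae_restrict_of_subset hIoc D.adv
  have hV0 : ∀ᵐ τ ∂(volume.restrict (Ioc 0 t)), 0 ≤ V τ := hgrad.mono fun _ h => h.nonneg
  have hterm0 : ∀ τ, 0 ≤ V τ → 0 ≤ C * V τ * Real.sqrt (1 + n) * Y τ / W τ := fun τ hτ => by
    have h1 := hW0 τ
    have h2 := hY0 τ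
    positivity
  have E := D.energySetting hK ht n (h := h) (hm0 n) (fun τ hτ => hm τ (hIcc hτ) n)
    (by
      filter_upwards [hV0] with τ hτ
      have h1 := hF0 τ
      have h2 := hterm0 τ hτ
      simp only [hh]
      positivity)
    (by
      filter_upwards [hmem, hgrad, hadv, ae_restrict_of_ae_restrict_of_subset hIoc hfF]
        with τ h1 h2 h3 h4
      have h5 := h2.eLpNorm_advRemainder_le hK h3 n
      have hΛτ := hΛt τ (Ioc_subset_Icc_self h1)
      have h6 := tsum_remainder_le (M := M) (y := β * Λ τ / Real.log 2) hκ hσs hs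
        (div_nonneg (mul_nonneg hβ.le hΛτ.1) hlog.le)
        (by
          have : β * Λ τ / Real.log 2 ≤ ε := by
            rw [div_le_iff₀ hlog]
            exact (mul_le_mul_of_nonneg_left hΛτ.2 hβ.le).trans hβε
          linarith)
        (hz τ (Ioc_subset_Icc_self h1)) (C := 100 * (K + 1) ^ 3) (by positivity) h2.nonneg n
      have h7 := hF0 τ
      simp only [hh]
      rw [ENNReal.ofReal_add (by positivity) (hterm0 τ h2.nonneg)]
      exact add_le_add (h4 n) (h5.trans h6))
    hhint
  -- With this rate the integrating factor is the square of the weight, divided by Ω².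
  set lam : ℝ → ℝ := fun τ => 2 * β * (n + 1) * V τ with hlam
  set Ξ : ℝ → ℝ := fun τ => (Ω ^ 2)⁻¹ * (4 * (F τ * Y τ) + k * (V τ * Y τ ^ 2)) with hΞ
  have hFY : IntegrableOn (fun τ => F τ * Y τ) (Icc 0 t) :=
    (hF.mono_set hIcc).mul_continuousOn hYc isCompact_Icc
  have hVY : IntegrableOn (fun τ => V τ * Y τ ^ 2) (Icc 0 t) :=
    (D.integrable.mono_set hIcc).mul_continuousOn (hYc.pow 2) isCompact_Icc
  have hexp : ∀ τ, Real.exp (-∫ σ in (0 : ℝ)..τ, lam σ) = W τ ^ 2 * (Ω ^ 2)⁻¹ := by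
    intro τ
    rw [hWΩ, hlam, intervalIntegral.integral_const_mul, mul_pow, ← Real.exp_nat_mul]
    field_simp
    congr 1
    push_cast
    ring
  have hE := E.le (lam := lam) (Ξ := Ξ) ((D.integrable.mono_set hIoc).const_mul _)
    (by
      filter_upwards [hV0] with τ hτ
      simp only [hlam]
      positivity)
    ((((hFY.mono_set Ioc_subset_Icc_self).const_mul 4).add
      ((hVY.mono_set Ioc_subset_Icc_self).const_mul k)).const_mul _)
    (by
      filter_upwards [hmem, hV0] with τ h1 hVτ ζ hζ0 hζ
      have hWτ := hW0 τ
      have hX : W τ * ζ ≤ Y τ := by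
        rw [← ENNReal.ofReal_le_ofReal_iff (hY0 τ), ENNReal.ofReal_mul hWτ.le]
        exact (mul_le_mul' le_rfl hζ).trans (hz τ (Ioc_subset_Icc_self h1) n)
      have hX0 : 0 ≤ W τ * ζ := by positivity
      have hWF : W τ * (2 : ℝ) ^ ((1 - (n : ℝ)) * s) ≤ 2 := by
        refine le_trans (mul_le_mul_of_nonneg_right ?_ (by positivity)) hΩs
        rw [hWΩ]
        refine mul_le_of_le_one_right hΩ0.le ?_
        rw [Real.exp_le_one_iff, neg_nonpos]
        have := (hΛt τ (Ioc_subset_Icc_self h1)).1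
        positivity
      have habs := absorb_le (C := C) (X := W τ * ζ) (Y := Y τ) (N := 1 + n) hβ hVτ (by positivity)
      rw [← hk] at habs
      have hWh : W τ * h τ = W τ * (2 : ℝ) ^ ((1 - (n : ℝ)) * s) * F τ +
          C * V τ * Real.sqrt (1 + n) * Y τ := by
        simp only [hh]
        field_simp
      have h5 : 2 * (W τ * ζ) * (W τ * (2 : ℝ) ^ ((1 - (n : ℝ)) * s) * F τ) ≤ 4 * (F τ * Y τ) := by
        have h6 := hF0 τ
        have h7 := hY0 τ
        calc _ ≤ 2 * Y τ * (2 * F τ) := by gcongr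
          _ = _ := by ring
      rw [hexp]
      simp only [hΞ]
      rw [mul_comm (W τ ^ 2), mul_assoc]
      refine mul_le_mul_of_nonneg_left ?_ (by positivity)
      calc W τ ^ 2 * (2 * ζ * h τ - lam τ * ζ ^ 2)
          = 2 * (W τ * ζ) * (W τ * h τ) - lam τ * (W τ * ζ) ^ 2 := by ring
        _ = 2 * (W τ * ζ) * (W τ * (2 : ℝ) ^ ((1 - (n : ℝ)) * s) * F τ) +
            (2 * (W τ * ζ) * (C * V τ * Real.sqrt (1 + n) * Y τ) -
              2 * β * (1 + n) * V τ * (W τ * ζ) ^ 2) := by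
            rw [hWh]
            simp only [hlam]
            ring
        _ ≤ 4 * (F τ * Y τ) + k * V τ * Y τ ^ 2 := add_le_add h5 habs
        _ = _ := by ring)
  rw [hexp] at hE
  have hFYI : IntervalIntegrable (fun τ => F τ * Y τ) volume 0 t :=
    (intervalIntegrable_iff_integrableOn_Icc_of_le ht.1).2 hFY
  have hVYI : IntervalIntegrable (fun τ => V τ * Y τ ^ 2) volume 0 t :=
    (intervalIntegrable_iff_integrableOn_Icc_of_le ht.1).2 hVY
  have hΞint : ∫ τ in (0 : ℝ)..t, Ξ τ = (Ω ^ 2)⁻¹ * (4 * (∫ τ in (0 : ℝ)..t, F τ * Y τ) +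
      k * ∫ τ in (0 : ℝ)..t, V τ * Y τ ^ 2) := by
    simp only [hΞ]
    rw [intervalIntegral.integral_const_mul, intervalIntegral.integral_add (hFYI.const_mul 4)
      (hVYI.const_mul k), intervalIntegral.integral_const_mul, intervalIntegral.integral_const_mul]
  have hFYle : ∫ τ in (0 : ℝ)..t, F τ * Y τ ≤ Φ * Real.exp (k * Λ t) * ∫ τ in (0 : ℝ)..t, F τ := by
    rw [← intervalIntegral.integral_const_mul]
    refine intervalIntegral.integral_mono_on ht.1 hFYI (hFI.const_mul _) fun τ hτ => ?_
    rw [mul_comm]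
    refine mul_le_mul_of_nonneg_right ?_ (hF0 τ)
    simp only [hY]
    have := (hΛt τ hτ).2
    gcongr
  -- The integrand is half the derivative of exp(2kΛ), up to the factor Φ²; this produces the 1/2 in
  -- the conclusion.
  have hVYeq : k * ∫ τ in (0 : ℝ)..t, V τ * Y τ ^ 2 = Φ ^ 2 * (Real.exp (2 * k * Λ t) - 1) / 2 := by
    rw [← integral_mul_exp_primitive ht.1 hVI, ← intervalIntegral.integral_const_mul,
      mul_div_assoc, ← intervalIntegral.integral_div, ← intervalIntegral.integral_const_mul]
    refine intervalIntegral.integral_congr fun τ _ => ?_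
    simp only [hY, hΛ]
    rw [mul_pow, ← Real.exp_nat_mul]
    push_cast
    ring_nf
  have hz0 : Ω * (eLpNorm (multiplier (L.blockSymbol n) (ρ 0)) 2 volume).toReal ≤ 2 * N₀ := by
    have h1 : (eLpNorm (multiplier (L.blockSymbol n) (ρ 0)) 2 volume).toReal ≤
        (2 : ℝ) ^ ((1 - (n : ℝ)) * s) * N₀ :=
      ENNReal.toReal_le_of_le_ofReal (by positivity) (hρ₀ n)
    calc _ ≤ Ω * ((2 : ℝ) ^ ((1 - (n : ℝ)) * s) * N₀) := by gcongr
      _ = Ω * (2 : ℝ) ^ ((1 - (n : ℝ)) * s) * N₀ := by ring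
      _ ≤ 2 * N₀ := by gcongr
  set z := (eLpNorm (multiplier (L.blockSymbol n) (ρ t)) 2 volume).toReal
  set z0 := (eLpNorm (multiplier (L.blockSymbol n) (ρ 0)) 2 volume).toReal with hz0_def
  have hz00 : 0 ≤ z0 := ENNReal.toReal_nonneg
  rw [hΞint, hVYeq] at hE
  have hE2 := mul_le_mul_of_nonneg_left hE (sq_nonneg Ω)
  have e1 : Ω ^ 2 * (W t ^ 2 * (Ω ^ 2)⁻¹ * z ^ 2) = (W t * z) ^ 2 := by
    field_simp
  have e2 : ∀ q, Ω ^ 2 * (z0 ^ 2 + (Ω ^ 2)⁻¹ * q) = (Ω * z0) ^ 2 + q := by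
    intro q
    field_simp
  rw [e1, e2] at hE2
  have h9 : (Ω * z0) ^ 2 ≤ 4 * N₀ ^ 2 := by
    have : (Ω * z0) ^ 2 ≤ (2 * N₀) ^ 2 := by gcongr
    linarith
  calc (W t * z) ^ 2 ≤ _ := hE2
    _ ≤ _ := by linarith

end Gronwall

end LosingTransport

namespace LosingTransport

/-! ### The losing estimate -/

section Losing

variable {L : DyadicCouple} {K T : ℝ} {v : ℝ → Fin 2 → 𝓢'(Plane, ℂ)} {V : ℝ → ℝ}
  {f ρ P : ℝ → 𝓢'(Plane, ℂ)}

/-- Gronwall's argument by an exponential weight: with Φ the supremum over times and blocks of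
exp(−kΛ) times the weighted norm, the energy estimate reads Φ² ≤ 4N₀² + 4ΦQ + Φ²/2. No continuity in
time of the supremum is needed, only its finiteness. -/
theorem TransportData.weighted_bound (D : TransportData L T v V f ρ P) (hK : KernelBound L K)
    {s σ κ ε β : ℝ} (M : ℝ) (hκ : 0 < κ) (hσs : σ ≤ s) (hs : s ≤ 1 - κ) (hσ : -1 + κ ≤ σ - ε)
    (hβ : 0 < β) {t : ℝ} (ht : t ∈ Icc 0 T)
    (hβε : β * (∫ σ in (0 : ℝ)..t, V σ) ≤ ε * Real.log 2)
    {F : ℝ → ℝ} (hF : IntegrableOn F (Icc 0 T)) (hF0 : ∀ τ, 0 ≤ F τ)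
    (hfF : ∀ᵐ τ ∂(volume.restrict (Icc 0 T)), ∀ n : ℕ,
      eLpNorm (multiplier (L.blockSymbol n) (f τ)) 2 volume ≤
        ENNReal.ofReal ((2 : ℝ) ^ ((1 - (n : ℝ)) * s) * F τ))
    {N₀ : ℝ} (hN₀ : 0 ≤ N₀) (hρ₀ : ∀ n : ℕ, eLpNorm (multiplier (L.blockSymbol n) (ρ 0)) 2 volume ≤
        ENNReal.ofReal ((2 : ℝ) ^ ((1 - (n : ℝ)) * s) * N₀))
    {B : ℝ} (hB0 : 0 ≤ B) (hB : ∀ τ ∈ Icc 0 T, ∀ n : ℕ,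
      eLpNorm (multiplier (L.blockSymbol n) (ρ τ)) 2 volume ≤
        ENNReal.ofReal ((2 : ℝ) ^ ((1 - (n : ℝ)) * σ) * B))
    {k : ℝ} (hk : k = remainderConst K κ ^ 2 / (2 * β)) (n : ℕ) :
    lossWeight s σ M (β * (∫ σ in (0 : ℝ)..t, V σ) / Real.log 2) n *
      (eLpNorm (multiplier (L.blockSymbol n) (ρ t)) 2 volume).toReal ≤
      8 * (N₀ + ∫ τ in (0 : ℝ)..t, F τ) * Real.exp (k * ∫ σ in (0 : ℝ)..t, V σ) := by
  have hlog : 0 < Real.log 2 := Real.log_pos one_lt_two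
  have hk0 : 0 ≤ k := by rw [hk]; positivity
  have hIcc : ∀ τ ∈ Icc 0 t, τ ∈ Icc 0 T := fun τ hτ => ⟨hτ.1, hτ.2.trans ht.2⟩
  set Λ : ℝ → ℝ := fun τ => ∫ σ in (0 : ℝ)..τ, V σ with hΛ
  have hΛ0 : ∀ τ ∈ Icc 0 t, 0 ≤ Λ τ := fun τ hτ => D.primitive_nonneg (hIcc τ hτ)
  set w : ℝ → ℕ → ℝ := fun τ n => lossWeight s σ M (β * Λ τ / Real.log 2) n *
    (eLpNorm (multiplier (L.blockSymbol n) (ρ τ)) 2 volume).toReal with hw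
  have hw0 : ∀ τ n, 0 ≤ w τ n := fun τ n =>
    mul_nonneg (lossWeight_pos _ _ _ _ _).le ENNReal.toReal_nonneg
  set S : Set ℝ := {y | ∃ τ ∈ Icc 0 t, ∃ n, y = Real.exp (-(k * Λ τ)) * w τ n} with hS
  -- The truncation serves here: the weight is at most 2^{M+nσ}, and the a priori regularity makes
  -- the supremum finite. The bound found here does not enter the conclusion.
  have hSbdd : BddAbove S := by
    refine ⟨(2 : ℝ) ^ (M + σ) * B, ?_⟩
    rintro y ⟨τ, hτ, n, rfl⟩
    have h1 := hΛ0 τ hτ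
    have h2 : Real.exp (-(k * Λ τ)) ≤ 1 :=
      Real.exp_le_one_iff.2 (neg_nonpos.2 (mul_nonneg hk0 h1))
    refine (mul_le_of_le_one_left (hw0 τ n) h2).trans ?_
    have h3 : lossWeight s σ M (β * Λ τ / Real.log 2) n ≤ (2 : ℝ) ^ (M + n * σ) := by
      refine Real.rpow_le_rpow_of_exponent_le one_le_two ?_
      have h4 : weightExp s σ M n ≤ M + n * σ := min_le_right _ _
      have h5 : 0 ≤ (n + 1) * (β * Λ τ / Real.log 2) := by positivity
      linarith
    have h6 : (eLpNorm (multiplier (L.blockSymbol n) (ρ τ)) 2 volume).toReal ≤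
        (2 : ℝ) ^ ((1 - (n : ℝ)) * σ) * B :=
      ENNReal.toReal_le_of_le_ofReal (by positivity) (hB τ (hIcc τ hτ) n)
    calc w τ n ≤ (2 : ℝ) ^ (M + n * σ) * ((2 : ℝ) ^ ((1 - (n : ℝ)) * σ) * B) :=
          mul_le_mul h3 h6 ENNReal.toReal_nonneg (by positivity)
      _ = (2 : ℝ) ^ (M + σ) * B := by
          rw [← mul_assoc, ← Real.rpow_add two_pos]
          ring_nf
  have h0t : (0 : ℝ) ∈ Icc 0 t := ⟨le_rfl, ht.1⟩
  have hSne : S.Nonempty := ⟨_, 0, h0t, 0, rfl⟩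
  set Φ := sSup S with hΦ_def
  have hle : ∀ τ ∈ Icc 0 t, ∀ n, Real.exp (-(k * Λ τ)) * w τ n ≤ Φ := fun τ hτ n =>
    le_csSup hSbdd ⟨τ, hτ, n, rfl⟩
  have hwle : ∀ τ ∈ Icc 0 t, ∀ n, w τ n ≤ Φ * Real.exp (k * Λ τ) := by
    intro τ hτ n
    have h1 := hle τ hτ n
    rwa [Real.exp_neg, inv_mul_le_iff₀ (Real.exp_pos _), mul_comm] at h1
  have hΦ : 0 ≤ Φ := le_trans (mul_nonneg (Real.exp_pos _).le (hw0 0 0)) (hle 0 h0t 0)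
  set Q := ∫ τ in (0 : ℝ)..t, F τ with hQ
  have hFI : ∀ τ ∈ Icc 0 t, IntervalIntegrable F volume 0 τ := fun τ hτ =>
    (intervalIntegrable_iff_integrableOn_Icc_of_le hτ.1).2
      (hF.mono_set (Icc_subset_Icc_right (hτ.2.trans ht.2)))
  have hQ0 : 0 ≤ Q := intervalIntegral.integral_nonneg ht.1 fun τ _ => hF0 τ
  have hQle : ∀ τ ∈ Icc 0 t, ∫ τ in (0 : ℝ)..τ, F τ ≤ Q := fun τ hτ =>
    intervalIntegral.integral_mono_interval le_rfl hτ.1 hτ.2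
      (Eventually.of_forall hF0) (hFI t ⟨ht.1, le_rfl⟩)
  have hz : ∀ τ ∈ Icc 0 t, ∀ n,
      ENNReal.ofReal (lossWeight s σ M (β * Λ τ / Real.log 2) n) *
        eLpNorm (multiplier (L.blockSymbol n) (ρ τ)) 2 volume ≤
          ENNReal.ofReal (Φ * Real.exp (k * Λ τ)) := by
    intro τ hτ n
    have hfin : eLpNorm (multiplier (L.blockSymbol n) (ρ τ)) 2 volume ≠ ⊤ :=
      ((hB τ (hIcc τ hτ) n).trans_lt ENNReal.ofReal_lt_top).ne
    rw [← ENNReal.ofReal_toReal hfin, ← ENNReal.ofReal_mul (lossWeight_pos _ _ _ _ _).le]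
    exact ENNReal.ofReal_le_ofReal (hwle τ hτ n)
  have hsq : ∀ y ∈ S, y ^ 2 ≤ 4 * N₀ ^ 2 + 4 * Φ * Q + Φ ^ 2 / 2 := by
    rintro y ⟨τ, hτ, n, rfl⟩
    have hβτ : β * Λ τ ≤ ε * Real.log 2 :=
      (mul_le_mul_of_nonneg_left (D.primitive_mono hτ.1 hτ.2 ht.2) hβ.le).trans hβε
    have h1 := D.weighted_le hK (M := M) hκ hσs hs hσ hβ (hIcc τ hτ) hβτ hF hF0 hfF hN₀ hρ₀
      (m := fun n => (2 : ℝ) ^ ((1 - (n : ℝ)) * σ) * B) (fun n => by positivity) hB hk hΦ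
      (fun x hx => hz x ⟨hx.1, hx.2.trans hτ.2⟩) n
    change w τ n ^ 2 ≤ 4 * N₀ ^ 2 + 4 * Φ * Real.exp (k * Λ τ) * (∫ τ in (0 : ℝ)..τ, F τ) +
      Φ ^ 2 * (Real.exp (2 * k * Λ τ) - 1) / 2 at h1
    set E := Real.exp (k * Λ τ) with hE
    have hE1 : 1 ≤ E := Real.one_le_exp (mul_nonneg hk0 (hΛ0 τ hτ))
    have hE2 : Real.exp (2 * k * Λ τ) = E ^ 2 := by
      rw [hE, ← Real.exp_nat_mul]
      push_cast
      ring_nf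
    rw [Real.exp_neg, ← hE, mul_pow, inv_pow, inv_mul_le_iff₀ (by positivity)]
    refine h1.trans ?_
    rw [hE2]
    have hEE : E ≤ E ^ 2 := by nlinarith
    have h2 : 4 * Φ * E * (∫ τ in (0 : ℝ)..τ, F τ) ≤ 4 * Φ * E ^ 2 * Q := by
      have := hQle τ hτ
      have h3 : 0 ≤ ∫ τ in (0 : ℝ)..τ, F τ := intervalIntegral.integral_nonneg hτ.1 fun τ _ => hF0 τ
      gcongr
    have h4 : 4 * N₀ ^ 2 ≤ E ^ 2 * (4 * N₀ ^ 2) :=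
      le_mul_of_one_le_left (by positivity) (hE1.trans hEE)
    nlinarith [sq_nonneg Φ]
  have hΦsq : Φ ^ 2 ≤ 4 * N₀ ^ 2 + 4 * Φ * Q + Φ ^ 2 / 2 := by
    rw [← Real.le_sqrt hΦ (by positivity)]
    exact csSup_le hSne fun y hy => Real.le_sqrt_of_sq_le (hsq y hy)
  -- If Φ exceeded this value, Φ²/2 would be larger than 4ΦN₀ + 4ΦQ, contradicting the quadratic
  -- inequality.
  have hΦle : Φ ≤ 8 * (N₀ + Q) := by
    by_contra hcon
    push Not at hcon
    nlinarith [mul_nonneg hN₀ hQ0, mul_nonneg hN₀ hΦ, mul_nonneg hQ0 hΦ, sq_nonneg N₀]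
  refine (hwle t ⟨ht.1, le_rfl⟩ n).trans ?_
  gcongr

/-- As the bound does not depend on the truncation, it is chosen for each `n` as n(s−σ), so that it
is inactive at that index. The constant is 16 = 2·8, and `2 * ε ≤ s + 1` is what the index shift
requires for the factor 2. -/
theorem TransportData.besovNorm_loss_le (D : TransportData L T v V f ρ P) (hK : KernelBound L K)
    {s σ κ ε β : ℝ} (hκ : 0 < κ) (hσs : σ ≤ s) (hs : s ≤ 1 - κ) (hσ : -1 + κ ≤ σ - ε)
    (hεs : 2 * ε ≤ s + 1) (hβ : 0 < β) {t : ℝ} (ht : t ∈ Icc 0 T)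
    (hβε : β * (∫ σ in (0 : ℝ)..t, V σ) ≤ ε * Real.log 2)
    {F : ℝ → ℝ} (hF : IntegrableOn F (Icc 0 T)) (hF0 : ∀ τ, 0 ≤ F τ)
    (hfF : ∀ᵐ τ ∂(volume.restrict (Icc 0 T)), ∀ n : ℕ,
      eLpNorm (multiplier (L.blockSymbol n) (f τ)) 2 volume ≤
        ENNReal.ofReal ((2 : ℝ) ^ ((1 - (n : ℝ)) * s) * F τ))
    {N₀ : ℝ} (hN₀ : 0 ≤ N₀) (hρ₀ : ∀ n : ℕ, eLpNorm (multiplier (L.blockSymbol n) (ρ 0)) 2 volume ≤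
        ENNReal.ofReal ((2 : ℝ) ^ ((1 - (n : ℝ)) * s) * N₀))
    {B : ℝ} (hB0 : 0 ≤ B) (hB : ∀ τ ∈ Icc 0 T, ∀ n : ℕ,
      eLpNorm (multiplier (L.blockSymbol n) (ρ τ)) 2 volume ≤
        ENNReal.ofReal ((2 : ℝ) ^ ((1 - (n : ℝ)) * σ) * B)) :
    L.besovNorm (s - ε) (ρ t) ≤ ENNReal.ofReal (16 *
      Real.exp (remainderConst K κ ^ 2 / (2 * β) * ∫ σ in (0 : ℝ)..t, V σ) *
        (N₀ + ∫ τ in (0 : ℝ)..t, F τ)) := by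
  rw [besovNorm_eq]
  refine iSup_le fun n => ?_
  have hlog : 0 < Real.log 2 := Real.log_pos one_lt_two
  have h1 := D.weighted_bound hK (n * (s - σ)) hκ hσs hs hσ hβ ht hβε hF hF0 hfF hN₀ hρ₀ hB0 hB
    rfl n
  set Λ := ∫ σ in (0 : ℝ)..t, V σ
  have hfin : eLpNorm (multiplier (L.blockSymbol n) (ρ t)) 2 volume ≠ ⊤ :=
    ((hB t ht n).trans_lt ENNReal.ofReal_lt_top).ne
  rw [← ENNReal.ofReal_toReal hfin, ← ENNReal.ofReal_mul (by positivity)]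
  refine ENNReal.ofReal_le_ofReal ?_
  have h2 : (2 : ℝ) ^ (((n : ℝ) - 1) * (s - ε)) ≤
      2 * lossWeight s σ (n * (s - σ)) (β * Λ / Real.log 2) n := by
    nth_rewrite 2 [← Real.rpow_one 2]
    rw [lossWeight, ← Real.rpow_add two_pos]
    refine Real.rpow_le_rpow_of_exponent_le one_le_two ?_
    have h3 : β * Λ / Real.log 2 ≤ ε := (div_le_iff₀ hlog).2 hβε
    have h4 : weightExp s σ (n * (s - σ)) n = n * s := by
      rw [weightExp, min_eq_left]
      linarith
    rw [h4]
    have h5 : ((n : ℝ) + 1) * (β * Λ / Real.log 2) ≤ (n + 1) * ε := by gcongr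
    linarith
  calc _ ≤ 2 * lossWeight s σ (n * (s - σ)) (β * Λ / Real.log 2) n *
        (eLpNorm (multiplier (L.blockSymbol n) (ρ t)) 2 volume).toReal := by gcongr
    _ ≤ 2 * (8 * (N₀ + ∫ τ in (0 : ℝ)..t, F τ) *
        Real.exp (remainderConst K κ ^ 2 / (2 * β) * Λ)) := by
      rw [mul_assoc]
      gcongr
    _ = _ := by ring

/-- The losing estimate for a solution bounded in time with values in `B^σ_{2,∞}`. -/
theorem TransportData.losing_estimate (D : TransportData L T v V f ρ P) (hK : KernelBound L K)
    {s σ κ ε : ℝ} (hκ : 0 < κ) (hσs : σ ≤ s) (hs : s ≤ 1 - κ) (hσ : -1 + κ ≤ σ - ε)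
    (hε : 0 < ε) (hεs : 2 * ε ≤ s + 1) (hρ₀ : L.MemBesov s (ρ 0)) (hf : L.MemL1Besov s T f)
    (hρ : (⨆ t ∈ Icc 0 T, L.besovNorm σ (ρ t)) < ⊤) {t : ℝ} (ht : t ∈ Icc 0 T) :
    L.besovNorm (s - ε) (ρ t) ≤ ENNReal.ofReal (16 * Real.exp
      (remainderConst K κ ^ 2 / (2 * Real.log 2) / ε * (∫ σ in (0 : ℝ)..t, V σ) ^ 2)) *
        (L.besovNorm s (ρ 0) + ∫⁻ τ in Icc 0 t, L.besovNorm s (f τ)) := by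
  have hlog : 0 < Real.log 2 := Real.log_pos one_lt_two
  have hΛ0 := D.primitive_nonneg ht
  set Λ := ∫ σ in (0 : ℝ)..t, V σ with hΛ
  -- The whole loss is spent by time t: β = ε log 2/Λ, which turns the exponent into a multiple of
  -- Λ²/ε. If Λ = 0, any positive β will do.
  obtain ⟨β, hβ, hβε, hβk⟩ : ∃ β : ℝ, 0 < β ∧ β * Λ ≤ ε * Real.log 2 ∧
      remainderConst K κ ^ 2 / (2 * β) * Λ =
        remainderConst K κ ^ 2 / (2 * Real.log 2) / ε * Λ ^ 2 := by
    rcases hΛ0.eq_or_lt with h | h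
    · exact ⟨1, one_pos, by
        rw [← h, mul_zero]
        positivity, by rw [← h]; simp⟩
    · refine ⟨ε * Real.log 2 / Λ, by positivity, (div_mul_cancel₀ _ h.ne').le, ?_⟩
      field_simp
  have hmeas := aemeasurable_besovNorm L s hf.1
  have hFint : IntegrableOn (fun τ => (L.besovNorm s (f τ)).toReal) (Icc 0 T) :=
    integrable_toReal_of_lintegral_ne_top hmeas hf.2.ne
  have hae : ∀ᵐ τ ∂(volume.restrict (Icc 0 T)), L.besovNorm s (f τ) < ⊤ :=
    ae_lt_top' hmeas hf.2.ne
  have hblock : ∀ {r : ℝ} {u : 𝓢'(Plane, ℂ)}, L.besovNorm r u ≠ ⊤ → ∀ n : ℕ,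
      eLpNorm (multiplier (L.blockSymbol n) u) 2 volume ≤
        ENNReal.ofReal ((2 : ℝ) ^ ((1 - (n : ℝ)) * r) * (L.besovNorm r u).toReal) := by
    intro r u hu n
    rw [ENNReal.ofReal_mul (by positivity), ENNReal.ofReal_toReal hu]
    exact eLpNorm_block_le_besovNorm L r u n
  have hB : ∀ τ ∈ Icc 0 T, ∀ n : ℕ, eLpNorm (multiplier (L.blockSymbol n) (ρ τ)) 2 volume ≤
      ENNReal.ofReal ((2 : ℝ) ^ ((1 - (n : ℝ)) * σ) *
        (⨆ t ∈ Icc 0 T, L.besovNorm σ (ρ t)).toReal) := by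
    intro τ hτ n
    rw [ENNReal.ofReal_mul (by positivity), ENNReal.ofReal_toReal hρ.ne]
    exact (eLpNorm_block_le_besovNorm L σ _ n).trans
      (mul_le_mul_right (le_iSup₂ (f := fun t (_ : t ∈ Icc 0 T) => L.besovNorm σ (ρ t)) τ hτ) _)
  have h1 := D.besovNorm_loss_le hK hκ hσs hs hσ hεs hβ ht hβε hFint
    (fun τ => ENNReal.toReal_nonneg) (hae.mono fun τ hτ => hblock hτ.ne) ENNReal.toReal_nonneg
    (hblock hρ₀.ne) ENNReal.toReal_nonneg hB
  rw [hβk, ENNReal.ofReal_mul (by positivity)] at h1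
  refine h1.trans (le_of_eq ?_)
  congr 1
  have hsub : Icc 0 t ⊆ Icc 0 T := Icc_subset_Icc_right ht.2
  rw [ENNReal.ofReal_add ENNReal.toReal_nonneg
    (intervalIntegral.integral_nonneg ht.1 fun τ _ => ENNReal.toReal_nonneg),
    ENNReal.ofReal_toReal hρ₀.ne, intervalIntegral.integral_of_le ht.1, ← integral_Icc_eq_integral_Ioc,
    integral_toReal (hmeas.mono_set hsub) (ae_restrict_of_ae_restrict_of_subset hsub hae),
    ENNReal.ofReal_toReal]
  exact ((lintegral_mono_set hsub).trans_lt hf.2).ne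

/-- The losing estimate does not depend on the a priori regularity of the solution. -/
theorem TransportData.losing_estimate_of_neg_one_lt (D : TransportData L T v V f ρ P)
    (hK : KernelBound L K) {s σ ε : ℝ} (hs : s ∈ Ioo (-1 : ℝ) 1) (hσ : -1 < σ)
    (hε : ε ∈ Ioo (0 : ℝ) ((s + 1) / 2)) (hρ₀ : L.MemBesov s (ρ 0)) (hf : L.MemL1Besov s T f)
    (hρ : (⨆ t ∈ Icc 0 T, L.besovNorm σ (ρ t)) < ⊤) {t : ℝ} (ht : t ∈ Icc 0 T) :
    L.besovNorm (s - ε) (ρ t) ≤ ENNReal.ofReal (16 * Real.exp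
      (remainderConst K (min ((s + 1) / 4) (1 - s)) ^ 2 / (2 * Real.log 2) / ε *
        (∫ σ in (0 : ℝ)..t, V σ) ^ 2)) *
        (L.besovNorm s (ρ 0) + ∫⁻ τ in Icc 0 t, L.besovNorm s (f τ)) := by
  obtain ⟨hs1, hs2⟩ := hs
  have hlog : 0 < Real.log 2 := Real.log_pos one_lt_two
  have hbdd : ∀ {r r' : ℝ}, r ≤ r' → (⨆ t ∈ Icc 0 T, L.besovNorm r' (ρ t)) < ⊤ →
      (⨆ t ∈ Icc 0 T, L.besovNorm r (ρ t)) < ⊤ := by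
    intro r r' hr h
    refine lt_of_le_of_lt (iSup₂_le fun τ hτ => ?_)
      (ENNReal.mul_lt_top (ENNReal.ofReal_lt_top (r := (2 : ℝ) ^ (r' - r))) h)
    exact (besovNorm_le_of_le L hr _).trans (mul_le_mul_right
      (le_iSup₂ (f := fun t (_ : t ∈ Icc 0 T) => L.besovNorm r' (ρ t)) τ hτ) _)
  have hσ' : -1 < min σ s := lt_min hσ hs1
  -- First pass, for finiteness only: half of the distance from min(σ, s) to −1 is allotted to the
  -- loss and half to κ'. The resulting constant depends on σ, but it does not enter the conclusion.
  set ε' := min ((s + 1) / 4) ((min σ s + 1) / 2) with hε'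
  have hε'0 : 0 < ε' := lt_min (by linarith) (by linarith)
  have hε'1 : ε' ≤ (s + 1) / 4 := min_le_left _ _
  have hε'2 : ε' ≤ (min σ s + 1) / 2 := min_le_right _ _
  set κ' := min (1 - s) ((min σ s + 1) / 2) with hκ'
  have hκ'0 : 0 < κ' := lt_min (by linarith) (by linarith)
  have hκ'1 : κ' ≤ 1 - s := min_le_left _ _
  have hκ'2 : κ' ≤ (min σ s + 1) / 2 := min_le_right _ _
  have hρ' : (⨆ t ∈ Icc 0 T, L.besovNorm (s - ε') (ρ t)) < ⊤ := by
    have hT : (0 : ℝ) ≤ T := ht.1.trans ht.2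
    refine lt_of_le_of_lt (iSup₂_le fun τ hτ => ?_) (b := ENNReal.ofReal (16 * Real.exp
      (remainderConst K κ' ^ 2 / (2 * Real.log 2) / ε' * (∫ σ in (0 : ℝ)..T, V σ) ^ 2)) *
        (L.besovNorm s (ρ 0) + ∫⁻ τ in Icc 0 T, L.besovNorm s (f τ)))
      (ENNReal.mul_lt_top ENNReal.ofReal_lt_top (ENNReal.add_lt_top.2 ⟨hρ₀, hf.2⟩))
    refine (D.losing_estimate hK hκ'0 (min_le_right σ s) (by linarith) (by linarith) hε'0
      (by linarith) hρ₀ hf (hbdd (min_le_left σ s) hρ) hτ).trans ?_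
    refine mul_le_mul' (ENNReal.ofReal_le_ofReal ?_)
      (add_le_add le_rfl (lintegral_mono_set (Icc_subset_Icc_right hτ.2)))
    have h1 := D.primitive_nonneg hτ
    have h2 := D.primitive_mono hτ.1 hτ.2 le_rfl
    gcongr
  -- Second pass, with s − ε' as a priori regularity. Here κ + ε' + ε is below s + 1 since the three
  -- terms take at most a quarter, a quarter and a half, so κ depends on s alone.
  set κ := min ((s + 1) / 4) (1 - s) with hκ
  have hκ0 : 0 < κ := lt_min (by linarith) (by linarith)
  have hκ1 : κ ≤ (s + 1) / 4 := min_le_left _ _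
  have hκ2 : κ ≤ 1 - s := min_le_right _ _
  have hε2 := hε.2
  exact D.losing_estimate hK hκ0 (by linarith) (by linarith) (by linarith) hε.1 (by linarith)
    hρ₀ hf hρ' ht

end Losing

end LosingTransport

/-! ### The estimate for weak solutions. -/

theorem proposition16 (L : LosingTransport.DyadicCouple) (s : ℝ) (hs : s ∈ Ioo (-1 : ℝ) 1) :
    ∃ C : ℝ, 0 < C ∧
      ∀ (T : ℝ) (_ : 0 < T)
        (v : ℝ → Fin 2 → 𝓢'(LosingTransport.Plane, ℂ)) (V : ℝ → ℝ)
        (f : ℝ → 𝓢'(LosingTransport.Plane, ℂ)) (ρ₀ : 𝓢'(LosingTransport.Plane, ℂ))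
        (ρ : ℝ → 𝓢'(LosingTransport.Plane, ℂ)),
        LosingTransport.IsVelocityField T v →
        (∀ᵐ t ∂(volume.restrict (Icc 0 T)), LosingTransport.divergence (v t) = 0) →
        IntegrableOn V (Icc 0 T) →
        (∀ᵐ t ∂(volume.restrict (Icc 0 T)), 0 ≤ V t ∧
          (⨆ N : ℕ, L.gradLowNorm N (v t) / ENNReal.ofReal (Real.sqrt (1 + N))) ≤
            ENNReal.ofReal (V t)) →
        L.MemBesov s ρ₀ →
        L.MemL1Besov s T f →
        L.IsTransportSolution T v f ρ₀ ρ →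
        ∀ ε ∈ Ioo (0 : ℝ) ((s + 1) / 2), ∀ t ∈ Icc 0 T,
          L.besovNorm (s - ε) (ρ t) ≤
            ENNReal.ofReal (C * Real.exp (C / ε * (∫ τ in (0 : ℝ)..t, V τ) ^ 2)) *
              (L.besovNorm s ρ₀ + ∫⁻ τ in Icc 0 t, L.besovNorm s (f τ)) := by
  obtain ⟨K, hK⟩ := LosingTransport.exists_kernelBound L
  have hlog : 0 < Real.log 2 := Real.log_pos one_lt_two
  set c := LosingTransport.remainderConst K (min ((s + 1) / 4) (1 - s)) ^ 2 / (2 * Real.log 2)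
    with hc
  have hc0 : 0 ≤ c := by positivity
  -- A single constant dominates both the prefactor 16 and the coefficient c of the exponent.
  refine ⟨16 + c, by linarith, fun T hT v V f ρ₀ ρ hv hdiv hV hVbd hρ₀ hf hsol ε hε t ht => ?_⟩
  obtain ⟨⟨σ, hσ, hρ⟩, P, hadv, heq⟩ := hsol
  have h0 : ρ 0 = ρ₀ := by
    ext θ
    simpa using (heq θ).2.2 0 ⟨le_rfl, hT.le⟩
  have D : LosingTransport.TransportData L T v V f ρ P := by
    refine ⟨hv.2, hV, ?_, hadv, fun θ => (heq θ).1, fun θ => (heq θ).2.1, fun θ τ hτ => ?_⟩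
    · filter_upwards [hdiv, hVbd, ae_restrict_mem measurableSet_Icc] with τ h1 h2 h3
      exact LosingTransport.gradBound_of_iSup_le (hv.1 τ h3) h1 h2.1 h2.2
    · rw [h0]
      exact (heq θ).2.2 τ hτ
  have h := D.losing_estimate_of_neg_one_lt hK hs hσ hε (h0 ▸ hρ₀) hf hρ ht
  rw [h0] at h
  refine h.trans (mul_le_mul' (ENNReal.ofReal_le_ofReal ?_) le_rfl)
  have hε0 := hε.1
  gcongr <;> linarith
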